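/- A group $X$ is an icc-group if for every first-order formula $\varphi(x,\bar y)$ of the language of groups there is an $n\in\mathbb N$ such that every chain of subgroups of $X$, each of which is the intersection of a (finite or infinite) family of subgroups of the form $\varphi(X,\bar a)=\{x\in X:\varphi(x,\bar a)\}$ with parameters $\bar a$ from $X$, has at most $n$ members. A sub-icc group is a group isomorphic to a subgroup of an icc-group. Lemma. Let $G$ be a periodic, locally soluble sub-icc group (locally soluble: every finitely generated subgroup is soluble) such that for every prime $p$, every $p$-subgroup of $G$ satisfies the minimal condition on subgroups. Then $G$ is virtually abelian, that is, $G$ has an abelian subgroup of finite index. -/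

import Mathlib

universe u v

namespace SubIcc

/-- The function symbols of the first-order language of groups: product, inverse, identity. -/
inductive GroupFunc : ℕ → Type
  | mul : GroupFunc 2
  | inv : GroupFunc 1
  | one : GroupFunc 0

/-- The first-order language of groups (with equality and no relation symbols). -/
def groupLanguage : FirstOrder.Language.{0, 0} := ⟨GroupFunc, fun _ => Empty⟩

/-- Every group is a structure for the language of groups, with the standard interpretation. -/
instance groupStructure (X : Type v) [Group X] : groupLanguage.Structure X where
  funMap {_} f :=
    match f with
    | .mul => fun x => x 0 * x 1
    | .inv => fun x => (x 0)⁻¹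
    | .one => fun _ => 1
  RelMap {_} r := Empty.elim r

/-- The solution set `φ(X, a)` of a formula `φ(x, y₀, …, yₘ₋₁)` with the parameters `a` from `X`
substituted for `y`. The variable `x` is `Sum.inl ()`, the variable `yᵢ` is `Sum.inr i`. -/
def solutionSet {X : Type v} [Group X] {m : ℕ} (φ : groupLanguage.Formula (Unit ⊕ Fin m))
    (a : Fin m → X) : Set X :=
  {x | φ.Realize (Sum.elim (fun _ => x) a)}

/-- The subgroups of `X` of the form `φ(X, a)`: a uniformly definable family of subgroups. -/
def definableSubgroups (X : Type v) [Group X] {m : ℕ}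
    (φ : groupLanguage.Formula (Unit ⊕ Fin m)) : Set (Subgroup X) :=
  {H | ∃ a : Fin m → X, (H : Set X) = solutionSet φ a}

/-- The intersections `⋂ᵢ φ(X, aᵢ)` of arbitrary (finite or infinite) families of subgroups
of `X` of the form `φ(X, a)`. -/
def definableIntersections (X : Type v) [Group X] {m : ℕ}
    (φ : groupLanguage.Formula (Unit ⊕ Fin m)) : Set (Subgroup X) :=
  {H | ∃ S : Set (Subgroup X), S ⊆ definableSubgroups X φ ∧ H = sInf S}

/-- An icc-group: for each formula `φ(x, y)` of the language of groups there is a bound `n` on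
the length of all chains of intersections of subgroups defined by instances of `φ`. -/
def IsIcc (X : Type v) [Group X] : Prop :=
  ∀ (m : ℕ) (φ : groupLanguage.Formula (Unit ⊕ Fin m)), ∃ n : ℕ,
    ∀ C : Set (Subgroup X), C ⊆ definableIntersections X φ → IsChain (· ≤ ·) C → C.encard ≤ n

/-- A sub-icc group: a group isomorphic to a subgroup of an icc-group. -/
def IsSubIcc (G : Type u) [Group G] : Prop :=
  ∃ (X : Type v) (_ : Group X), IsIcc X ∧ ∃ H : Subgroup X, Nonempty (G ≃* H)

/-- Every finitely generated subgroup is soluble. -/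
def IsLocallySoluble (G : Type u) [Group G] : Prop :=
  ∀ H : Subgroup G, H.FG → Group.IsSolvable H

/-- The minimal condition on subgroups: every non-empty set of subgroups has a minimal member. -/
def MinimalCondition (G : Type u) [Group G] : Prop :=
  ∀ S : Set (Subgroup G), S.Nonempty → ∃ H, Minimal (· ∈ S) H

/-- There is an abelian subgroup of finite index. -/
def IsVirtuallyAbelian (G : Type u) [Group G] : Prop :=
  ∃ A : Subgroup G, IsMulCommutative A ∧ A.FiniteIndex

end SubIcc

/-! The icc hypothesis enters only through the descending chain condition on centralizers.
Periodicity and local solubility make G locally finite. By Noetherian induction on centralizers, all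
proper centralizers in G may be taken virtually abelian. By the chain condition, the common
centralizer of all elements with finitely many conjugates is already that of finitely many of them,
so it has finite index. Hence G is virtually abelian or these elements are central. In the latter
case the quotient K of G by its centre has no nontrivial element with finitely many conjugates, and
the centralizers of its nontrivial elements are virtually abelian. It remains to see that K is
trivial (`HasSmallCentralizers.subsingleton`).

Suppose K ≠ 1. An abelian normal subgroup has finitely many elements of each exponent, so all its
elements have finitely many conjugates and it is trivial. Thus K has no nontrivial soluble normal
subgroup, its derived series never reaches 1, and all terms have trivial centralizer. Each
p-subgroup has nontrivial centre, hence is virtually abelian, with a bound uniform over the finite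
ones. An argument in the style of Hall and Higman then shows that the terms K^(l) far down the
series consist of p'-elements. Any given finite set of primes can thus be avoided by descending far
enough.

If K contains no C_p × C_p, the finite subgroups of a deep term without involutions have cyclic
Sylow subgroups and are metabelian, which is impossible. So let A ≅ C_p × C_p. In a deep term M,
finite A-invariant subgroups are generated by the centralizers of nontrivial a in A, each C_M(a) is
abelian and locally cyclic, and C_M(A) = 1. Let H be a finite A-invariant subgroup of M. If H' ≠ 1,
an element x of prime order in H' acts nontrivially on some finite subgroup U of a deeper term,
invariant under H and A and of order prime to |H|. For U minimal, x centralizes a proper subgroup V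
= U'U^r, and the heart of the proof (`commute_of_rankTwo`) shows that H acts on U/V as an abelian
group. So x is trivial on U/V and on V, hence by coprimality on U, a contradiction. Therefore M is
abelian and the derived series stops after all. -/

namespace SubIcc

/-! ### Coprime action: lifting fixed points and generation by them -/

section CoprimeAction

variable {P K : Type*} [Group P] [Group K] {p : ℕ} [Fact p.Prime]

/-- A `p`-group acting on `K` fixes a point in each coset of an invariant subgroup of order prime
to `p`, as soon as it leaves the coset invariant. -/
theorem exists_fixed_mul_of_not_dvd_card (φ : P →* MulAut K) (hP : IsPGroup p P) (N : Subgroup K)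
    (hN : ∀ g, ∀ n ∈ N, φ g n ∈ N) (hpN : ¬ p ∣ Nat.card N) (k : K)
    (hk : ∀ g, k⁻¹ * φ g k ∈ N) : ∃ n ∈ N, ∀ g, φ g (k * n) = k * n := by
  -- The invariant coset of `k` is identified with `N` through n ↦ k * n; a `p`-group acting on a
  -- set of size prime to `p` has a fixed point.
  let _ : MulAction P N :=
    { smul := fun g n => ⟨k⁻¹ * φ g (k * n), by
        rw [map_mul, ← mul_assoc]; exact N.mul_mem (hk g) (hN g n n.2)⟩
      one_smul := fun n => Subtype.ext (by change k⁻¹ * φ 1 (k * n) = n; simp)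
      mul_smul := fun g h n => Subtype.ext (by
        change k⁻¹ * φ (g * h) (k * n) = k⁻¹ * φ g (k * (k⁻¹ * φ h (k * n)))
        rw [mul_inv_cancel_left, map_mul φ, MulAut.mul_apply]) }
  obtain ⟨n, hn⟩ := hP.nonempty_fixed_point_of_prime_not_dvd_card N hpN
  refine ⟨n, n.2, fun g => ?_⟩
  have h : k⁻¹ * φ g (k * n) = n := congrArg Subtype.val (hn g)
  exact inv_mul_eq_iff_eq_mul.1 h

theorem isPGroup_zpowers_of_pow_eq_one {p : ℕ} {g : K} {n : ℕ} (hg : g ^ p ^ n = 1) :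
    IsPGroup p (Subgroup.zpowers g) :=
  IsPGroup.of_card_dvd_pow (n := n) (by rw [Nat.card_zpowers]; exact orderOf_dvd_of_pow_eq_one hg)

theorem exists_fixed_mul_of_pow_eq_one {α : MulAut K} {n : ℕ} (hα : α ^ p ^ n = 1) (N : Subgroup K)
    [Finite N] (hN : ∀ n ∈ N, α n ∈ N) (hpN : ¬ p ∣ Nat.card N) (k : K) (hk : k⁻¹ * α k ∈ N) :
    ∃ n ∈ N, α (k * n) = k * n := by
  have hN' : ∀ m : ℕ, ∀ n ∈ N, (α ^ m) n ∈ N := by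
    intro m
    induction m with
    | zero => simp
    | succ m ih => intro n hn; rw [pow_succ, MulAut.mul_apply]; exact ih _ (hN n hn)
  have hk' : ∀ m : ℕ, k⁻¹ * (α ^ m) k ∈ N := by
    intro m
    induction m with
    | zero => simp [N.one_mem]
    | succ m ih =>
      have : k⁻¹ * (α ^ (m + 1)) k = (k⁻¹ * (α ^ m) k) * (α ^ m) (k⁻¹ * α k) := by
        rw [pow_succ, MulAut.mul_apply, map_mul, map_inv]; group
      rw [this]; exact N.mul_mem ih (hN' m _ hk)
  have hfin : IsOfFinOrder α :=
    isOfFinOrder_iff_pow_eq_one.2 ⟨p ^ n, pow_pos (Fact.out : p.Prime).pos n, hα⟩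
  have hpow : ∀ g : Subgroup.zpowers α, ∃ m : ℕ, α ^ m = (g : MulAut K) := fun g =>
    (Submonoid.mem_powers_iff _ _).1 (hfin.mem_powers_iff_mem_zpowers.2 g.2)
  obtain ⟨n, hn, h⟩ := exists_fixed_mul_of_not_dvd_card (Subgroup.zpowers α).subtype
    (isPGroup_zpowers_of_pow_eq_one hα) N
    (fun g n hn => by obtain ⟨m, hm⟩ := hpow g; simpa [← hm] using hN' m n hn) hpN k
    (fun g => by obtain ⟨m, hm⟩ := hpow g; simpa [← hm] using hk' m)
  exact ⟨n, hn, h ⟨α, Subgroup.mem_zpowers α⟩⟩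

/-- The product of the images of `w` under the powers of an automorphism. -/
def autNorm {W : Type*} [CommGroup W] (n : ℕ) (γ : MulAut W) (w : W) : W :=
  ∏ j ∈ Finset.range n, (γ ^ j) w

theorem map_autNorm {W : Type*} [CommGroup W] {n : ℕ} {γ : MulAut W} (hγ : γ ^ n = 1) (w : W) :
    γ (autNorm n γ w) = autNorm n γ w := by
  have h1 : γ (autNorm n γ w) = ∏ j ∈ Finset.range n, (γ ^ (j + 1)) w := by
    simp [autNorm, map_prod, pow_succ', MulAut.mul_apply]
  have h2 := Finset.prod_range_succ (fun j => (γ ^ j) w) n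
  rw [Finset.prod_range_succ'] at h2
  rw [h1, autNorm]
  simpa [hγ] using h2

/-- The product over i < p of the norms of w under α^i β lies in T. Regrouped by powers β^j, it has
the factor w^p for j = 0, while for 0 < j < p the factor is a norm under α^j. Since α^j generates
⟨α⟩, that norm is fixed by α and lies in T too. -/
theorem pow_mem_of_fixed_mem {W : Type*} [CommGroup W] {α β : MulAut W} (hαβ : Commute α β)
    (hα : α ^ p = 1) (hβ : β ^ p = 1) (T : Subgroup W) (hTα : ∀ w, α w = w → w ∈ T)
    (hTβ : ∀ i : ℕ, ∀ w, (α ^ i * β) w = w → w ∈ T) (w : W) : w ^ p ∈ T := by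
  have hp : p.Prime := Fact.out
  have h1 : ∏ i ∈ Finset.range p, autNorm p (α ^ i * β) w ∈ T := by
    refine T.prod_mem fun i _ => hTβ i _ (map_autNorm ?_ w)
    rw [(hαβ.pow_left i).mul_pow, ← pow_mul, mul_comm, pow_mul, hα, hβ, one_pow, one_mul]
  have h2 : ∏ i ∈ Finset.range p, autNorm p (α ^ i * β) w =
      ∏ j ∈ Finset.range p, autNorm p (α ^ j) ((β ^ j) w) := by
    unfold autNorm
    rw [Finset.prod_comm]
    refine Finset.prod_congr rfl fun j _ => Finset.prod_congr rfl fun i _ => ?_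
    rw [(hαβ.pow_left i).mul_pow, MulAut.mul_apply, ← pow_mul, ← pow_mul, mul_comm]
  obtain ⟨m, rfl⟩ : ∃ m, p = m + 1 := ⟨p - 1, by have := hp.pos; omega⟩
  rw [h2, Finset.prod_range_succ'] at h1
  have h3 : autNorm (m + 1) (α ^ 0) ((β ^ 0) w) = w ^ (m + 1) := by simp [autNorm]
  rw [h3] at h1
  refine (T.mul_mem_cancel_left (T.prod_mem fun j hj => hTα _ ?_)).1 h1
  have hco : (m + 1).Coprime (j + 1) := by
    refine (hp.coprime_iff_not_dvd).2 fun hd => ?_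
    have := Nat.le_of_dvd (Nat.succ_pos j) hd
    have := Finset.mem_range.1 hj
    omega
  set v := autNorm (m + 1) (α ^ (j + 1)) ((β ^ (j + 1)) w) with hv
  have hfix : (α ^ (j + 1)) v = v :=
      map_autNorm (by rw [← pow_mul, mul_comm, pow_mul, hα, one_pow]) _
  have hs1 : α ^ (j + 1) ∈ MulAction.stabilizer (MulAut W) v := hfix
  have hs2 : α ^ (m + 1) ∈ MulAction.stabilizer (MulAut W) v := by rw [hα]; exact one_mem _
  have : α ^ ((m + 1).gcd (j + 1) : ℤ) ∈ MulAction.stabilizer (MulAut W) v := by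
    rw [Nat.gcd_eq_gcd_ab, zpow_add, zpow_mul, zpow_mul, zpow_natCast, zpow_natCast]
    exact mul_mem (zpow_mem hs2 _) (zpow_mem hs1 _)
  rw [hco.gcd_eq_one] at this
  simpa using this

theorem mem_of_pow_mem_of_coprime {W : Type*} [Group W] {T : Subgroup W} {w : W} {m n : ℕ}
    (hmn : m.Coprime n) (hm : w ^ m ∈ T) (hn : w ^ n ∈ T) : w ∈ T := by
  have : w ^ (m.gcd n : ℤ) ∈ T := by
    rw [Nat.gcd_eq_gcd_ab, zpow_add, zpow_mul, zpow_mul, zpow_natCast, zpow_natCast]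
    exact mul_mem (zpow_mem hm _) (zpow_mem hn _)
  simpa [hmn.gcd_eq_one] using this

/-- Restriction of automorphisms to an invariant subgroup. -/
def restrictAut (N : Subgroup K) (hN : N.Characteristic) : MulAut K →* MulAut N where
  toFun α := α.subgroupMap N |>.trans (MulEquiv.subgroupCongr
    (Subgroup.characteristic_iff_map_eq.1 hN α))
  map_one' := by ext; rfl
  map_mul' _ _ := by ext; rfl

/-- The action of automorphisms on the abelianization. -/
def abelianizationAut : MulAut K →* MulAut (Abelianization K) where
  toFun α := α.abelianizationCongr
  map_one' := by
    ext x; obtain ⟨x, rfl⟩ := QuotientGroup.mk_surjective x; rfl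
  map_mul' _ _ := by
    ext x; obtain ⟨x, rfl⟩ := QuotientGroup.mk_surjective x; rfl

/-- A finite soluble `p'`-group on which `⟨α⟩ × ⟨β⟩` acts, both factors of exponent `p`, is
generated by the fixed points of `α` and of the automorphisms `α ^ i * β`. -/
theorem eq_top_of_fixed_mem [Finite K] [Group.IsSolvable K] {α β : MulAut K} (hαβ : Commute α β)
    (hα : α ^ p = 1) (hβ : β ^ p = 1) (hpK : ¬ p ∣ Nat.card K) (T : Subgroup K)
    (hTα : ∀ w, α w = w → w ∈ T) (hTβ : ∀ i : ℕ, ∀ w, (α ^ i * β) w = w → w ∈ T) : T = ⊤ := by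
  have hp : p.Prime := Fact.out
  induction hn : Nat.card K using Nat.strong_induction_on generalizing K with
  | _ n ih =>
  subst hn
  rcases subsingleton_or_nontrivial K with hK | hK
  · exact Subsingleton.elim _ _
  have hchar : (commutator K).Characteristic := inferInstance
  have hlt : Nat.card (commutator K) < Nat.card K := by
    have h := Group.IsSolvable.commutator_lt_top_of_nontrivial K
    refine lt_of_le_of_ne (Subgroup.card_le_card_group _) fun he => h.ne ?_
    exact Subgroup.eq_top_of_card_eq _ he
  have hpC : ¬ p ∣ Nat.card (commutator K) := fun h =>
    hpK (h.trans (Subgroup.card_subgroup_dvd_card _))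
  -- Induction on the order applies to the derived subgroup, which is proper by solubility; the
  -- abelianization is handled by norms.
  have hC : commutator K ≤ T := by
    have := ih _ hlt (K := commutator K) (α := restrictAut _ hchar α) (β := restrictAut _ hchar β)
      (hαβ.map _) (by rw [← map_pow, hα, map_one]) (by rw [← map_pow, hβ, map_one]) hpC
      (T.subgroupOf _) (fun w hw => hTα _ (congrArg Subtype.val hw))
      (fun i w hw => hTβ i _ (by
        rw [← map_pow, ← map_mul] at hw; exact congrArg Subtype.val hw)) rfl
    rwa [Subgroup.subgroupOf_eq_top] at this
  -- Coprimality lifts fixed points of the abelianization to fixed points of `K`.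
  have key : ∀ γ : MulAut K, γ ^ p = 1 → (∀ w, γ w = w → w ∈ T) →
      ∀ w : Abelianization K, abelianizationAut γ w = w → w ∈ T.map Abelianization.of := by
    intro γ hγ hT w hw
    obtain ⟨k, rfl⟩ := QuotientGroup.mk_surjective w
    have hk : k⁻¹ * γ k ∈ commutator K := QuotientGroup.eq.1 hw.symm
    obtain ⟨n, hn, h⟩ := exists_fixed_mul_of_pow_eq_one (n := 1) (by rwa [pow_one]) (commutator K)
      (fun n hn => by
        have := Subgroup.characteristic_iff_map_eq.1 hchar γ
        rw [← this]; exact ⟨n, hn, rfl⟩) hpC k hk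
    refine ⟨k * n, hT _ h, ?_⟩
    exact (QuotientGroup.eq.2 (by simpa using hn)).symm
  refine (Subgroup.eq_top_iff' T).2 fun k => ?_
  have h1 := pow_mem_of_fixed_mem (p := p) (hαβ.map abelianizationAut)
    (by rw [← map_pow, hα, map_one]) (by rw [← map_pow, hβ, map_one]) (T.map Abelianization.of)
    (key α hα hTα) (fun i w hw => key (α ^ i * β) (by
      rw [(hαβ.pow_left i).mul_pow, ← pow_mul, mul_comm, pow_mul, hα, hβ, one_pow, one_mul])
      (hTβ i) w (by rw [map_mul, map_pow]; exact hw)) (Abelianization.of k)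
  have h2 : Abelianization.of k ^ Nat.card K ∈ T.map Abelianization.of := by
    rw [← map_pow, pow_card_eq_one', map_one]; exact one_mem _
  obtain ⟨t, ht, hte⟩ := mem_of_pow_mem_of_coprime ((Nat.Prime.coprime_iff_not_dvd hp).2 hpK) h1 h2
  have : t⁻¹ * k ∈ commutator K := QuotientGroup.eq.1 hte
  simpa using T.mul_mem ht (hC this)

end CoprimeAction

/-! ### Elements of prime order in cyclic groups -/

section PrimeOrder

variable {K : Type*} [Group K] {q : ℕ} [Fact q.Prime]

theorem zpowers_eq_of_mem_of_ne_one {x y : K} (hx : x ^ q = 1) (hy : y ∈ Subgroup.zpowers x)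
    (hy1 : y ≠ 1) : Subgroup.zpowers y = Subgroup.zpowers x := by
  have hle : Subgroup.zpowers y ≤ Subgroup.zpowers x := Subgroup.zpowers_le.2 hy
  have hyq : y ^ q = 1 := by
    obtain ⟨i, rfl⟩ := Subgroup.mem_zpowers_iff.1 hy
    rw [← zpow_natCast, ← zpow_mul, mul_comm, zpow_mul, zpow_natCast, hx, one_zpow]
  have hx1 : x ≠ 1 := by
    rintro rfl
    simp only [Subgroup.zpowers_one_eq_bot, Subgroup.mem_bot] at hy
    exact hy1 hy
  have h1 := orderOf_eq_prime hyq hy1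
  have h2 := orderOf_eq_prime hx hx1
  have : Finite (Subgroup.zpowers x) :=
    Nat.finite_of_card_ne_zero (by rw [Nat.card_zpowers, h2]; exact (Fact.out : q.Prime).ne_zero)
  exact Subgroup.eq_of_le_of_card_ge hle (by rw [Nat.card_zpowers, Nat.card_zpowers, h1, h2])

theorem mem_zpowers_of_isCyclic [Finite K] [IsCyclic K] {x y : K} (hx : x ^ q = 1)
    (hy : y ^ q = 1) (hx1 : x ≠ 1) : y ∈ Subgroup.zpowers x := by
  classical
  have := Fintype.ofFinite K
  have h1 := IsCyclic.card_pow_eq_one_le (α := K) (Fact.out : q.Prime).pos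
  have hsub : (Subgroup.zpowers x : Set K) ⊆ {z : K | z ^ q = 1} := by
    rintro z ⟨i, rfl⟩
    change (x ^ i) ^ q = 1
    rw [← zpow_natCast, ← zpow_mul, mul_comm, zpow_mul, zpow_natCast, hx, one_zpow]
  have hcard : (Subgroup.zpowers x : Set K).ncard = q := by
    rw [← Nat.card_coe_set_eq]
    exact (Nat.card_zpowers x).trans (orderOf_eq_prime hx hx1)
  have h2 : ({z : K | z ^ q = 1} : Set K).ncard ≤ q := by
    rw [Set.ncard_eq_toFinset_card']
    convert h1
    ext; simp
  have := Set.eq_of_subset_of_ncard_le hsub (h2.trans hcard.ge)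
  have hy' : y ∈ {z : K | z ^ q = 1} := hy
  rwa [← this] at hy'

theorem mem_zpowers_of_mem_zpowers [Finite K] {g x y : K} (hxg : x ∈ Subgroup.zpowers g)
    (hyg : y ∈ Subgroup.zpowers g) (hx : x ^ q = 1) (hy : y ^ q = 1) (hx1 : x ≠ 1) :
    y ∈ Subgroup.zpowers x := by
  have := mem_zpowers_of_isCyclic (q := q) (x := (⟨x, hxg⟩ : Subgroup.zpowers g))
    (y := ⟨y, hyg⟩) (Subtype.ext hx) (Subtype.ext hy) (fun h => hx1 (congrArg Subtype.val h))
  obtain ⟨i, hi⟩ := this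
  exact ⟨i, congrArg Subtype.val hi⟩

end PrimeOrder

/-! ### Elementary abelian groups of operators of rank two -/

section RankTwo

variable {A : Type*} [CommGroup A] {p : ℕ} [Fact p.Prime]

theorem exists_notMem_zpowers (hA : ∀ a : A, a ^ p = 1) (hcard : Nat.card A = p ^ 2) (a : A) :
    ∃ c : A, c ∉ Subgroup.zpowers a := by
  by_contra! h
  have hp : p.Prime := Fact.out
  have h1 : Subgroup.zpowers a = ⊤ := (Subgroup.eq_top_iff' _).2 h
  have h2 := Nat.card_zpowers a
  rw [h1, Subgroup.card_top, hcard] at h2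
  have h3 := Nat.le_of_dvd hp.pos (orderOf_dvd_of_pow_eq_one (hA a))
  nlinarith [hp.two_le]

theorem eq_top_of_mem_of_notMem_zpowers (hA : ∀ a : A, a ^ p = 1) (hcard : Nat.card A = p ^ 2)
    {a c : A} (ha : a ≠ 1) (hc : c ∉ Subgroup.zpowers a) (S : Subgroup A) (haS : a ∈ S)
    (hcS : c ∈ S) : S = ⊤ := by
  have hp : p.Prime := Fact.out
  have : Finite A := Nat.finite_of_card_ne_zero (by rw [hcard]; exact pow_ne_zero _ hp.ne_zero)
  have hle : Subgroup.zpowers a ≤ S := Subgroup.zpowers_le.2 haS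
  obtain ⟨i, hi, hS⟩ := (Nat.dvd_prime_pow hp).1 (hcard ▸ S.card_subgroup_dvd_card)
  have h1 : Nat.card (Subgroup.zpowers a) = p := by
    rw [Nat.card_zpowers]; exact orderOf_eq_prime (hA a) ha
  interval_cases i
  · have := Subgroup.card_le_of_le hle
    rw [h1, hS, pow_zero] at this
    exact absurd this hp.one_lt.not_ge
  · have := Subgroup.eq_of_le_of_card_ge hle (by rw [h1, hS, pow_one])
    exact absurd (this ▸ hcS) hc
  · exact Subgroup.eq_top_of_card_eq _ (by rw [hS, hcard])

variable {K : Type*} [Group K]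

/-- Restriction of an action by automorphisms to an invariant subgroup. -/
def restrictAction {B : Type*} [Group B] (ψ : B →* MulAut K) (N : Subgroup K)
    (hN : ∀ a, ∀ n ∈ N, ψ a n ∈ N) : B →* MulAut N where
  toFun a :=
    { toFun := fun n => ⟨ψ a n, hN a n n.2⟩
      invFun := fun n => ⟨ψ a⁻¹ n, hN _ n n.2⟩
      left_inv := fun n => Subtype.ext (by simp)
      right_inv := fun n => Subtype.ext (by simp)
      map_mul' := fun m n => Subtype.ext (by simp) }
  map_one' := by ext; simp
  map_mul' a b := by ext; simp

/-- A finite soluble `p'`-group is generated by the centralizers of the nontrivial elements of an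
elementary abelian group of order `p ^ 2` acting on it. -/
theorem le_of_fixed_mem (hA : ∀ a : A, a ^ p = 1) (hcard : Nat.card A = p ^ 2)
    (ψ : A →* MulAut K) (N : Subgroup K) [Finite N] [Group.IsSolvable N]
    (hN : ∀ a, ∀ n ∈ N, ψ a n ∈ N) (hpN : ¬ p ∣ Nat.card N) (T : Subgroup K)
    (hT : ∀ a, a ≠ 1 → ∀ k ∈ N, ψ a k = k → k ∈ T) : N ≤ T := by
  have hp : p.Prime := Fact.out
  have : Nontrivial A := by
    have : Finite A := Nat.finite_of_card_ne_zero (by rw [hcard]; exact pow_ne_zero _ hp.ne_zero)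
    refine Finite.one_lt_card_iff_nontrivial.1 ?_
    rw [hcard]; exact Nat.one_lt_pow two_ne_zero hp.one_lt
  obtain ⟨a, ha⟩ := exists_ne (1 : A)
  obtain ⟨c, hc⟩ := exists_notMem_zpowers hA hcard a
  set ψ' := restrictAction ψ N hN
  have key : ∀ b : A, b ≠ 1 → ∀ w : N, ψ' b w = w → w ∈ T.subgroupOf N := fun b hb w hw =>
    hT b hb w w.2 (congrArg Subtype.val hw)
  rw [← Subgroup.subgroupOf_eq_top]
  refine eq_top_of_fixed_mem (p := p) (α := ψ' a) (β := ψ' c) ((Commute.all a c).map ψ')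
    (by rw [← map_pow, hA, map_one]) (by rw [← map_pow, hA, map_one]) hpN _ (key a ha) ?_
  intro i w hw
  rw [← map_pow, ← map_mul] at hw
  refine key _ (fun h => hc ?_) w hw
  rw [eq_inv_of_mul_eq_one_right h]
  exact inv_mem (pow_mem (Subgroup.mem_zpowers a) i)

end RankTwo

/-! ### Fixed points in a Frobenius-type action -/

section FrobeniusAction

variable {W : Type*} [CommGroup W] {p q : ℕ}

/-- Let `b` normalize, but not centralize, a group `⟨x⟩` of prime order `q` of automorphisms of
the `q'`-group `W`. If `x` has no nontrivial fixed points in the nontrivial invariant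
subgroup `U`, then `b` has some. -/
theorem exists_fixed_of_frobenius [Finite W] [Fact p.Prime] [Fact q.Prime] {x b : MulAut W}
    (hx : x ^ q = 1) (hb : b ^ p = 1) (hbx : b * x * b⁻¹ ∈ Subgroup.zpowers x)
    (hnc : ¬ Commute b x) (hqW : ¬ q ∣ Nat.card W) {U : Subgroup W} (hxU : ∀ u ∈ U, x u ∈ U)
    (hbU : ∀ u ∈ U, b u ∈ U) (hfix : ∀ u ∈ U, x u = u → u = 1) (hU : U ≠ ⊥) :
    ∃ u ∈ U, u ≠ 1 ∧ b u = u := by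
  have hp : p.Prime := Fact.out
  have hq : q.Prime := Fact.out
  obtain ⟨u, hu, hu1⟩ := U.bot_or_exists_ne_one.resolve_left hU
  have hpowU : ∀ (γ : MulAut W), (∀ w ∈ U, γ w ∈ U) → ∀ (n : ℕ), ∀ w ∈ U, (γ ^ n) w ∈ U := by
    intro γ hγ n
    induction n with
    | zero => simp
    | succ n ih => intro w hw; rw [pow_succ, MulAut.mul_apply]; exact ih _ (hγ w hw)
  by_contra! hno
  have h1 : ∀ k : ℕ, autNorm p b ((x ^ k) u) = 1 := by
    intro k
    by_contra h
    exact hno _ (U.prod_mem fun j _ => hpowU b hbU j _ (hpowU x hxU k _ hu)) h (map_autNorm hb _)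
  have hconj : ∀ i : ℕ, b ^ i * x * (b ^ i)⁻¹ ∈ Subgroup.zpowers x := by
    intro i
    induction i with
    | zero => simp
    | succ i ih =>
      obtain ⟨m, hm⟩ := Subgroup.mem_zpowers_iff.1 ih
      have : b ^ (i + 1) * x * (b ^ (i + 1))⁻¹ = (b * x * b⁻¹) ^ m := by
        rw [conj_zpow, hm]; simp only [pow_succ', mul_inv_rev, mul_assoc]
      rw [this]; exact zpow_mem hbx m
  -- The product over k of x^(-k) applied to the `b`-norm of x^k u is trivial. Regrouped by powers
  -- of `b`, it is the product over i of the norms of b^i u under `y i`. The term i = 0 is u^q, as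
  -- `y 0` = 1. For 0 < i < p, `y i` generates ⟨x⟩, so its norm is a fixed point of `x` in `U`,
  -- hence 1. This leaves u^q = 1, against coprimality.
  set y : ℕ → MulAut W := fun i => x⁻¹ * (b ^ i * x * (b ^ i)⁻¹) with hy
  have hymem : ∀ i, y i ∈ Subgroup.zpowers x := fun i =>
    mul_mem (inv_mem (Subgroup.mem_zpowers x)) (hconj i)
  have hypow : ∀ i k : ℕ, (y i) ^ k * b ^ i = x⁻¹ ^ k * (b ^ i * x ^ k) := by
    intro i k
    have hc : Commute x⁻¹ (b ^ i * x * (b ^ i)⁻¹) := by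
      obtain ⟨m, hm⟩ := Subgroup.mem_zpowers_iff.1 (hconj i)
      rw [← hm]; exact ((Commute.refl x).zpow_right m).inv_left
    rw [hy]; simp only []
    rw [hc.mul_pow, conj_pow]; group
  have hyq : ∀ i, y i ^ q = 1 := fun i => by
    obtain ⟨m, hm⟩ := Subgroup.mem_zpowers_iff.1 (hymem i)
    rw [← hm, ← zpow_natCast, ← zpow_mul, mul_comm, zpow_mul, zpow_natCast, hx, one_zpow]
  have h2 : ∏ k ∈ Finset.range q, (x⁻¹ ^ k) (autNorm p b ((x ^ k) u)) = 1 :=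
    Finset.prod_eq_one fun k _ => by rw [h1, map_one]
  have h3 : ∏ k ∈ Finset.range q, (x⁻¹ ^ k) (autNorm p b ((x ^ k) u)) =
      ∏ i ∈ Finset.range p, autNorm q (y i) ((b ^ i) u) := by
    simp only [autNorm, map_prod]
    rw [Finset.prod_comm]
    refine Finset.prod_congr rfl fun i _ => Finset.prod_congr rfl fun k _ => ?_
    simp only [← MulAut.mul_apply]
    rw [hypow]
  obtain ⟨m, rfl⟩ : ∃ m, p = m + 1 := ⟨p - 1, by have := hp.pos; omega⟩
  rw [h3, Finset.prod_range_succ', Finset.prod_eq_one, one_mul] at h2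
  · have h4 : u ^ q = 1 := by simpa [autNorm, hy] using h2
    have h5 : u ^ Nat.card W = 1 := pow_card_eq_one'
    have := mem_of_pow_mem_of_coprime (T := (⊥ : Subgroup W))
      ((Nat.Prime.coprime_iff_not_dvd hq).2 hqW) (Subgroup.mem_bot.2 h4) (Subgroup.mem_bot.2 h5)
    exact hu1 (Subgroup.mem_bot.1 this)
  · intro i hi
    have hxn : ∀ n : ℤ, ∀ w ∈ U, (x ^ n) w ∈ U := by
      intro n w hw
      have : ∃ j : ℕ, x ^ j = x ^ n := (Submonoid.mem_powers_iff _ _).1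
        ((isOfFinOrder_iff_pow_eq_one.2 ⟨q, hq.pos, hx⟩).mem_powers_iff_mem_zpowers.2 ⟨n, rfl⟩)
      obtain ⟨j, hj⟩ := this
      rw [← hj]; exact hpowU x hxU j w hw
    have hyU : ∀ w ∈ U, y (i + 1) w ∈ U := by
      obtain ⟨n, hn⟩ := Subgroup.mem_zpowers_iff.1 (hymem (i + 1))
      rw [← hn]; exact hxn n
    refine hfix _ (U.prod_mem fun j _ => hpowU _ hyU j _ (hpowU b hbU _ _ hu)) ?_
    have hy1 : y (i + 1) ≠ 1 := by
      intro h
      have hcom : Commute (b ^ (i + 1)) x := by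
        have := eq_of_inv_mul_eq_one h
        exact (eq_mul_inv_iff_mul_eq.1 this).symm
      refine hnc ?_
      have hco : (m + 1).Coprime (i + 1) := by
        refine (hp.coprime_iff_not_dvd).2 fun hd => ?_
        have := Nat.le_of_dvd (Nat.succ_pos i) hd
        have := Finset.mem_range.1 hi
        omega
      have hmem := mem_of_pow_mem_of_coprime (T := Subgroup.centralizer {x}) (w := b) hco
        (by rw [hb]; exact one_mem _) (Subgroup.mem_centralizer_singleton_iff.2 hcom.eq)
      exact (Subgroup.mem_centralizer_singleton_iff.1 hmem)
    have hz := zpowers_eq_of_mem_of_ne_one hx (hymem (i + 1)) hy1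
    have hxz : x ∈ Subgroup.zpowers (y (i + 1)) := hz ▸ Subgroup.mem_zpowers x
    have hs : y (i + 1) ∈ MulAction.stabilizer (MulAut W)
        (autNorm q (y (i + 1)) ((b ^ (i + 1)) u)) := map_autNorm (hyq _) _
    exact (Subgroup.zpowers_le.2 hs) hxz

end FrobeniusAction

/-! ### Derived series and commutators, auxiliary facts -/

section Solvable

/-- The last nontrivial term of the derived series. -/
theorem exists_characteristic_commutator_eq_bot (L : Type*) [Group L] [Nontrivial L]
    [Group.IsSolvable L] : ∃ D : Subgroup L, D.Characteristic ∧ D ≠ ⊥ ∧ ⁅D, D⁆ = ⊥ := by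
  classical
  have hex : ∃ n, derivedSeries L n = ⊥ := Group.IsSolvable.solvable
  obtain ⟨n, hn⟩ : ∃ n, Nat.find hex = n + 1 := Nat.exists_eq_succ_of_ne_zero (by
    intro h0
    have := Nat.find_spec hex
    rw [h0, derivedSeries_zero] at this
    exact top_ne_bot this)
  refine ⟨derivedSeries L n, inferInstance, Nat.find_min hex (by omega), ?_⟩
  rw [← derivedSeries_succ, ← hn]; exact Nat.find_spec hex

end Solvable

section Commutator

variable {M : Type*} [Group M]

/-- As t centralizes no nontrivial element of Y, the map z ↦ [t, z] is injective on Y, hence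
surjective because Y is finite. -/
theorem exists_commutator_eq (Y : Subgroup M) [Finite Y] {t : M}
    (hYn : ∀ y ∈ Y, t * y * t⁻¹ ∈ Y)
    (hYt : ∀ y ∈ Y, Commute t y → y = 1) {y : M} (hy : y ∈ Y) :
    ∃ z ∈ Y, t * z * t⁻¹ * z⁻¹ = y := by
  have hinj : Function.Injective (fun z : Y => (⟨t * z * t⁻¹ * (z : M)⁻¹,
      mul_mem (hYn z z.2) (inv_mem z.2)⟩ : Y)) := by
    intro z u hzu
    have hzu : t * z * t⁻¹ * (z : M)⁻¹ = t * u * t⁻¹ * (u : M)⁻¹ := congrArg Subtype.val hzu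
    have h1 : t * z * t⁻¹ = t * u * t⁻¹ * ((u : M)⁻¹ * z) := by
      rw [← mul_assoc, ← hzu]; simp
    have h2 : t * ((u : M)⁻¹ * z) * t⁻¹ = (u : M)⁻¹ * z := by
      calc t * ((u : M)⁻¹ * z) * t⁻¹ = (t * u * t⁻¹)⁻¹ * (t * z * t⁻¹) := by group
        _ = (u : M)⁻¹ * z := by rw [h1]; group
    exact Subtype.ext (inv_mul_eq_one.1
      (hYt _ (mul_mem (inv_mem u.2) z.2) (mul_inv_eq_iff_eq_mul.1 h2))).symm
  obtain ⟨z, hz⟩ := Finite.injective_iff_surjective.1 hinj ⟨y, hy⟩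
  exact ⟨z, z.2, congrArg Subtype.val hz⟩

end Commutator

/-! ### Automorphism groups of an abelian group normalized by a rank-two group -/

section RankTwoAction

variable {A W : Type*} [CommGroup A] [CommGroup W] {p q : ℕ} [Fact p.Prime]
  [Fact q.Prime]

/-- The subgroup `[W, x]`. -/
def commutatorRange (x : MulAut W) : Subgroup W :=
  Subgroup.closure {w | ∃ y ∈ Subgroup.zpowers x, ∃ v, w = y v * v⁻¹}

theorem map_mem_commutatorRange {x b : MulAut W}
    (hb : ∀ y ∈ Subgroup.zpowers x, b * y * b⁻¹ ∈ Subgroup.zpowers x) {w : W}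
    (hw : w ∈ commutatorRange x) : b w ∈ commutatorRange x := by
  have : commutatorRange x ≤ (commutatorRange x).comap b.toMonoidHom := by
    refine (Subgroup.closure_le _).2 ?_
    rintro _ ⟨y, hy, v, rfl⟩
    refine Subgroup.subset_closure ⟨_, hb y hy, b v, ?_⟩
    simp [MulAut.mul_apply]
  exact this hw

/-- The norm of x is a homomorphism that kills [W, x], while it sends a fixed point w to w^q. -/
theorem eq_one_of_mem_commutatorRange {x : MulAut W} (hx : x ^ q = 1)
    (hqW : ¬ q ∣ Nat.card W) {w : W} (hw : w ∈ commutatorRange x) (hxw : x w = w) : w = 1 := by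
  have hq : q.Prime := Fact.out
  let N : W →* W :=
    { toFun := autNorm q x
      map_one' := by simp [autNorm]
      map_mul' := fun a b => by simp [autNorm, Finset.prod_mul_distrib] }
  have hle : commutatorRange x ≤ N.ker := by
    refine (Subgroup.closure_le _).2 ?_
    rintro _ ⟨y, ⟨i, rfl⟩, v, rfl⟩
    have hcomm : autNorm q x ((x ^ i) v) = (x ^ i) (autNorm q x v) := by
      simp only [autNorm, map_prod, ← MulAut.mul_apply]
      refine Finset.prod_congr rfl fun j _ => ?_
      rw [((Commute.refl x).zpow_right i).pow_left j |>.eq]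
    have hs : x ^ i ∈ MulAction.stabilizer (MulAut W) (autNorm q x v) :=
      zpow_mem (show x ∈ MulAction.stabilizer (MulAut W) (autNorm q x v) from map_autNorm hx v) i
    have hs' : (x ^ i) (autNorm q x v) = autNorm q x v := hs
    change N ((x ^ i) v * v⁻¹) = 1
    rw [map_mul, map_inv, mul_inv_eq_one]
    exact hcomm.trans hs'
  have h1 : autNorm q x w = 1 := hle hw
  have hfix : ∀ j : ℕ, (x ^ j) w = w := fun j =>
    pow_mem (show x ∈ MulAction.stabilizer (MulAut W) w from hxw) j
  have h2 : w ^ q = 1 := by simpa [autNorm, hfix] using h1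
  exact Subgroup.mem_bot.1 (mem_of_pow_mem_of_coprime (T := (⊥ : Subgroup W))
      ((Nat.Prime.coprime_iff_not_dvd hq).2 hqW) (Subgroup.mem_bot.2 h2)
      (Subgroup.mem_bot.2 pow_card_eq_one'))

/-- The subgroup of points fixed by a group of automorphisms. -/
def fixedSubgroup (Y : Subgroup (MulAut W)) : Subgroup W where
  carrier := {w | ∀ y ∈ Y, y w = w}
  one_mem' := fun y _ => map_one y
  mul_mem' := fun ha hb y hy => by rw [map_mul, ha y hy, hb y hy]
  inv_mem' := fun ha y hy => by rw [map_inv, ha y hy]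

variable [Finite W] (hA : ∀ a : A, a ^ p = 1) (hcard : Nat.card A = p ^ 2) (φ : A →* MulAut W)
  (hpW : ¬ p ∣ Nat.card W) (hqW : ¬ q ∣ Nat.card W)
  (hW1 : ∀ a : A, a ≠ 1 → ∀ u v : W, φ a u = u → φ a v = v → u ≠ 1 → v ∈ Subgroup.zpowers u)

include hA hcard hpW hqW hW1 in
/-- If `x` centralizes `φ a` and the fixed points of `φ a`, then a group of automorphisms that
centralizes `x` and `φ a'`, for an `a'` not in `⟨a⟩`, is trivial. -/
theorem eq_bot_of_commute {a a' : A} (ha : a ≠ 1) (haa' : a' ∉ Subgroup.zpowers a)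
    {x : MulAut W} (hx1 : x ≠ 1) (hxq : x ^ q = 1)
    (hxa : ∀ w, φ a w = w → x w = w)
    (hxb : ∀ b, φ b * x * (φ b)⁻¹ ∈ Subgroup.zpowers x)
    (hxnc : ∀ b, b ∉ Subgroup.zpowers a → ¬ Commute (φ b) x)
    (Y : Subgroup (MulAut W)) (hYx : ∀ y ∈ Y, Commute y x)
    (hYn : ∀ b, ∀ y ∈ Y, φ b * y * (φ b)⁻¹ ∈ Y)
    (hYa' : ∀ w, φ a' w = w → ∀ y ∈ Y, y w = w)
    (hYa : ∀ y ∈ Y, Commute (φ a) y → y = 1) : Y = ⊥ := by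
  have hp : p.Prime := Fact.out
  set U := commutatorRange x with hUdef
  have hpow : ∀ b, ∀ y ∈ Subgroup.zpowers x, φ b * y * (φ b)⁻¹ ∈ Subgroup.zpowers x := by
    rintro b _ ⟨i, rfl⟩
    change φ b * x ^ i * (φ b)⁻¹ ∈ Subgroup.zpowers x
    rw [← conj_zpow]; exact zpow_mem (hxb b) i
  have hbU : ∀ b, ∀ u ∈ U, φ b u ∈ U := fun b u hu => map_mem_commutatorRange (hpow b) hu
  have hxU : ∀ u ∈ U, x u ∈ U := fun u hu => map_mem_commutatorRange (fun y hy =>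
    mul_mem (mul_mem (Subgroup.mem_zpowers x) hy) (inv_mem (Subgroup.mem_zpowers x))) hu
  have hfix : ∀ u ∈ U, x u = u → u = 1 := fun u hu hxu =>
    eq_one_of_mem_commutatorRange hxq hqW hu hxu
  have hU1 : U ≠ ⊥ := by
    intro h
    refine hx1 (MulEquiv.ext fun v => ?_)
    have : x v * v⁻¹ ∈ U := Subgroup.subset_closure ⟨x, Subgroup.mem_zpowers x, v, rfl⟩
    rw [h, Subgroup.mem_bot, mul_inv_eq_one] at this
    simpa using this
  -- The Frobenius lemma puts a nontrivial fixed point of `φ b` in `V`. By `hW1` it generates all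
  -- fixed points of `φ b`, so they all lie in `V`.
  have key : ∀ V : Subgroup W, V ≤ U → V ≠ ⊥ → (∀ v ∈ V, x v ∈ V) → (∀ b, ∀ v ∈ V, φ b v ∈ V) →
      ∀ b, b ∉ Subgroup.zpowers a → (∃ v, v ≠ 1 ∧ φ b v = v) ∧ ∀ w, φ b w = w → w ∈ V := by
    intro V hVU hV hxV hbV b hb
    obtain ⟨u, hu, hu1, hbu⟩ := exists_fixed_of_frobenius (p := p) (b := φ b) hxq
      (by rw [← map_pow, hA, map_one]) (hxb b) (hxnc b hb) hqW hxV (hbV b)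
      (fun u hu => hfix u (hVU hu)) hV
    refine ⟨⟨u, hu1, hbu⟩, fun w hw => ?_⟩
    have hb1 : b ≠ 1 := fun h => hb (h ▸ one_mem _)
    exact (Subgroup.zpowers_le.2 hu) (hW1 b hb1 u w hbu hw hu1)
  have keyU := key U le_rfl hU1 hxU hbU
  set F := fixedSubgroup Y with hF
  have hxF : ∀ v ∈ F, x v ∈ F := fun v hv y hy => by
    rw [← MulAut.mul_apply, (hYx y hy).eq, MulAut.mul_apply, hv y hy]
  have hbF : ∀ b, ∀ v ∈ F, φ b v ∈ F := fun b v hv y hy => by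
    have h := hv _ (hYn b⁻¹ y hy)
    rw [map_inv, inv_inv, MulAut.mul_apply, MulAut.mul_apply] at h
    simpa using congrArg (φ b) h
  -- A nontrivial fixed point of `φ a'` lies in `U` and is fixed by `Y`. So `key` applies again, now
  -- to `U ⊓ F`: the group `Y` fixes every fixed point of `φ b` for `b` outside ⟨a⟩.
  have hFU : U ⊓ F ≠ ⊥ := by
    obtain ⟨⟨v, hv1, hv⟩, hU'⟩ := keyU a' haa'
    intro h
    have : v ∈ U ⊓ F := ⟨hU' v hv, hYa' v hv⟩
    rw [h] at this
    exact hv1 this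
  have keyF := key (U ⊓ F) inf_le_left hFU (fun v hv => ⟨hxU v hv.1, hxF v hv.2⟩)
    (fun b v hv => ⟨hbU b v hv.1, hbF b v hv.2⟩)
  -- the fixed points of `x` are those of `φ a`
  have hfa : ∀ b : A, b ∈ Subgroup.zpowers a → b ≠ 1 → ∀ w, φ b w = w → φ a w = w := by
    intro b hb hb1 w hw
    have hz := zpowers_eq_of_mem_of_ne_one (hA a) hb hb1
    have h1 : a ∈ Subgroup.zpowers b := hz ▸ Subgroup.mem_zpowers a
    obtain ⟨i, rfl⟩ := h1
    change φ (b ^ i) w = w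
    rw [map_zpow]
    exact zpow_mem (show φ b ∈ MulAction.stabilizer (MulAut W) w from hw) i
  have hcx : ∀ w, x w = w → φ a w = w := by
    let X : Subgroup W := fixedSubgroup (Subgroup.zpowers x)
    have hmemX : ∀ w, w ∈ X ↔ x w = w := by
      intro w
      refine ⟨fun h => h x (Subgroup.mem_zpowers x), ?_⟩
      rintro h _ ⟨i, rfl⟩
      exact zpow_mem (show x ∈ MulAction.stabilizer (MulAut W) w from h) i
    -- The fixed points of `x` are generated by those also fixed by some `b ≠ 1`. For `b` outside
    -- ⟨a⟩ these lie in `U`, where `x` fixes only 1.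
    have hXle := le_of_fixed_mem hA hcard φ X (fun b w hw y hy => by
        have h := hw _ (hpow b⁻¹ y hy)
        rw [map_inv, inv_inv, MulAut.mul_apply, MulAut.mul_apply] at h
        simpa using congrArg (φ b) h)
      (fun h => hpW (h.trans X.card_subgroup_dvd_card)) (fixedSubgroup (Subgroup.zpowers (φ a))) ?_
    · intro w hw
      exact hXle ((hmemX w).2 hw) _ (Subgroup.mem_zpowers _)
    · intro b hb1 w hw hbw
      by_cases hb : b ∈ Subgroup.zpowers a
      · rintro _ ⟨i, rfl⟩
        exact zpow_mem (show φ a ∈ MulAction.stabilizer (MulAut W) w from hfa b hb hb1 w hbw) i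
      · have := hfix w ((keyU b hb).2 w hbw) ((hmemX w).1 hw)
        rw [this]; exact one_mem _
  -- `Y` is trivial on the fixed points of `φ a`
  have hYfix : ∀ w, φ a w = w → ∀ y ∈ Y, y w = w := by
    intro w hw y hy
    -- `Y` preserves the fixed points of `φ a`, these being the fixed points of `x`, and `φ a` is
    -- trivial on them. So the commutator of `φ a` with `z`, which is `y`, is trivial there.
    obtain ⟨z, hzY, hz⟩ := exists_commutator_eq Y (hYn a) hYa hy
    have h1 : ∀ t ∈ Y, φ a (t w) = t w := fun t ht => hcx _ (by
      rw [← MulAut.mul_apply, ← (hYx t ht).eq, MulAut.mul_apply, hxa w hw])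
    have h2 : (φ a)⁻¹ (z⁻¹ w) = z⁻¹ w := by
      have := h1 _ (inv_mem hzY)
      nth_rw 1 [← this]
      simp
    rw [← hz, MulAut.mul_apply, MulAut.mul_apply, MulAut.mul_apply, h2]
    simp [hw]
  have hall := le_of_fixed_mem hA hcard φ (⊤ : Subgroup W) (fun _ _ _ => Subgroup.mem_top _)
    (by rwa [Subgroup.card_top]) F (fun b hb1 w _ hbw => by
      by_cases hb : b ∈ Subgroup.zpowers a
      · exact hYfix w (hfa b hb hb1 w hbw)
      · exact ((keyF b hb).2 w hbw).2)
  refine (Subgroup.eq_bot_iff_forall Y).2 fun y hy => MulEquiv.ext fun w => ?_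
  exact hall (Subgroup.mem_top w) y hy

omit [Fact q.Prime] in
include hA hcard hpW hW1 in
/-- A soluble `p'`-group `L` of automorphisms of a finite abelian group of coprime order is abelian
if an elementary abelian group of order `p ^ 2` acts on everything, the centralizers in `L` of its
nontrivial elements are cyclic and act trivially on their fixed points, of order at most a prime,
and it has no nontrivial fixed points in `L`. -/
theorem commute_of_rankTwo (L : Subgroup (MulAut W)) [Group.IsSolvable L]
    (hLn : ∀ a, ∀ l ∈ L, φ a * l * (φ a)⁻¹ ∈ L) (hpL : ¬ p ∣ Nat.card L)
    (hcop : ∀ q : ℕ, q.Prime → q ∣ Nat.card L → ¬ q ∣ Nat.card W)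
    (hcyc : ∀ a, a ≠ 1 → ∃ g : MulAut W, ∀ l ∈ L, Commute (φ a) l → l ∈ Subgroup.zpowers g)
    (hLW : ∀ a, a ≠ 1 → ∀ l ∈ L, Commute (φ a) l → ∀ w, φ a w = w → l w = w)
    (hLA : ∀ l ∈ L, (∀ a, Commute (φ a) l) → l = 1) : ∀ l ∈ L, ∀ m ∈ L, Commute l m := by
  have hp : p.Prime := Fact.out
  have hfin : Finite L := inferInstance
  have hcomm : ∀ a, a ≠ 1 → ∀ l ∈ L, ∀ m ∈ L, Commute (φ a) l → Commute (φ a) m →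
      Commute l m := by
    intro a ha l hl m hm hal ham
    obtain ⟨g, hg⟩ := hcyc a ha
    obtain ⟨i, rfl⟩ := hg l hl hal
    obtain ⟨j, rfl⟩ := hg m hm ham
    exact (Commute.refl g).zpow_zpow i j
  rcases subsingleton_or_nontrivial L with hL | hL
  · intro l hl m hm
    have : (⟨l, hl⟩ : L) = ⟨m, hm⟩ := Subsingleton.elim _ _
    obtain rfl : l = m := congrArg Subtype.val this
    rfl
  -- An abelian normal `A`-invariant subgroup `Q` of `L` supplies `x`: generation by fixed points
  -- gives some `a ≠ 1` with nontrivial centralizer in `Q`.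
  obtain ⟨D, hDchar, hD1, hDc⟩ := exists_characteristic_commutator_eq_bot L
  set Q := D.map L.subtype with hQ
  have hQL : Q ≤ L := Subgroup.map_subtype_le D
  have hQc : ∀ y ∈ Q, ∀ z ∈ Q, Commute y z := by
    rintro _ ⟨y, hy, rfl⟩ _ ⟨z, hz, rfl⟩
    have h := Subgroup.commutator_mem_commutator hy hz
    rw [hDc, Subgroup.mem_bot, commutatorElement_eq_one_iff_mul_comm] at h
    exact congrArg Subtype.val h
  set ψ : A →* MulAut (MulAut W) := MulAut.conj.comp φ with hψ
  have hQn : ∀ a, ∀ y ∈ Q, φ a * y * (φ a)⁻¹ ∈ Q := by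
    rintro a _ ⟨y, hy, rfl⟩
    have := Subgroup.characteristic_iff_map_eq.1 hDchar (restrictAction ψ L hLn a)
    exact ⟨restrictAction ψ L hLn a y, this ▸ Subgroup.mem_map_of_mem _ hy, rfl⟩
  have hQl : ∀ l ∈ L, ∀ y ∈ Q, l * y * l⁻¹ ∈ Q := by
    rintro l hl _ ⟨y, hy, rfl⟩
    have hDn : D.Normal := inferInstance
    exact ⟨_, hDn.conj_mem y hy ⟨l, hl⟩, rfl⟩
  have hfixed : ∀ a k, ψ a k = k ↔ Commute (φ a) k := fun a k => mul_inv_eq_iff_eq_mul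
  have hsol : Group.IsSolvable Q :=
    Group.isSolvable_of_isSolvable_injective (Subgroup.inclusion_injective hQL)
  have hpQ : ¬ p ∣ Nat.card Q := fun h => hpL (h.trans (Subgroup.card_dvd_of_le hQL))
  obtain ⟨a, ha, k, hkQ, hak, hk1⟩ : ∃ a, a ≠ 1 ∧ ∃ k ∈ Q, Commute (φ a) k ∧ k ≠ 1 := by
    by_contra! h
    have := le_of_fixed_mem hA hcard ψ Q hQn hpQ ⊥
      (fun a ha k hk hak => Subgroup.mem_bot.2 (h a ha k hk ((hfixed a k).1 hak)))
    exact hD1 ((Subgroup.map_eq_bot_iff_of_injective D L.subtype_injective).1 (le_bot_iff.1 this))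
  obtain ⟨q, hq, x, hxQ, hax, hx1, hxq⟩ : ∃ q : ℕ, q.Prime ∧ ∃ x ∈ Q, Commute (φ a) x ∧ x ≠ 1 ∧
      x ^ q = 1 := by
    obtain ⟨q, hq, hqk⟩ := Nat.exists_prime_and_dvd (fun h => hk1 (orderOf_eq_one_iff.1 h))
    have hpos := orderOf_pos k
    refine ⟨q, hq, k ^ (orderOf k / q), pow_mem hkQ _, hak.pow_right _, ?_, ?_⟩
    · exact pow_ne_one_of_lt_orderOf (Nat.div_pos (Nat.le_of_dvd hpos hqk) hq.pos).ne'
        (Nat.div_lt_self hpos hq.one_lt)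
    · rw [← pow_mul, Nat.div_mul_cancel hqk, pow_orderOf_eq_one]
  have : Fact q.Prime := ⟨hq⟩
  have hqW : ¬ q ∣ Nat.card W := by
    refine hcop q hq ?_
    rw [← orderOf_eq_prime hxq hx1]
    exact Subgroup.orderOf_dvd_natCard L (hQL hxQ)
  have hφc : ∀ b c : A, Commute (φ b) (φ c) := fun b c => (Commute.all b c).map φ
  -- The centralizer of `φ a` in `L` is invariant under `A` and lies in a cyclic group, where
  -- subgroups of order `q` are unique.
  have hxb : ∀ b, φ b * x * (φ b)⁻¹ ∈ Subgroup.zpowers x := by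
    intro b
    obtain ⟨g, hg⟩ := hcyc a ha
    refine mem_zpowers_of_mem_zpowers (q := q) (hg x (hQL hxQ) hax) (hg _ (hQL (hQn b x hxQ)) ?_)
      hxq (by rw [conj_pow, hxq]; simp) hx1
    exact ((hφc a b).mul_right hax).mul_right (hφc a b).inv_right
  have hnc : ∀ b, b ∉ Subgroup.zpowers a → ∀ y ∈ L, Commute (φ a) y → Commute (φ b) y →
      y = 1 := by
    intro b hb y hy hay hby
    refine hLA y hy fun c => ?_
    have : (Subgroup.centralizer {y}).comap φ = ⊤ :=
      eq_top_of_mem_of_notMem_zpowers hA hcard ha hb _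
        (Subgroup.mem_centralizer_singleton_iff.2 hay.eq)
        (Subgroup.mem_centralizer_singleton_iff.2 hby.eq)
    have hc : c ∈ (Subgroup.centralizer {y}).comap φ := this ▸ Subgroup.mem_top c
    exact Subgroup.mem_centralizer_singleton_iff.1 hc
  have hfa : ∀ b : A, b ∈ Subgroup.zpowers a → b ≠ 1 → ∀ y, Commute (φ b) y →
      Commute (φ a) y := by
    intro b hb hb1 y hy
    have hz := zpowers_eq_of_mem_of_ne_one (hA a) hb hb1
    have h1 : a ∈ Subgroup.zpowers b := hz ▸ Subgroup.mem_zpowers a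
    obtain ⟨i, rfl⟩ := h1
    change Commute (φ (b ^ i)) y
    rw [map_zpow]
    exact hy.zpow_left i
  -- For `b` outside ⟨a⟩, `eq_bot_of_commute` shows that `φ b` centralizes nothing in `N` but 1.
  -- Generation by fixed points then makes `φ a` centralize `N`. This is used for `Q`, and then for
  -- `L` itself.
  have main : ∀ N : Subgroup (MulAut W), N ≤ L → (∀ b, ∀ y ∈ N, φ b * y * (φ b)⁻¹ ∈ N) →
      (∀ b, b ∉ Subgroup.zpowers a → ∀ y ∈ N, Commute (φ b) y → Commute y x) →
      ∀ y ∈ N, Commute (φ a) y := by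
    intro N hNL hNn hNx
    have hsol : Group.IsSolvable N :=
      Group.isSolvable_of_isSolvable_injective (Subgroup.inclusion_injective hNL)
    have := le_of_fixed_mem hA hcard ψ N hNn
      (fun h => hpL (h.trans (Subgroup.card_dvd_of_le hNL))) (Subgroup.centralizer {φ a}) ?_
    · intro y hy
      exact (Subgroup.mem_centralizer_singleton_iff.1 (this hy)).symm
    · intro b hb1 y hy hby
      have hby := (hfixed b y).1 hby
      by_cases hb : b ∈ Subgroup.zpowers a
      · exact Subgroup.mem_centralizer_singleton_iff.2 (hfa b hb hb1 y hby).symm.eq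
      · have hbot := eq_bot_of_commute hA hcard φ hpW hqW hW1 ha hb hx1 hxq
          (hLW a ha x (hQL hxQ) hax) hxb
          (fun c hc hcx => hx1 (hnc c hc x (hQL hxQ) hax hcx))
          (N ⊓ Subgroup.centralizer {φ b})
          (fun y hy => hNx b hb y hy.1 (Subgroup.mem_centralizer_singleton_iff.1 hy.2).symm)
          (fun c y hy => ⟨hNn c y hy.1, Subgroup.mem_centralizer_singleton_iff.2 (by
            have h2 : Commute (φ b) y := (Subgroup.mem_centralizer_singleton_iff.1 hy.2).symm
            exact (((hφc b c).mul_right h2).mul_right (hφc b c).inv_right).symm.eq)⟩)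
          (fun w hw y hy => hLW b hb1 y (hNL hy.1)
            (Subgroup.mem_centralizer_singleton_iff.1 hy.2).symm w hw)
          (fun y hy hay => hnc b hb y (hNL hy.1) hay
            (Subgroup.mem_centralizer_singleton_iff.1 hy.2).symm)
        have : y ∈ N ⊓ Subgroup.centralizer {φ b} :=
          ⟨hy, Subgroup.mem_centralizer_singleton_iff.2 hby.symm.eq⟩
        rw [hbot, Subgroup.mem_bot] at this
        rw [this]; exact one_mem _
  have hQa := main Q hQL hQn (fun b _ y hy _ => hQc y hy x hxQ)
  -- Write `y` as the commutator of `φ a` with some `z`. The conjugate z⁻¹xz lies in `Q`, so the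
  -- first application shows it commutes with `φ a`; hence `y` commutes with `x`.
  have hLa := main L le_rfl hLn (fun b hb y hy hby => by
    have hb1 : b ≠ 1 := fun h => hb (h ▸ one_mem _)
    obtain ⟨z, hz, hzy⟩ := exists_commutator_eq (L ⊓ Subgroup.centralizer {φ b}) (t := φ a)
      (fun y hy => ⟨hLn a y hy.1, Subgroup.mem_centralizer_singleton_iff.2 (by
        have h2 : Commute (φ b) y := (Subgroup.mem_centralizer_singleton_iff.1 hy.2).symm
        exact (((hφc b a).mul_right h2).mul_right (hφc b a).inv_right).symm.eq)⟩)
      (fun y hy hay => hnc b hb y hy.1 hay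
        (Subgroup.mem_centralizer_singleton_iff.1 hy.2).symm)
      (y := y) ⟨hy, Subgroup.mem_centralizer_singleton_iff.2 hby.symm.eq⟩
    have h1 : φ a * (z⁻¹ * x * z) * (φ a)⁻¹ = z⁻¹ * x * z := by
      have := hQl z⁻¹ (inv_mem hz.1) x hxQ
      rw [inv_inv] at this
      exact mul_inv_eq_iff_eq_mul.2 (hQa _ this)
    have h2 : (φ a)⁻¹ * x * φ a = x := by
      rw [mul_assoc, inv_mul_eq_iff_eq_mul]; exact hax.symm
    have h3 : y * x * y⁻¹ = x := by
      calc y * x * y⁻¹ = φ a * z * (φ a)⁻¹ * (z⁻¹ * x * z) * φ a * z⁻¹ * (φ a)⁻¹ := by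
            rw [← hzy]; group
        _ = φ a * z * (φ a)⁻¹ * (φ a * (z⁻¹ * x * z) * (φ a)⁻¹) * φ a * z⁻¹ * (φ a)⁻¹ := by
            rw [h1]
        _ = φ a * x * (φ a)⁻¹ := by group
        _ = x := mul_inv_eq_iff_eq_mul.2 hax
    exact mul_inv_eq_iff_eq_mul.1 h3)
  exact fun l hl m hm => hcomm a ha l hl m hm (hLa l hl) (hLa m hm)

end RankTwoAction

/-! ### Transfer of the minimal condition -/

section MinimalCondition

variable {P : Type*} {Q : Type*} [Group P] [Group Q]

theorem minimalCondition_iff_wellFoundedLT : MinimalCondition P ↔ WellFoundedLT (Subgroup P) := by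
  refine ⟨fun h => ⟨WellFounded.wellFounded_iff_has_min.2 fun S hS => ?_⟩, fun h S hS => ?_⟩
  · obtain ⟨H, hH⟩ := h S hS
    exact ⟨H, hH.prop, fun K hK hlt => hH.not_lt hK hlt⟩
  · obtain ⟨H, hH, hmin⟩ := WellFounded.has_min h.wf S hS
    exact ⟨H, hH, fun K hK hle => not_lt_iff_le_imp_ge.1 (hmin K hK) hle⟩

theorem wellFoundedLT_subgroup_of_injective (f : P →* Q) (hf : Function.Injective f)
    [h : WellFoundedLT (Subgroup Q)] : WellFoundedLT (Subgroup P) :=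
  (OrderEmbedding.ofMapLEIff (Subgroup.map f)
    (fun _ _ => Subgroup.map_le_map_iff_of_injective hf)).wellFoundedLT

theorem wellFoundedLT_subgroup_of_surjective (f : P →* Q) (hf : Function.Surjective f)
    [h : WellFoundedLT (Subgroup P)] : WellFoundedLT (Subgroup Q) :=
  (OrderEmbedding.ofMapLEIff (Subgroup.comap f)
    (fun _ _ => Subgroup.comap_le_comap_of_surjective hf)).wellFoundedLT

end MinimalCondition

/-! ### Local finiteness -/

section LocallyFinite

variable {G : Type*} [Group G]

/-- A subgroup of finite index in a finitely generated group is finitely generated, and a finitely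
generated abelian torsion group is finite; so finite index passes to the next derived term. -/
theorem finiteIndex_derivedSeries [Group.FG G] (hper : IsMulTorsion G) (n : ℕ) :
    (derivedSeries G n).FiniteIndex := by
  induction n with
  | zero => rw [derivedSeries_zero]; infer_instance
  | succ n ih =>
    set D := derivedSeries G n with hD
    have hFG : Group.FG D := Subgroup.fg_of_index_ne_zero D
    have htor : IsMulTorsion (Abelianization D) :=
      (hper.subgroup D).of_surjective (f := Abelianization.of) QuotientGroup.mk_surjective
    have hfgA : Group.FG (Abelianization D) :=
      Group.fg_of_surjective (f := (Abelianization.of : D →* Abelianization D))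
        QuotientGroup.mk_surjective
    have hfin : Finite (Abelianization D) := CommGroup.finite_of_fg_isMulTorsion _ htor
    have hfin' : Finite (D ⧸ commutator D) := hfin
    have hci : (commutator D).FiniteIndex := Subgroup.finiteIndex_of_finite_quotient
    have heq : derivedSeries G (n + 1) = (commutator D).map D.subtype := by
      rw [derivedSeries_succ, commutator_def, Subgroup.map_commutator, ← MonoidHom.range_eq_map,
        Subgroup.range_subtype]
    refine ⟨?_⟩
    rw [heq, Subgroup.index_map_subtype]
    exact mul_ne_zero hci.index_ne_zero ih.index_ne_zero

theorem finite_of_fg_of_isSolvable [Group.FG G] [Group.IsSolvable G] (hper : IsMulTorsion G) :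
    Finite G := by
  obtain ⟨n, hn⟩ := (inferInstance : Group.IsSolvable G).solvable
  have h := (finiteIndex_derivedSeries hper n).index_ne_zero
  rw [hn, Subgroup.index_bot] at h
  exact Nat.finite_of_card_ne_zero h

/-- Locally finite, locally soluble groups whose `p`-subgroups satisfy the minimal condition. -/
structure IsLocFinSolMin (G : Type*) [Group G] : Prop where
  finite_closure : ∀ s : Set G, s.Finite → Finite (Subgroup.closure s)
  isSolvable_closure : ∀ s : Set G, s.Finite → Group.IsSolvable (Subgroup.closure s)
  wellFoundedLT : ∀ p : ℕ, p.Prime → ∀ P : Subgroup G, IsPGroup p P → WellFoundedLT (Subgroup P)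

theorem IsLocallySoluble.isLocFinSolMin (hper : IsMulTorsion G) (hsol : IsLocallySoluble G)
    (hmin : ∀ p : ℕ, p.Prime → ∀ P : Subgroup G, IsPGroup p P → MinimalCondition P) :
    IsLocFinSolMin G := by
  have hs : ∀ s : Set G, s.Finite → Group.IsSolvable (Subgroup.closure s) := fun s hs =>
    hsol _ ⟨hs.toFinset, by simp⟩
  refine ⟨fun s hfin => ?_, hs, fun p hp P hP =>
    minimalCondition_iff_wellFoundedLT.1 (hmin p hp P hP)⟩
  have := hs s hfin
  have : Finite s := hfin
  exact finite_of_fg_of_isSolvable (hper.subgroup _)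

namespace IsLocFinSolMin

variable (h : IsLocFinSolMin G)

include h in
theorem isSolvable_of_finite (H : Subgroup G) [Finite H] : Group.IsSolvable H := by
  have := h.isSolvable_closure (H : Set G) (Set.toFinite _)
  rwa [Subgroup.closure_eq] at this

include h in
theorem isOfFinOrder (g : G) : IsOfFinOrder g := by
  have := h.finite_closure {g} (Set.finite_singleton g)
  rw [← Subgroup.zpowers_eq_closure] at this
  exact (Subgroup.zpowers g).subtype.isOfFinOrder
    (isOfFinOrder_of_finite (⟨g, Subgroup.mem_zpowers g⟩ : Subgroup.zpowers g))

include h in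
theorem subgroup (H : Subgroup G) : IsLocFinSolMin H := by
  have key : ∀ s : Set H, (Subgroup.closure s).map H.subtype = Subgroup.closure (H.subtype '' s) :=
    fun s => MonoidHom.map_closure _ _
  have e : ∀ K : Subgroup H, K ≃* K.map H.subtype := fun K =>
    K.equivMapOfInjective H.subtype H.subtype_injective
  refine ⟨fun s hs => ?_, fun s hs => ?_, fun p hp P hP => ?_⟩
  · have := h.finite_closure _ (hs.image H.subtype)
    rw [← key] at this
    exact Finite.of_equiv _ (e _).symm.toEquiv
  · have := h.isSolvable_closure _ (hs.image H.subtype)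
    rw [← key] at this
    exact Group.isSolvable_of_isSolvable_injective
      (f := (e (Subgroup.closure s)).toMonoidHom) (e _).injective
  · have := h.wellFoundedLT p hp (P.map H.subtype) (hP.map _)
    exact wellFoundedLT_subgroup_of_injective (e P).toMonoidHom (e P).injective

end IsLocFinSolMin

end LocallyFinite

/-! ### Permanence of virtual commutativity -/

section VirtuallyAbelian

variable {G : Type*} {H : Type*} [Group G] [Group H]

theorem IsVirtuallyAbelian.of_injective (hH : IsVirtuallyAbelian H) (f : G →* H)
    (hf : Function.Injective f) : IsVirtuallyAbelian G := by
  obtain ⟨A, hA, hAi⟩ := hH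
  exact ⟨A.comap f, Subgroup.comap_injective_isMulCommutative A hf, ⟨by
    rw [Subgroup.index_comap]
    exact (inferInstance : (A.subgroupOf f.range).FiniteIndex).index_ne_zero⟩⟩

theorem IsVirtuallyAbelian.of_surjective (hG : IsVirtuallyAbelian G) (f : G →* H)
    (hf : Function.Surjective f) : IsVirtuallyAbelian H := by
  obtain ⟨A, hA, hAi⟩ := hG
  exact ⟨A.map f, inferInstance,
    ⟨ne_zero_of_dvd_ne_zero hAi.index_ne_zero (A.index_map_dvd hf)⟩⟩

theorem IsVirtuallyAbelian.mono {K L : Subgroup G} (hL : IsVirtuallyAbelian L) (hKL : K ≤ L) :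
    IsVirtuallyAbelian K :=
  hL.of_injective (Subgroup.inclusion hKL) (Subgroup.inclusion_injective hKL)

theorem IsVirtuallyAbelian.of_finiteIndex {K : Subgroup G} (hK : IsVirtuallyAbelian K)
    [hKi : K.FiniteIndex] : IsVirtuallyAbelian G := by
  obtain ⟨A, hA, hAi⟩ := hK
  refine ⟨A.map K.subtype, inferInstance, ⟨?_⟩⟩
  rw [Subgroup.index_map_subtype]
  exact mul_ne_zero hAi.index_ne_zero hKi.index_ne_zero

/-- A virtually abelian group all of whose finitely generated subgroups are soluble is soluble. -/
theorem IsVirtuallyAbelian.isSolvable (hG : IsVirtuallyAbelian G)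
    (hs : ∀ s : Set G, s.Finite → Group.IsSolvable (Subgroup.closure s)) : Group.IsSolvable G := by
  obtain ⟨A, hA, hAi⟩ := hG
  set N := A.normalCore
  have hfin : Finite (G ⧸ N) := inferInstance
  have hNA : N ≤ A := A.normalCore_le
  have hN : Group.IsSolvable N := by
    have : IsMulCommutative N := ⟨⟨fun x y => Subtype.ext
      (setLike_mul_comm (hNA x.2) (hNA y.2))⟩⟩
    exact Group.isSolvable_of_comm fun x y => mul_comm' x y
  -- Finitely many coset representatives generate a soluble subgroup that covers the quotient by
  -- `N`.
  have hT := hs (Set.range (Quotient.out : G ⧸ N → G)) (Set.finite_range _)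
  set T := Subgroup.closure (Set.range (Quotient.out : G ⧸ N → G))
  have hQ : Group.IsSolvable (G ⧸ N) := by
    refine Group.isSolvable_of_surjective (f := (QuotientGroup.mk' N).comp T.subtype) fun x => ?_
    exact ⟨⟨x.out, Subgroup.subset_closure ⟨x, rfl⟩⟩, QuotientGroup.out_eq' x⟩
  exact Group.isSolvable_of_ker_le_range N.subtype (QuotientGroup.mk' N) (by simp)

end VirtuallyAbelian

/-! ### From icc to the chain condition on centralizers -/

section CentralizerDCC

/-- The descending chain condition on centralizers. -/
def CentralizerDCC (G : Type*) [Group G] : Prop :=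
  WellFoundedLT {C : Subgroup G // ∃ S : Set G, C = Subgroup.centralizer S}

/-- The formula `x * y = y * x`. -/
def commuteFormula : groupLanguage.Formula (Unit ⊕ Fin 1) :=
  FirstOrder.Language.Term.equal
    (.func (l := 2) GroupFunc.mul ![.var (Sum.inl ()), .var (Sum.inr 0)])
    (.func (l := 2) GroupFunc.mul ![.var (Sum.inr 0), .var (Sum.inl ())])

theorem mem_solutionSet_commuteFormula {X : Type v} [Group X] (a : Fin 1 → X) (x : X) :
    x ∈ solutionSet commuteFormula a ↔ x * a 0 = a 0 * x := by
  change (FirstOrder.Language.Formula.Realize _ _) ↔ _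
  unfold commuteFormula
  rw [FirstOrder.Language.Formula.realize_equal]
  rfl

theorem centralizer_mem_definableIntersections {X : Type v} [Group X] (S : Set X) :
    Subgroup.centralizer S ∈ definableIntersections X commuteFormula := by
  refine ⟨(fun s => Subgroup.centralizer {s}) '' S, ?_, ?_⟩
  · rintro _ ⟨s, -, rfl⟩
    refine ⟨fun _ => s, Set.ext fun x => ?_⟩
    rw [mem_solutionSet_commuteFormula]
    exact Subgroup.mem_centralizer_singleton_iff
  · ext x
    rw [sInf_image, Subgroup.mem_iInf, Subgroup.mem_centralizer_iff]
    simp only [Subgroup.mem_iInf, Subgroup.mem_centralizer_singleton_iff]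
    exact ⟨fun h s hs => (h s hs).symm, fun h s hs => (h s hs).symm⟩

/-- A centralizer C in G is the trace on G of the centralizer in X of the image of C_G(C). A
strictly descending sequence in G thus yields one in X, made of intersections of instances of a
single formula. -/
theorem IsSubIcc.centralizerDCC {G : Type u} [Group G] (h : IsSubIcc.{u, v} G) :
    CentralizerDCC G := by
  obtain ⟨X, _, hX, H, ⟨e⟩⟩ := h
  obtain ⟨n, hn⟩ := hX 1 commuteFormula
  let ι : G →* X := H.subtype.comp e.toMonoidHom
  have hι : Function.Injective ι := H.subtype_injective.comp e.injective
  refine ⟨RelEmbedding.wellFounded_iff_isEmpty.2 ⟨fun f => ?_⟩⟩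
  let c : ℕ → Subgroup X := fun k =>
    Subgroup.centralizer (ι '' (Subgroup.centralizer ((f k : Subgroup G) : Set G)))
  have hc : ∀ k g, ι g ∈ c k ↔ g ∈ (f k : Subgroup G) := by
    intro k g
    obtain ⟨S, hS⟩ := (f k).2
    simp only [c, Subgroup.mem_centralizer_iff, Set.forall_mem_image, SetLike.mem_coe]
    constructor
    · intro h
      rw [hS, Subgroup.mem_centralizer_iff]
      intro s hs
      refine hι ?_
      rw [map_mul, map_mul]
      refine h fun t ht => ?_
      rw [hS, Subgroup.mem_centralizer_iff] at ht
      exact (ht s hs).symm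
    · intro hg t ht
      rw [← map_mul, ← map_mul, ht g hg]
  have hlt : ∀ i j, i < j → (f j : Subgroup G) < f i := fun i j hij => f.map_rel_iff.2 hij
  have hle : ∀ i j, i ≤ j → c j ≤ c i := by
    intro i j hij
    refine Subgroup.centralizer_le (Set.image_mono (Subgroup.centralizer_le ?_))
    rcases hij.eq_or_lt with rfl | hij
    · exact le_rfl
    · exact (hlt i j hij).le
  have hinj : Function.Injective c := by
    have : ∀ i j, i < j → c i ≠ c j := by
      intro i j hij heq
      refine (hlt i j hij).not_ge fun g hg => ?_
      rw [← hc, ← heq, hc]; exact hg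
    intro i j hij
    rcases lt_trichotomy i j with h | h | h
    · exact absurd hij (this i j h)
    · exact h
    · exact absurd hij.symm (this j i h)
  have hchain := hn (Set.range c)
    (by rintro _ ⟨k, rfl⟩; exact centralizer_mem_definableIntersections _)
    (by
      rintro _ ⟨i, rfl⟩ _ ⟨j, rfl⟩ -
      rcases le_total i j with h | h
      · exact Or.inr (hle i j h)
      · exact Or.inl (hle j i h))
  rw [(Set.infinite_range_of_injective hinj).encard_eq] at hchain
  exact absurd hchain (by simp)

end CentralizerDCC

/-! ### Bounded torsion in abelian subgroups -/

section TorsionFinite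

theorem finite_of_wellFoundedLT_of_pow_eq_one {E : Type*} [CommGroup E] {p : ℕ} [Fact p.Prime]
    (hE : ∀ e : E, e ^ p = 1) [h : WellFoundedLT (Subgroup E)] : Finite E := by
  let _ : Module (ZMod p) (Additive E) := AddCommGroup.zmodModule (n := p) fun e => hE e.toMul
  have : IsArtinian (ZMod p) (Additive E) := by
    let f : Submodule (ZMod p) (Additive E) ↪o Subgroup E :=
      OrderEmbedding.ofMapLEIff (fun S => AddSubgroup.toSubgroup' S.toAddSubgroup)
        fun S T => Iff.rfl
    exact f.wellFoundedLT
  let b := Module.Basis.ofVectorSpace (ZMod p) (Additive E)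
  have : Finite (Module.Basis.ofVectorSpaceIndex (ZMod p) (Additive E)) :=
    IsArtinian.finite_of_linearIndependent (R := ZMod p)
      (Module.Basis.ofVectorSpaceIndex.linearIndependent (ZMod p) (Additive E))
  have := Module.Finite.of_basis b
  have := Module.finite_of_finite (ZMod p) (M := Additive E)
  exact Finite.of_equiv _ (Additive.toMul (α := E))

variable {G : Type*} [Group G]

/-- For a prime exponent this is an elementary abelian group with the minimal condition, a
finite-dimensional space. For a product ab, the fibres of z ↦ z^a are cosets of the a-torsion. -/
theorem IsLocFinSolMin.finite_torsion (h : IsLocFinSolMin G) (N : Subgroup G)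
    (hN : IsMulCommutative N) {n : ℕ} (hn : n ≠ 0) : {z : G | z ∈ N ∧ z ^ n = 1}.Finite := by
  induction n using Nat.recOnMul with
  | zero => exact absurd rfl hn
  | one => exact (Set.finite_singleton 1).subset (by rintro z ⟨-, hz⟩; simpa using hz)
  | prime p hp =>
    have : Fact p.Prime := ⟨hp⟩
    let E : Subgroup G :=
      { carrier := {z | z ∈ N ∧ z ^ p = 1}
        one_mem' := ⟨one_mem _, one_pow _⟩
        mul_mem' := fun {a b} ha hb => ⟨mul_mem ha.1 hb.1, by
          rw [Commute.mul_pow (setLike_mul_comm ha.1 hb.1), ha.2, hb.2, one_mul]⟩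
        inv_mem' := fun {a} ha => ⟨inv_mem ha.1, by rw [inv_pow, ha.2, inv_one]⟩ }
    have := h.wellFoundedLT p hp E (fun z => ⟨1, Subtype.ext (by
      rw [pow_one]; exact z.2.2)⟩)
    let _ : CommGroup E :=
      { (inferInstance : Group E) with
        mul_comm := fun a b => Subtype.ext (setLike_mul_comm a.2.1 b.2.1) }
    exact finite_of_wellFoundedLT_of_pow_eq_one (E := E) (p := p) fun e => Subtype.ext e.2.2
  | mul a b iha ihb =>
    have ha := iha (left_ne_zero_of_mul hn)
    have hb := ihb (right_ne_zero_of_mul hn)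
    refine ((hb.preimage' (f := fun z : N => (z : G) ^ a) fun y hy => ?_).image
      (Subtype.val : N → G)).subset ?_
    · by_cases hne : ∃ z : N, (z : G) ^ a = y
      · obtain ⟨z, rfl⟩ := hne
        refine ((ha.preimage (f := fun w : N => (w : G)) Subtype.val_injective.injOn).image
          (fun w : N => z * w)).subset fun w hw => ⟨z⁻¹ * w, ⟨(z⁻¹ * w).2, ?_⟩, by simp⟩
        have hw : (w : G) ^ a = (z : G) ^ a := hw
        have hc : Commute (z : G)⁻¹ w := Commute.inv_left (setLike_mul_comm z.2 w.2)
        change ((z : G)⁻¹ * w) ^ a = 1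
        rw [hc.mul_pow, hw, inv_pow, inv_mul_cancel]
      · exact Set.finite_empty.subset fun w hw => (hne ⟨w, hw⟩).elim
    · rintro z ⟨hz, hzp⟩
      exact ⟨⟨z, hz⟩, ⟨pow_mem hz a, by rw [← pow_mul]; exact hzp⟩, rfl⟩

end TorsionFinite

/-! ### Passage to the central quotient -/

section Quotient

variable {G : Type*} [Group G]

/-- The subgroup generated by x and y is finite and a p-group modulo central elements, hence
nilpotent, and its p-elements form its only Sylow p-subgroup. -/
theorem isPGroup_closure_pair_mul (h : IsLocFinSolMin G) {p : ℕ} [Fact p.Prime]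
    (f : G →* G ⧸ Subgroup.center G) (hf : f = QuotientGroup.mk' _)
    {P : Subgroup (G ⧸ Subgroup.center G)}
    (hP : IsPGroup p P) {x y : G} (hx : f x ∈ P) (hy : f y ∈ P) (hxp : ∃ k, x ^ p ^ k = 1)
    (hyp : ∃ k, y ^ p ^ k = 1) : ∃ k, (x * y) ^ p ^ k = 1 := by
  set F := Subgroup.closure {x, y} with hF
  have hfin : Finite F := h.finite_closure _ (Set.toFinite _)
  have hxF : x ∈ F := Subgroup.subset_closure (by simp)
  have hyF : y ∈ F := Subgroup.subset_closure (by simp)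
  have hFP : F.map f ≤ P := by
    rw [Subgroup.map_le_iff_le_comap, hF, Subgroup.closure_le]
    rintro z (rfl | rfl)
    · exact hx
    · exact hy
  have hnilF : Group.IsNilpotent F := by
    have : Finite (F.map f) := Finite.of_surjective _ (f.subgroupMap_surjective F)
    have hnil : Group.IsNilpotent (F.map f) := (hP.to_le hFP).isNilpotent
    refine Subgroup.isNilpotent_of_ker_le_center (f.subgroupMap F) ?_
    intro z hz
    have hz : f z = 1 := congrArg Subtype.val hz
    rw [hf] at hz
    have hz := (QuotientGroup.eq_one_iff _).1 hz
    exact Subgroup.mem_center_iff.2 fun w => Subtype.ext (Subgroup.mem_center_iff.1 hz w)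
  obtain ⟨Q⟩ : Nonempty (Sylow p F) := inferInstance
  have hQn : (Q : Subgroup F).Normal := inferInstance
  have key : ∀ z : F, (∃ k, (z : G) ^ p ^ k = 1) → z ∈ (Q : Subgroup F) := by
    rintro z ⟨k, hk⟩
    obtain ⟨R, hR⟩ := (isPGroup_zpowers_of_pow_eq_one (p := p) (g := z) (n := k)
      (Subtype.ext hk)).exists_le_sylow
    let _ := Sylow.unique_of_normal Q hQn
    rw [Subsingleton.elim Q R]
    exact hR (Subgroup.mem_zpowers z)
  obtain ⟨k, hk⟩ := Q.isPGroup' ⟨_, mul_mem (key ⟨x, hxF⟩ hxp) (key ⟨y, hyF⟩ hyp)⟩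
  exact ⟨k, congrArg (fun z => ((z : F) : G)) (congrArg Subtype.val hk)⟩

/-- For the minimal condition, the p-elements above a p-subgroup P of the quotient form a p-subgroup
of G that maps onto P. -/
theorem IsLocFinSolMin.quotient_center (h : IsLocFinSolMin G) :
    IsLocFinSolMin (G ⧸ Subgroup.center G) := by
  set f := QuotientGroup.mk' (Subgroup.center G) with hf
  have hsurj : Function.Surjective f := QuotientGroup.mk'_surjective _
  have hcl : ∀ s : Set (G ⧸ Subgroup.center G), s.Finite → ∃ t : Set G, t.Finite ∧
      (Subgroup.closure t).map f = Subgroup.closure s := by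
    intro s hs
    refine ⟨Quotient.out '' s, hs.image _, ?_⟩
    rw [MonoidHom.map_closure, Set.image_image]
    congr 1
    convert Set.image_id s using 2 with x
    exact QuotientGroup.out_eq' x
  refine ⟨fun s hs => ?_, fun s hs => ?_, fun p hp P hP => ?_⟩
  · obtain ⟨t, ht, hts⟩ := hcl s hs
    have := h.finite_closure t ht
    rw [← hts]
    exact Finite.of_surjective _ (f.subgroupMap_surjective _)
  · obtain ⟨t, ht, hts⟩ := hcl s hs
    have := h.isSolvable_closure t ht
    rw [← hts]
    exact Group.isSolvable_of_surjective (f.subgroupMap_surjective _)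
  · have : Fact p.Prime := ⟨hp⟩
    let S : Subgroup G :=
      { carrier := {x | f x ∈ P ∧ ∃ k, x ^ p ^ k = 1}
        one_mem' := ⟨by rw [map_one]; exact one_mem _, 0, one_pow _⟩
        mul_mem' := fun {a b} ha hb => ⟨by rw [map_mul]; exact mul_mem ha.1 hb.1,
          isPGroup_closure_pair_mul h f rfl hP ha.1 hb.1 ha.2 hb.2⟩
        inv_mem' := fun {a} ha => ⟨by rw [map_inv]; exact inv_mem ha.1,
          ha.2.imp fun k hk => by rw [inv_pow, hk, inv_one]⟩ }
    have hS : IsPGroup p S := fun x => x.2.2.imp fun k hk => Subtype.ext hk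
    have := h.wellFoundedLT p hp S hS
    let g : S →* P := (f.comp S.subtype).codRestrict P fun x => x.2.1
    refine wellFoundedLT_subgroup_of_surjective g ?_
    rintro ⟨z, hz⟩
    obtain ⟨x, rfl⟩ := hsurj z
    obtain ⟨j, hj⟩ := hP ⟨f x, hz⟩
    have hj : f x ^ p ^ j = 1 := congrArg Subtype.val hj
    have hx := h.isOfFinOrder x
    have hn := hx.orderOf_pos.ne'
    have hco : (orderOf x / p ^ (orderOf x).factorization p).Coprime (p ^ j) :=
      (Nat.coprime_ordCompl hp hn).symm.pow_right j
    -- The power x^s is a `p`-element, since `s` is divisible by the `p'`-part of the order; s ≡ 1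
    -- mod p^j keeps its image equal to that of `x`.
    obtain ⟨s, hs0, hs1⟩ := Nat.chineseRemainder hco 0 1
    refine ⟨⟨x ^ s, by rw [map_pow]; exact pow_mem hz s, (orderOf x).factorization p, ?_⟩, ?_⟩
    · rw [← pow_mul]
      refine orderOf_dvd_iff_pow_eq_one.1 ?_
      have := Nat.mul_dvd_mul_right ((Nat.modEq_zero_iff_dvd).1 hs0)
        (p ^ (orderOf x).factorization p)
      rwa [Nat.div_mul_cancel (Nat.ordProj_dvd _ _)] at this
    · refine Subtype.ext ?_
      change f (x ^ s) = f x
      rw [map_pow]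
      conv_rhs => rw [← pow_one (f x)]
      exact pow_eq_pow_iff_modEq.2 (hs1.of_dvd (orderOf_dvd_of_pow_eq_one hj))

/-- On the preimage of the centralizer of xZ, the commutator with x takes values in the elements of
Z(G) of exponent dividing the order of x, a finite set, and its fibres lie in single cosets of C(x).
-/
theorem IsLocFinSolMin.relIndex_centralizer_ne_zero (h : IsLocFinSolMin G) (x : G) :
    ((Subgroup.centralizer {x}).subgroupOf ((Subgroup.centralizer
      {(x : G ⧸ Subgroup.center G)}).comap (QuotientGroup.mk' _))).FiniteIndex := by
  set E := (Subgroup.centralizer {(x : G ⧸ Subgroup.center G)}).comap (QuotientGroup.mk' _) with hE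
  have hfin := h.finite_torsion (Subgroup.center G) inferInstance (h.isOfFinOrder x).orderOf_pos.ne'
  have hmem : ∀ g : E, (g : G) * x * (g : G)⁻¹ * x⁻¹ ∈
      {z : G | z ∈ Subgroup.center G ∧ z ^ orderOf x = 1} := by
    rintro ⟨g, hg⟩
    have hg : (g : G ⧸ Subgroup.center G) * x = x * g :=
      Subgroup.mem_centralizer_singleton_iff.1 hg
    have hz : g * x * g⁻¹ * x⁻¹ ∈ Subgroup.center G := by
      refine (QuotientGroup.eq_one_iff _).1 ?_
      change (g : G ⧸ Subgroup.center G) * x * (g : G ⧸ Subgroup.center G)⁻¹ *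
        (x : G ⧸ Subgroup.center G)⁻¹ = 1
      rw [mul_inv_eq_one, mul_inv_eq_iff_eq_mul]; exact hg
    refine ⟨hz, ?_⟩
    have hc : Commute (g * x * g⁻¹ * x⁻¹) x := (Subgroup.mem_center_iff.1 hz x).symm
    have h1 := hc.mul_pow (orderOf x)
    rw [inv_mul_cancel_right, conj_pow, pow_orderOf_eq_one, mul_one, mul_one, mul_inv_cancel] at h1
    exact h1.symm
  have : Finite {z : G | z ∈ Subgroup.center G ∧ z ^ orderOf x = 1} := hfin
  have hker : ∀ g k : E, (g : G) * x * (g : G)⁻¹ * x⁻¹ = (k : G) * x * (k : G)⁻¹ * x⁻¹ →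
      g⁻¹ * k ∈ (Subgroup.centralizer {x}).subgroupOf E := by
    intro g k hgk
    have hgk := mul_right_cancel hgk
    refine Subgroup.mem_centralizer_singleton_iff.2 ?_
    have : (g : G)⁻¹ * (g * x * (g : G)⁻¹) * k = (g : G)⁻¹ * (k * x * (k : G)⁻¹) * k := by rw [hgk]
    have h2 : x * ((g : G)⁻¹ * k) = (g : G)⁻¹ * k * x := by
      simpa [mul_assoc] using this
    exact h2.symm
  have hfinq : Finite (E ⧸ (Subgroup.centralizer {x}).subgroupOf E) := by
    refine Finite.of_injective (fun q => (⟨_, hmem q.out⟩ :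
      {z : G | z ∈ Subgroup.center G ∧ z ^ orderOf x = 1})) fun q r hqr => ?_
    have := QuotientGroup.eq.2 (hker q.out r.out (congrArg Subtype.val hqr))
    rwa [QuotientGroup.out_eq', QuotientGroup.out_eq'] at this
  exact Subgroup.finiteIndex_of_finite_quotient

end Quotient

/-! ### Reduction to small centralizers -/

section Reduction

variable {G : Type u} [Group G]

/-- A minimal centralizer of a finite set T of elements with finitely many conjugates has finite
index, and by minimality it centralizes every such element. It is either virtually abelian or all of
G. -/
theorem isVirtuallyAbelian_or_mem_center (hdcc : CentralizerDCC G)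
    (hC : ∀ T : Set G, Subgroup.centralizer T = ⊤ ∨ IsVirtuallyAbelian (Subgroup.centralizer T)) :
    IsVirtuallyAbelian G ∨
      ∀ x : G, (Subgroup.centralizer {x}).FiniteIndex → x ∈ Subgroup.center G := by
  obtain ⟨⟨C, hC'⟩, ⟨T, hTF, hT, hTC⟩, hmin⟩ := WellFounded.has_min hdcc.wf
    {C | ∃ T : Set G, T.Finite ∧ (∀ x ∈ T, (Subgroup.centralizer {x}).FiniteIndex) ∧
      (C : Subgroup G) = Subgroup.centralizer T}
    ⟨⟨Subgroup.centralizer ∅, ∅, rfl⟩, ∅, Set.finite_empty, by simp, rfl⟩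
  have hTC : C = Subgroup.centralizer T := hTC
  subst hTC
  have hle : ∀ x : G, (Subgroup.centralizer {x}).FiniteIndex →
      Subgroup.centralizer T ≤ Subgroup.centralizer {x} := by
    intro x hx
    have := hmin ⟨Subgroup.centralizer (insert x T), _, rfl⟩ ⟨insert x T, hTF.insert x, by
      rintro y (rfl | hy)
      · exact hx
      · exact hT y hy, rfl⟩
    have h1 : Subgroup.centralizer (insert x T) ≤ Subgroup.centralizer T :=
      Subgroup.centralizer_le (Set.subset_insert _ _)
    have h2 : Subgroup.centralizer T ≤ Subgroup.centralizer (insert x T) := by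
      by_contra hn
      exact this (lt_of_le_not_ge h1 hn)
    exact h2.trans (Subgroup.centralizer_le (by simp))
  have hfi : (Subgroup.centralizer T).FiniteIndex := by
    have heq : Subgroup.centralizer T = ⨅ x ∈ hTF.toFinset, Subgroup.centralizer {x} := by
      ext g
      simp only [Subgroup.mem_iInf, Set.Finite.mem_toFinset, Subgroup.mem_centralizer_singleton_iff]
      rw [Subgroup.mem_centralizer_iff]
      exact ⟨fun h s hs => (h s hs).symm, fun h s hs => (h s hs).symm⟩
    rw [heq]
    exact Subgroup.finiteIndex_iInf' _ fun x hx => hT x (by simpa using hx)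
  rcases hC T with htop | hVA
  · refine Or.inr fun x hx => Subgroup.mem_center_iff.2 fun g => ?_
    have : g ∈ Subgroup.centralizer {x} := hle x hx (htop ▸ Subgroup.mem_top g)
    exact Subgroup.mem_centralizer_singleton_iff.1 this
  · exact Or.inl hVA.of_finiteIndex

/-- Reduction to groups without nontrivial elements of finite class in which the centralizers of
nontrivial elements are virtually abelian. -/
theorem isVirtuallyAbelian_of_centralizer
    (hB : ∀ (K : Type u) [Group K], IsLocFinSolMin K →
      (∀ x : K, (Subgroup.centralizer {x}).FiniteIndex → x = 1) →
      (∀ x : K, x ≠ 1 → IsVirtuallyAbelian (Subgroup.centralizer {x})) → Subsingleton K)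
    (h : IsLocFinSolMin G) (hdcc : CentralizerDCC G)
    (hC : ∀ T : Set G, Subgroup.centralizer T = ⊤ ∨ IsVirtuallyAbelian (Subgroup.centralizer T)) :
    IsVirtuallyAbelian G := by
  rcases isVirtuallyAbelian_or_mem_center hdcc hC with hVA | hFC
  · exact hVA
  -- C(x) has finite index in the preimage of the centralizer of xZ, so finite index of centralizers
  -- lifts to `G` and virtual commutativity descends to the quotient.
  have hsub : Subsingleton (G ⧸ Subgroup.center G) := by
    refine hB _ h.quotient_center (fun x hx => ?_) (fun x hx => ?_)
    · obtain ⟨x, rfl⟩ := QuotientGroup.mk_surjective x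
      refine (QuotientGroup.eq_one_iff x).2 (hFC x ⟨?_⟩)
      have h1 := (h.relIndex_centralizer_ne_zero x).index_ne_zero
      have hle : Subgroup.centralizer {x} ≤ (Subgroup.centralizer
          {(x : G ⧸ Subgroup.center G)}).comap (QuotientGroup.mk' _) := fun g hg => by
        have hg := Subgroup.mem_centralizer_singleton_iff.1 hg
        exact Subgroup.mem_centralizer_singleton_iff.2 (congrArg (QuotientGroup.mk' _) hg)
      rw [← Subgroup.relIndex_mul_index hle,
        Subgroup.index_comap_of_surjective _ (QuotientGroup.mk'_surjective _)]
      exact mul_ne_zero h1 hx.index_ne_zero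
    · obtain ⟨x, rfl⟩ := QuotientGroup.mk_surjective x
      have hVA : IsVirtuallyAbelian (Subgroup.centralizer {x}) := by
        refine (hC {x}).resolve_left fun htop => hx ?_
        refine (QuotientGroup.eq_one_iff x).2 (hFC x ?_)
        rw [htop]; infer_instance
      have hfi := h.relIndex_centralizer_ne_zero x
      have hE : IsVirtuallyAbelian ((Subgroup.centralizer
          {(x : G ⧸ Subgroup.center G)}).comap (QuotientGroup.mk' _)) := by
        refine IsVirtuallyAbelian.of_finiteIndex (hKi := hfi) ?_
        refine hVA.of_injective ((Subgroup.subtype _).comp (Subgroup.subtype _) |>.codRestrict _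
          fun g => g.2) fun a b hab => ?_
        have hab' : ((a : _) : G) = b := congrArg (fun z : Subgroup.centralizer {x} => (z : G)) hab
        exact Subtype.ext (Subtype.ext hab')
      exact hE.of_surjective (((QuotientGroup.mk' _).comp (Subgroup.subtype _)).codRestrict _
        fun g => g.2) fun ⟨z, hz⟩ => by
          obtain ⟨g, rfl⟩ := QuotientGroup.mk'_surjective _ z
          exact ⟨⟨g, hz⟩, rfl⟩
  have htop : Subgroup.center G = ⊤ := QuotientGroup.subgroup_eq_top_of_subsingleton _ hsub
  refine ⟨⊤, ?_, inferInstance⟩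
  rw [← htop]; infer_instance

/-- Well-founded induction over centralizers: a centralizer inside C(S) is the centralizer in G of a
larger set, so C(S) inherits the chain condition and its proper centralizers fall under the
induction hypothesis. -/
theorem isVirtuallyAbelian_of_centralizerDCC
    (hB : ∀ (K : Type u) [Group K], IsLocFinSolMin K →
      (∀ x : K, (Subgroup.centralizer {x}).FiniteIndex → x = 1) →
      (∀ x : K, x ≠ 1 → IsVirtuallyAbelian (Subgroup.centralizer {x})) → Subsingleton K)
    (h : IsLocFinSolMin G) (hdcc : CentralizerDCC G) : IsVirtuallyAbelian G := by
  have key : ∀ C : {C : Subgroup G // ∃ S : Set G, C = Subgroup.centralizer S},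
      IsVirtuallyAbelian (C : Subgroup G) := by
    intro C
    induction C using hdcc.wf.induction with
    | _ C ih =>
    obtain ⟨C, S, rfl⟩ := C
    have hmap : ∀ T : Set (Subgroup.centralizer S),
        (Subgroup.centralizer T).map (Subgroup.subtype _) =
          Subgroup.centralizer (S ∪ Subtype.val '' T) := by
      intro T
      ext g
      simp only [Subgroup.mem_map, Subgroup.mem_centralizer_iff, Set.mem_union]
      constructor
      · rintro ⟨g, hg, rfl⟩ s (hs | ⟨t, ht, rfl⟩)
        · exact g.2 s hs
        · exact congrArg Subtype.val (hg t ht)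
      · intro hg
        exact ⟨⟨g, fun s hs => hg s (Or.inl hs)⟩,
          fun t ht => Subtype.ext (hg t (Or.inr ⟨t, ht, rfl⟩)), rfl⟩
    have hmono : StrictMono (Subgroup.map (Subgroup.subtype (Subgroup.centralizer S))) :=
      (OrderEmbedding.ofMapLEIff (Subgroup.map (Subgroup.subtype (Subgroup.centralizer S)))
        fun _ _ => Subgroup.map_le_map_iff_of_injective (Subgroup.subtype_injective _)).strictMono
    refine isVirtuallyAbelian_of_centralizer hB (h.subgroup _) ?_ fun T => ?_
    · let f : {D : Subgroup (Subgroup.centralizer S) // ∃ T, D = Subgroup.centralizer T} →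
          {C : Subgroup G // ∃ S : Set G, C = Subgroup.centralizer S} :=
        fun D => ⟨(D : Subgroup _).map (Subgroup.centralizer S).subtype, by
          obtain ⟨T, hT⟩ := D.2
          exact ⟨_, hT ▸ hmap T⟩⟩
      have hf : StrictMono f := fun D E hDE => hmono hDE
      have : WellFoundedLT {C : Subgroup G // ∃ S : Set G, C = Subgroup.centralizer S} := hdcc
      exact hf.wellFoundedLT
    · by_cases heq : Subgroup.centralizer (S ∪ Subtype.val '' T) = Subgroup.centralizer S
      · left
        rw [← hmap] at heq
        refine Subgroup.map_injective (Subgroup.subtype_injective _) ?_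
        rw [heq, ← MonoidHom.range_eq_map, Subgroup.range_subtype]
      · right
        have hlt : Subgroup.centralizer (S ∪ Subtype.val '' T) < Subgroup.centralizer S :=
          lt_of_le_of_ne (Subgroup.centralizer_le Set.subset_union_left) heq
        have := ih ⟨_, _, rfl⟩ hlt
        have this : IsVirtuallyAbelian (Subgroup.centralizer (S ∪ Subtype.val '' T)) := this
        rw [← hmap] at this
        exact this.of_injective ((Subgroup.subtype _).subgroupMap _)
          (Subgroup.equivMapOfInjective _ _ (Subgroup.subtype_injective _)).injective
  exact (key ⟨Subgroup.centralizer ∅, ∅, rfl⟩).of_injective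
    ((MonoidHom.id G).codRestrict _ fun x => Subgroup.mem_centralizer_iff.2 (by simp))
    fun a b hab => congrArg Subtype.val hab

end Reduction

/-! ### Derived series: finite witnesses and length bounds -/

section DerivedSeries

variable {G : Type*} [Group G]

/-- The derived series of a subgroup, as a sequence of subgroups of the ambient group. -/
def derivedIn (K : Subgroup G) : ℕ → Subgroup G
  | 0 => K
  | n + 1 => ⁅derivedIn K n, derivedIn K n⁆

theorem derivedIn_mono {K L : Subgroup G} (h : K ≤ L) (n : ℕ) : derivedIn K n ≤ derivedIn L n := by
  induction n with
  | zero => exact h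
  | succ n ih => exact Subgroup.commutator_mono ih ih

theorem derivedIn_top (n : ℕ) : derivedIn (⊤ : Subgroup G) n = derivedSeries G n := by
  induction n with
  | zero => rfl
  | succ n ih => rw [derivedSeries_succ, ← ih]; rfl

theorem map_derivedIn {H : Type*} [Group H] (f : G →* H) (K : Subgroup G) (n : ℕ) :
    (derivedIn K n).map f = derivedIn (K.map f) n := by
  induction n with
  | zero => rfl
  | succ n ih =>
    change (⁅derivedIn K n, derivedIn K n⁆).map f = ⁅derivedIn (K.map f) n, derivedIn (K.map f) n⁆
    rw [Subgroup.map_commutator, ih]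

theorem derivedIn_eq_map (K : Subgroup G) (n : ℕ) :
    derivedIn K n = (derivedSeries K n).map K.subtype := by
  rw [← derivedIn_top, map_derivedIn, ← MonoidHom.range_eq_map, Subgroup.range_subtype]

theorem derivedIn_add (K : Subgroup G) (m n : ℕ) :
    derivedIn K (m + n) = derivedIn (derivedIn K m) n := by
  induction n with
  | zero => rfl
  | succ n ih =>
    change ⁅derivedIn K (m + n), derivedIn K (m + n)⁆ = _
    rw [ih]; rfl

/-- Membership in a derived term involves finitely many elements; this carries results on finite
soluble groups over to locally finite ones. -/
theorem exists_finite_mem_derivedIn {n : ℕ} {y : G} (hy : y ∈ derivedSeries G n) :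
    ∃ s : Set G, s.Finite ∧ y ∈ derivedIn (Subgroup.closure s) n := by
  induction n generalizing y with
  | zero => exact ⟨{y}, Set.finite_singleton y, Subgroup.subset_closure rfl⟩
  | succ n ih =>
    have hmono : ∀ {s t : Set G}, s ⊆ t → ∀ k,
        derivedIn (Subgroup.closure s) k ≤ derivedIn (Subgroup.closure t) k :=
      fun hst k => derivedIn_mono (Subgroup.closure_mono hst) k
    rw [derivedSeries_succ, Subgroup.commutator_def] at hy
    induction hy using Subgroup.closure_induction with
    | mem x hx =>
      obtain ⟨a, ha, b, hb, rfl⟩ := hx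
      obtain ⟨s, hs, has⟩ := ih ha
      obtain ⟨t, ht, hbt⟩ := ih hb
      exact ⟨s ∪ t, hs.union ht, Subgroup.commutator_mem_commutator
        (hmono Set.subset_union_left n has) (hmono Set.subset_union_right n hbt)⟩
    | one => exact ⟨∅, Set.finite_empty, one_mem _⟩
    | mul a b _ _ iha ihb =>
      obtain ⟨s, hs, has⟩ := iha
      obtain ⟨t, ht, hbt⟩ := ihb
      exact ⟨s ∪ t, hs.union ht, mul_mem (hmono Set.subset_union_left _ has)
        (hmono Set.subset_union_right _ hbt)⟩
    | inv a _ iha =>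
      obtain ⟨s, hs, has⟩ := iha
      exact ⟨s, hs, inv_mem has⟩

theorem card_add_le_of_derivedSeries_ne_bot [Finite G] [Group.IsSolvable G] (n : ℕ)
    (hn : derivedSeries G n ≠ ⊥) : Nat.card (derivedSeries G n) + n ≤ Nat.card G := by
  induction n with
  | zero => simp
  | succ n ih =>
    have hn' : derivedSeries G n ≠ ⊥ := fun h => hn (by
      rw [derivedSeries_succ, h, Subgroup.commutator_bot_left])
    have hlt : derivedSeries G (n + 1) < derivedSeries G n :=
      Group.IsSolvable.commutator_lt_of_ne_bot hn'
    have hcard : Nat.card (derivedSeries G (n + 1)) < Nat.card (derivedSeries G n) := by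
      by_contra h
      exact hlt.ne (Subgroup.eq_of_le_of_card_ge hlt.le (not_lt.1 h))
    have := ih hn'
    omega

theorem derivedSeries_eq_bot_of_card_le [Finite G] [Group.IsSolvable G] {n : ℕ}
    (hn : Nat.card G ≤ n) : derivedSeries G n = ⊥ := by
  by_contra h
  have h1 := card_add_le_of_derivedSeries_ne_bot n h
  have h2 : 0 < Nat.card (derivedSeries G n) := Nat.card_pos
  omega

theorem derivedSeries_le_ker [Group.IsSolvable G] {Q : Type*} [Group Q] [Finite Q] (f : G →* Q)
    {n : ℕ} (hn : Nat.card Q ≤ n) : derivedSeries G n ≤ f.ker := by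
  have hs : Group.IsSolvable f.range :=
    Group.isSolvable_of_surjective f.rangeRestrict_surjective
  have h1 : derivedSeries f.range n = ⊥ :=
    derivedSeries_eq_bot_of_card_le ((Subgroup.card_le_card_group _).trans hn)
  have h2 := map_derivedSeries_le_derivedSeries f.rangeRestrict n
  rw [h1, le_bot_iff, Subgroup.map_eq_bot_iff, MonoidHom.ker_rangeRestrict] at h2
  exact h2

end DerivedSeries

/-! ### Groups with a bounded abelian subgroup -/

section Good

/-- There is an abelian subgroup of index at most `m` with at most `m` elements `x` such that
`x ^ p = 1`. -/
def HasBoundedAbelian (p m : ℕ) (P : Type*) [Group P] : Prop :=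
  ∃ A : Subgroup P, IsMulCommutative A ∧ A.index ≠ 0 ∧ A.index ≤ m ∧
    {x | x ∈ A ∧ x ^ p = 1}.encard ≤ m

variable {p m : ℕ} {P Q : Type*} [Group P] [Group Q]

theorem HasBoundedAbelian.of_injective (h : HasBoundedAbelian p m Q) (f : P →* Q)
    (hf : Function.Injective f) : HasBoundedAbelian p m P := by
  obtain ⟨A, hA, hA0, hAm, hAp⟩ := h
  have hfi : A.FiniteIndex := ⟨hA0⟩
  refine ⟨A.comap f, Subgroup.comap_injective_isMulCommutative A hf, ?_, ?_, ?_⟩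
  · rw [Subgroup.index_comap]
    exact (inferInstance : (A.subgroupOf f.range).FiniteIndex).index_ne_zero
  · rw [Subgroup.index_comap]
    have := Subgroup.relIndex_le_of_le_right (H := A) (K := f.range) (L := ⊤) le_top
      (by rw [Subgroup.relIndex_top_right]; exact hA0)
    rw [Subgroup.relIndex_top_right] at this
    exact this.trans hAm
  · refine le_trans ?_ hAp
    refine Set.encard_le_encard_of_injOn (f := f) ?_ hf.injOn
    rintro x ⟨hx, hxp⟩
    exact ⟨hx, by rw [← map_pow, hxp, map_one]⟩

/-- The action on at most m cosets of A has image of order at most m!, which bounds the derived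
length modulo the core of A. -/
theorem HasBoundedAbelian.derivedSeries_eq_bot [Finite P] [Group.IsSolvable P]
    (h : HasBoundedAbelian p m P) : derivedSeries P (m.factorial + 1) = ⊥ := by
  obtain ⟨A, hA, hA0, hAm, -⟩ := h
  have h1 : derivedSeries P m.factorial ≤ A := by
    refine le_trans ?_ A.normalCore_le
    rw [Subgroup.normalCore_eq_ker]
    refine derivedSeries_le_ker _ ?_
    rw [Nat.card_perm]
    exact Nat.factorial_le hAm
  rw [derivedSeries_succ, eq_bot_iff]
  refine (Subgroup.commutator_mono h1 h1).trans ?_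
  rw [Subgroup.commutator_self_eq_bot_iff.2 hA]

theorem pow_mem_of_isCoatom [Finite P] [hp : Fact p.Prime] (hP : IsPGroup p P) {K : Subgroup P}
    (hK : IsCoatom K) (x : P) : x ^ p ∈ K := by
  have hnil : Group.IsNilpotent P := hP.isNilpotent
  have hKn : K.Normal := (Group.isNilpotent_of_finite_tfae.out 0 2 rfl rfl).1 hnil K hK
  by_contra hx
  have hPK : IsPGroup p (P ⧸ K) := hP.to_quotient K
  set y : P ⧸ K := QuotientGroup.mk' K x with hy
  have hy1 : y ^ p ≠ 1 := fun h => hx ((QuotientGroup.eq_one_iff _).1 h)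
  have htop : Subgroup.comap (QuotientGroup.mk' K) (Subgroup.zpowers (y ^ p)) = ⊤ := by
    refine hK.2 _ (lt_of_le_of_ne ?_ ?_)
    · intro k hk
      rw [Subgroup.mem_comap, QuotientGroup.mk'_apply, (QuotientGroup.eq_one_iff k).2 hk]
      exact one_mem _
    · intro h
      exact hx (h ▸ (Subgroup.mem_zpowers (y ^ p) : _ ∈ Subgroup.zpowers (y ^ p)))
  have hmem : y ∈ Subgroup.zpowers (y ^ p) := by
    have : x ∈ Subgroup.comap (QuotientGroup.mk' K) (Subgroup.zpowers (y ^ p)) :=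
      htop ▸ Subgroup.mem_top x
    exact this
  have hle := Subgroup.zpowers_le.2 hmem
  have hcard := Subgroup.card_le_of_le hle
  rw [Nat.card_zpowers, Nat.card_zpowers, orderOf_pow' y hp.out.ne_zero] at hcard
  have hy' : y ≠ 1 := fun h => hy1 (by rw [h, one_pow])
  rw [Nat.gcd_eq_right (hPK.dvd_orderOf hy')] at hcard
  exact absurd hcard (not_le.2 (Nat.div_lt_self (orderOf_pos y) hp.out.one_lt))

/-- The p-th powers of A lie in every maximal subgroup, and their index in A equals the number of
elements of A killed by p. -/
theorem HasBoundedAbelian.index_frattini_le [Finite P] [Fact p.Prime] (hP : IsPGroup p P)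
    (h : HasBoundedAbelian p m P) : (frattini P).index ≤ m * m := by
  obtain ⟨A, hA, hA0, hAm, hAp⟩ := h
  let _ : CommGroup A := { (inferInstance : Group A) with mul_comm := mul_comm' }
  have hr : ((powMonoidHom p : A →* A).range).map A.subtype ≤ frattini P := by
    rintro _ ⟨_, ⟨a, rfl⟩, rfl⟩
    refine (Subgroup.mem_iInf.2 fun K => Subgroup.mem_iInf.2 fun hK => ?_ :
      _ ∈ ⨅ K : Subgroup P, ⨅ _ : IsCoatom K, K)
    exact pow_mem_of_isCoatom hP hK (a : P)
  have hker : Nat.card (powMonoidHom p : A →* A).ker ≤ m := by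
    have h1 : Nat.card (powMonoidHom p : A →* A).ker = {x | x ∈ A ∧ x ^ p = 1}.ncard := by
      rw [← Nat.card_coe_set_eq]
      refine Nat.card_congr ⟨fun a => ⟨a, (a : A).2, congrArg Subtype.val a.2⟩,
        fun x => ⟨⟨x, x.2.1⟩, Subtype.ext x.2.2⟩, fun a => rfl, fun x => rfl⟩
    rw [h1]
    rwa [← Set.Finite.cast_ncard_eq (Set.toFinite _), Nat.cast_le] at hAp
  have hidx : ((powMonoidHom p : A →* A).range).index ≤ m := by
    have h1 := ((powMonoidHom p : A →* A).range).card_mul_index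
    have h2 := ((powMonoidHom p : A →* A).ker).card_mul_index
    rw [Subgroup.index_ker, mul_comm] at h2
    have h3 := Nat.eq_of_mul_eq_mul_left Nat.card_pos (h1.trans h2.symm)
    rwa [h3]
  calc (frattini P).index ≤ (((powMonoidHom p : A →* A).range).map A.subtype).index :=
        Subgroup.index_antitone hr
    _ = ((powMonoidHom p : A →* A).range).index * A.index := Subgroup.index_map_subtype _
    _ ≤ m * m := Nat.mul_le_mul hidx hAm

end Good

/-! ### Bounding the derived series modulo p'-elements -/

section PLength

variable {p m : ℕ} [hp : Fact p.Prime] {H : Type*} [Group H]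

theorem derivedIn_normal (K : Subgroup H) [hK : K.Normal] (n : ℕ) : (derivedIn K n).Normal := by
  induction n with
  | zero => exact hK
  | succ n ih => exact Subgroup.commutator_normal _ _

theorem isPGroup_of_forall_prime_orderOf [Finite H]
    (h : ∀ q : ℕ, q.Prime → ∀ x : H, orderOf x = q → q = p) : IsPGroup p H := by
  refine (isPGroup_iff_primeFactors_card_subset hp.out.ne_zero).2 fun q hq => ?_
  have hq' := Nat.prime_of_mem_primeFactors hq
  have : Fact q.Prime := ⟨hq'⟩
  obtain ⟨x, hx⟩ := exists_prime_orderOf_dvd_card' q (Nat.dvd_of_mem_primeFactors hq)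
  rw [h q hq' x hx, hp.out.primeFactors]
  exact Finset.mem_singleton_self p

variable [Finite H]

theorem isPGroup_of_isNilpotent
    (hO : ∀ N : Subgroup H, N.Normal → ¬ p ∣ Nat.card N → N = ⊥) (B : Subgroup H)
    (hB : B.Normal) [Group.IsNilpotent B] : IsPGroup p B := by
  refine isPGroup_of_forall_prime_orderOf fun q hq x hx => ?_
  by_contra hne
  have hqf : Fact q.Prime := ⟨hq⟩
  obtain ⟨Q, hQ⟩ := (isPGroup_zpowers_of_pow_eq_one (p := q) (g := x) (n := 1)
    (by rw [pow_one, ← hx, pow_orderOf_eq_one])).exists_le_sylow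
  have hQc : (Q : Subgroup B).Characteristic := Q.characteristic_of_normal inferInstance
  have hbot := hO ((Q : Subgroup B).map B.subtype) inferInstance (by
    obtain ⟨k, hk⟩ := IsPGroup.iff_card.1 Q.isPGroup'
    rw [Subgroup.card_map_of_injective B.subtype_injective, hk]
    exact fun hd => hne ((Nat.prime_dvd_prime_iff_eq Fact.out hq).1
      (Nat.Prime.dvd_of_dvd_pow Fact.out hd)).symm)
  rw [Subgroup.map_eq_bot_iff_of_injective _ B.subtype_injective] at hbot
  have hx1 : x ∈ (⊥ : Subgroup B) := hbot ▸ hQ (Subgroup.mem_zpowers x)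
  rw [Subgroup.mem_bot.1 hx1, orderOf_one] at hx
  exact hq.ne_one hx.symm

theorem exists_isPGroup_normal (p : ℕ) [Fact p.Prime] (H : Type*) [Group H] [Finite H] :
    ∃ V : Subgroup H, V.Normal ∧ IsPGroup p V ∧
      ∀ N : Subgroup H, N.Normal → IsPGroup p N → N ≤ V := by
  obtain ⟨P⟩ : Nonempty (Sylow p H) := inferInstance
  refine ⟨(P : Subgroup H).normalCore, inferInstance,
    P.isPGroup'.to_le (Subgroup.normalCore_le _), fun N hN hNp => ?_⟩
  exact Subgroup.normal_le_normalCore.2 (hNp.le_sylow_of_normal P)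

/-- Otherwise let B be the last derived term of C = C(V) not inside V. Then B' ≤ V is central in B,
so B is nilpotent and normal, hence a p-group by the triviality of normal p'-subgroups, hence inside
V. -/
theorem centralizer_le_of_normal [Group.IsSolvable H]
    (hO : ∀ N : Subgroup H, N.Normal → ¬ p ∣ Nat.card N → N = ⊥) {V : Subgroup H}
    (hVn : V.Normal) (hV : ∀ N : Subgroup H, N.Normal → IsPGroup p N → N ≤ V) :
    Subgroup.centralizer (V : Set H) ≤ V := by
  classical
  by_contra hC
  set C := Subgroup.centralizer (V : Set H) with hCdef
  have hCn : C.Normal := inferInstance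
  have hex : ∃ k, derivedIn C k ≤ V := by
    obtain ⟨k, hk⟩ := (inferInstance : Group.IsSolvable H).solvable
    exact ⟨k, (derivedIn_mono le_top k).trans (by rw [derivedIn_top, hk]; exact bot_le)⟩
  obtain ⟨j, hj⟩ : ∃ j, Nat.find hex = j + 1 := by
    refine Nat.exists_eq_succ_of_ne_zero fun h0 => hC ?_
    have := Nat.find_spec hex
    rwa [h0] at this
  have hle : derivedIn C (j + 1) ≤ V := hj ▸ Nat.find_spec hex
  have hnle : ¬ derivedIn C j ≤ V := Nat.find_min hex (by omega)
  set B := derivedIn C j with hB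
  have hBn : B.Normal := derivedIn_normal C j
  have hBC : B ≤ C := by
    rw [hB]
    clear_value C
    clear hle hnle hB hBn hj hex hC hCdef
    induction j with
    | zero => exact le_rfl
    | succ j ih => exact (have := derivedIn_normal C j; Subgroup.commutator_le_left _ _).trans ih
  have hnil : Group.IsNilpotent B := by
    refine Subgroup.isNilpotent_of_ker_le_center (Abelianization.of (G := B)) ?_
    rw [Abelianization.ker_of]
    intro x hx
    have hxV : (x : H) ∈ V := by
      refine hle ?_
      have := Subgroup.mem_map_of_mem B.subtype hx
      rw [commutator_def, Subgroup.map_commutator, ← MonoidHom.range_eq_map,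
        Subgroup.range_subtype] at this
      exact this
    exact Subgroup.mem_center_iff.2 fun y => Subtype.ext
      ((Subgroup.mem_centralizer_iff.1 (hBC y.2) _ hxV).symm)
  exact hnle (hV B hBn (isPGroup_of_isNilpotent hO B hBn))

/-- By coprimality every coset of the Frattini subgroup contains a fixed point of g; so V is
generated by fixed points and Frattini elements, and the latter are superfluous. -/
theorem conj_eq_of_conj_mem_frattini {V : Subgroup H} [hVn : V.Normal] (hVp : IsPGroup p V)
    {q : ℕ} [hq : Fact q.Prime] (hqp : q ≠ p) {g : H} (hg : g ^ q = 1)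
    (hgV : ∀ v : V, v⁻¹ * MulAut.conjNormal g v ∈ frattini V) :
    g ∈ Subgroup.centralizer (V : Set H) := by
  set α : MulAut V := MulAut.conjNormal g with hα
  let T : Subgroup V :=
    { carrier := {v | α v = v}
      one_mem' := map_one α
      mul_mem' := fun {a b} ha hb => by
        change α (a * b) = a * b
        rw [map_mul, ha, hb]
      inv_mem' := fun {a} ha => by
        change α a⁻¹ = a⁻¹
        rw [map_inv, ha] }
  have hT : T = ⊤ := by
    refine frattini_nongenerating (eq_top_iff.2 fun v _ => ?_)
    obtain ⟨n, hn, hfix⟩ := exists_fixed_mul_of_pow_eq_one (p := q) (n := 1) (α := α)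
      (by rw [pow_one, hα, ← map_pow, hg, map_one]) (frattini V) (fun n hn => by
        have := (Subgroup.characteristic_iff_map_le.1 (frattini_characteristic (G := V))) α
        exact this (Subgroup.mem_map_of_mem _ hn)) (by
        obtain ⟨k, hk⟩ := IsPGroup.iff_card.1 (hVp.to_subgroup (frattini V))
        rw [hk]
        exact fun hd => hqp ((Nat.prime_dvd_prime_iff_eq hq.out hp.out).1
          (hq.out.dvd_of_dvd_pow hd))) v (hgV v)
    have : v = (v * n) * n⁻¹ := by group
    rw [this]
    exact mul_mem (Subgroup.mem_sup_left hfix) (Subgroup.mem_sup_right (inv_mem hn))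
  refine Subgroup.mem_centralizer_iff.2 fun v hv => ?_
  have h1 : α ⟨v, hv⟩ = ⟨v, hv⟩ := (hT ▸ Subgroup.mem_top _ : (⟨v, hv⟩ : V) ∈ T)
  have h2 : g * v * g⁻¹ = v := congrArg Subtype.val h1
  exact (mul_inv_eq_iff_eq_mul.1 h2).symm

/-- With V the largest normal p-subgroup, the kernel of the action on V/Φ(V) is a p-group, because
its p'-elements of prime order would centralize V and so lie in V. Hence the kernel lies in V. The
order of V/Φ(V) is at most m², so the quotient by the kernel has order at most (m²)!; the derived
length of V is at most m! + 1. -/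
theorem derivedSeries_eq_bot_of_hasBoundedAbelian [Group.IsSolvable H]
    (hO : ∀ N : Subgroup H, N.Normal → ¬ p ∣ Nat.card N → N = ⊥)
    (hP : ∀ P : Subgroup H, IsPGroup p P → HasBoundedAbelian p m P) :
    derivedSeries H ((m * m).factorial + (m.factorial + 1)) = ⊥ := by
  obtain ⟨V, hVn, hVp, hV⟩ := exists_isPGroup_normal p H
  have hCV := centralizer_le_of_normal hO hVn hV
  have hFn : ((frattini V).map V.subtype).Normal := inferInstance
  set F := (frattini V).map V.subtype with hF
  set π := QuotientGroup.mk' F with hπ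
  have hWn : (V.map π).Normal := hVn.map π (QuotientGroup.mk'_surjective F)
  let f : H →* MulAut (V.map π) := (MulAut.conjNormal (H := V.map π)).comp π
  have hcardW : Nat.card (V.map π) ≤ m * m := by
    refine le_trans (le_of_eq ?_) ((hP V hVp).index_frattini_le hVp)
    have h1 := Subgroup.index_ker (π.comp V.subtype)
    rw [MonoidHom.range_comp, Subgroup.range_subtype] at h1
    rw [← h1]
    congr 1
    ext v
    rw [MonoidHom.mem_ker, MonoidHom.comp_apply, hπ, QuotientGroup.mk'_apply,
      QuotientGroup.eq_one_iff, hF]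
    exact Subgroup.mem_map_iff_mem V.subtype_injective
  have hcard : Nat.card (MulAut (V.map π)) ≤ (m * m).factorial := by
    refine le_trans ?_ (Nat.factorial_le hcardW)
    rw [← Nat.card_perm]
    exact Nat.card_le_card_of_injective (fun e : MulAut (V.map π) => (e.toEquiv : Equiv.Perm _))
      MulEquiv.toEquiv_injective
  have hker : ∀ g ∈ f.ker, ∀ v : V, v⁻¹ * MulAut.conjNormal g v ∈ frattini V := by
    intro g hg v
    have h1 : MulAut.conjNormal (π g) (⟨π v, Subgroup.mem_map_of_mem π v.2⟩ : V.map π) =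
        ⟨π v, Subgroup.mem_map_of_mem π v.2⟩ := by
      have := congrArg (fun e : MulAut (V.map π) => e ⟨π v, Subgroup.mem_map_of_mem π v.2⟩)
        (MonoidHom.mem_ker.1 hg)
      exact this
    have h2 : π g * π v * (π g)⁻¹ = π v := congrArg Subtype.val h1
    have h3 : (v : H)⁻¹ * (g * v * g⁻¹) ∈ F := by
      refine (QuotientGroup.eq_one_iff _).1 ?_
      change π ((v : H)⁻¹ * (g * v * g⁻¹)) = 1
      rw [map_mul, map_mul, map_mul, map_inv, map_inv, h2, inv_mul_cancel]
    exact (Subgroup.mem_map_iff_mem V.subtype_injective).1 h3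
  have hKp : IsPGroup p f.ker := by
    refine isPGroup_of_forall_prime_orderOf fun q hq x hx => ?_
    by_contra hne
    have : Fact q.Prime := ⟨hq⟩
    have hxq : (x : H) ^ q = 1 := by
      rw [← hx, ← Subgroup.orderOf_coe, pow_orderOf_eq_one]
    have hxV := hCV (conj_eq_of_conj_mem_frattini hVp hne hxq (hker x x.2))
    obtain ⟨k, hk⟩ := IsPGroup.iff_orderOf.1 hVp ⟨x, hxV⟩
    rw [← Subgroup.orderOf_coe, Subgroup.orderOf_coe x, hx] at hk
    exact hne ((Nat.prime_dvd_prime_iff_eq hq hp.out).1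
      (hq.dvd_of_dvd_pow (dvd_of_eq hk)))
  have hKV : f.ker ≤ V := hV _ inferInstance hKp
  have h1 : derivedIn (⊤ : Subgroup H) (m * m).factorial ≤ V := by
    rw [derivedIn_top]
    exact (derivedSeries_le_ker f hcard).trans hKV
  rw [← derivedIn_top, derivedIn_add, eq_bot_iff]
  refine (derivedIn_mono h1 _).trans ?_
  rw [derivedIn_eq_map, (hP V hVp).derivedSeries_eq_bot, Subgroup.map_bot]

/-- In a finite soluble group whose `p`-subgroups have bounded abelian subgroups, a term of the
derived series with bounded number has order prime to `p`. -/
theorem not_dvd_orderOf_of_mem_derivedSeries :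
    ∀ (n : ℕ) (H : Type u) [Group H] [Finite H] [Group.IsSolvable H], Nat.card H ≤ n →
      (∀ P : Subgroup H, IsPGroup p P → HasBoundedAbelian p m P) →
      ∀ y ∈ derivedSeries H ((m * m).factorial + (m.factorial + 1)), ¬ p ∣ orderOf y := by
  intro n
  induction n with
  | zero => intro H _ _ _ h; exact absurd Nat.card_pos (not_lt.2 h)
  | succ n ih =>
    intro H _ _ _ hn hP y hy
    by_cases hO : ∀ N : Subgroup H, N.Normal → ¬ p ∣ Nat.card N → N = ⊥
    · rw [derivedSeries_eq_bot_of_hasBoundedAbelian hO hP] at hy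
      rw [Subgroup.mem_bot.1 hy, orderOf_one, Nat.dvd_one]
      exact hp.out.ne_one
    push Not at hO
    obtain ⟨N, hN, hpN, hne⟩ := hO
    have hlt : Nat.card (H ⧸ N) ≤ n := by
      have h1 := Subgroup.card_eq_card_quotient_mul_card_subgroup N
      have h2 : 1 < Nat.card N := by
        rw [Subgroup.one_lt_card_iff_ne_bot]; exact hne
      have h3 : 0 < Nat.card (H ⧸ N) := Nat.card_pos
      nlinarith
    have hsurj : Function.Surjective (QuotientGroup.mk' N) := QuotientGroup.mk'_surjective N
    -- Since `p` does not divide |N|, Sylow `p`-subgroups of `H` map isomorphically to those of the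
    -- quotient.
    have hPN : ∀ P : Subgroup (H ⧸ N), IsPGroup p P → HasBoundedAbelian p m P := by
      intro P hPp
      obtain ⟨Q, hPQ⟩ := hPp.exists_le_sylow
      obtain ⟨R, rfl⟩ := Sylow.mapSurjective_surjective hsurj p Q
      have hbij : Function.Bijective ((QuotientGroup.mk' N).subgroupMap (R : Subgroup H)) := by
        refine ⟨(injective_iff_map_eq_one _).2 fun x hx => ?_, MonoidHom.subgroupMap_surjective _ _⟩
        have hxN : (x : H) ∈ N := (QuotientGroup.eq_one_iff _).1 (congrArg Subtype.val hx)
        by_contra hx1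
        have h1 := R.isPGroup'.dvd_orderOf hx1
        rw [← Subgroup.orderOf_coe] at h1
        exact hpN (h1.trans (Subgroup.orderOf_dvd_natCard N hxN))
      have hQ : HasBoundedAbelian p m ((R : Subgroup H).map (QuotientGroup.mk' N)) :=
        (hP R R.isPGroup').of_injective (MulEquiv.ofBijective _ hbij).symm.toMonoidHom
          (MulEquiv.ofBijective _ hbij).symm.injective
      exact hQ.of_injective (Subgroup.inclusion hPQ) (Subgroup.inclusion_injective hPQ)
    have hs : Group.IsSolvable (H ⧸ N) := Group.isSolvable_of_surjective hsurj
    have h1 := ih (H ⧸ N) hlt hPN (QuotientGroup.mk' N y)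
      (map_derivedSeries_le_derivedSeries _ _ (Subgroup.mem_map_of_mem _ hy))
    intro hd
    have h2 : y ^ orderOf (QuotientGroup.mk' N y) ∈ N := by
      refine (QuotientGroup.eq_one_iff _).1 ?_
      change QuotientGroup.mk' N (y ^ _) = 1
      rw [map_pow, pow_orderOf_eq_one]
    have h3 : y ^ (orderOf (QuotientGroup.mk' N y) * Nat.card N) = 1 := by
      rw [pow_mul]
      exact orderOf_dvd_iff_pow_eq_one.1 (Subgroup.orderOf_dvd_natCard N h2)
    rcases (Nat.Prime.dvd_mul hp.out).1 (hd.trans (orderOf_dvd_of_pow_eq_one h3)) with h | h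
    · exact h1 h
    · exact hpN h

end PLength

/-- Groups without nontrivial elements having finitely many conjugates and in which the centralizers
of nontrivial elements are virtually abelian. -/
structure HasSmallCentralizers (G : Type*) [Group G] : Prop extends IsLocFinSolMin G where
  eq_one_of_finiteIndex : ∀ x : G, (Subgroup.centralizer {x}).FiniteIndex → x = 1
  isVirtuallyAbelian_centralizer : ∀ x : G, x ≠ 1 → IsVirtuallyAbelian (Subgroup.centralizer {x})

/-! ### Structure of groups with small centralizers -/

section FiniteClass

variable {G : Type*} [Group G]

theorem finiteIndex_centralizer_of_finite {x : G} {S : Set G} (hS : S.Finite)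
    (hxS : ∀ g, g * x * g⁻¹ ∈ S) : (Subgroup.centralizer {x}).FiniteIndex := by
  have := hS.to_subtype
  have : Finite (G ⧸ Subgroup.centralizer {x}) := by
    refine Finite.of_injective (fun q => (⟨_, hxS q.out⟩ : S)) fun q r hqr => ?_
    have h1 : q.out * x * q.out⁻¹ = r.out * x * r.out⁻¹ := congrArg Subtype.val hqr
    have h2 : q.out⁻¹ * r.out ∈ Subgroup.centralizer {x} := by
      refine Subgroup.mem_centralizer_singleton_iff.2 ?_
      have h3 : q.out⁻¹ * (q.out * x * q.out⁻¹) * r.out =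
        q.out⁻¹ * (r.out * x * r.out⁻¹) * r.out := by rw [h1]
      simpa [mul_assoc] using h3.symm
    have := QuotientGroup.eq.2 h2
    rwa [QuotientGroup.out_eq', QuotientGroup.out_eq'] at this
  exact Subgroup.finiteIndex_of_finite_quotient

end FiniteClass

namespace HasSmallCentralizers

variable {G : Type u} [Group G] (h : HasSmallCentralizers G)

include h

theorem eq_bot_of_isMulCommutative (N : Subgroup G) [hNn : N.Normal] (hN : IsMulCommutative N) :
    N = ⊥ := by
  refine (Subgroup.eq_bot_iff_forall _).2 fun x hx => h.eq_one_of_finiteIndex x ?_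
  refine finiteIndex_centralizer_of_finite
    (h.finite_torsion N hN (h.isOfFinOrder x).orderOf_pos.ne') fun g => ⟨hNn.conj_mem x hx g, ?_⟩
  rw [conj_pow, pow_orderOf_eq_one, mul_one, mul_inv_cancel]

theorem eq_bot_of_isSolvable (N : Subgroup G) [N.Normal] [Group.IsSolvable N] : N = ⊥ := by
  by_contra hne
  have : Nontrivial N := (Subgroup.nontrivial_iff_ne_bot N).2 hne
  obtain ⟨D, hDc, hD, hDD⟩ := exists_characteristic_commutator_eq_bot N
  have hDcomm : IsMulCommutative D := Subgroup.commutator_self_eq_bot_iff.1 hDD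
  have := h.eq_bot_of_isMulCommutative (D.map N.subtype) inferInstance
  exact hD ((Subgroup.map_eq_bot_iff_of_injective _ N.subtype_injective).1 this)

theorem isSolvable_centralizer {x : G} (hx : x ≠ 1) :
    Group.IsSolvable (Subgroup.centralizer {x}) :=
  (h.isVirtuallyAbelian_centralizer x hx).isSolvable (h.subgroup _).isSolvable_closure

/-- A nontrivial y centralizing M would place M in the soluble group C(y). -/
theorem centralizer_eq_bot {M : Subgroup G} [M.Normal] (hM : M ≠ ⊥) :
    Subgroup.centralizer (M : Set G) = ⊥ := by
  refine (Subgroup.eq_bot_iff_forall _).2 fun y hy => ?_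
  by_contra hy1
  have hs := h.isSolvable_centralizer hy1
  have hle : M ≤ Subgroup.centralizer {y} := fun m hm =>
    Subgroup.mem_centralizer_singleton_iff.2 (Subgroup.mem_centralizer_iff.1 hy m hm)
  have : Group.IsSolvable M := Group.isSolvable_of_isSolvable_injective
    (f := Subgroup.inclusion hle) (Subgroup.inclusion_injective hle)
  exact hM (h.eq_bot_of_isSolvable M)

theorem derivedSeries_ne_bot [Nontrivial G] (n : ℕ) : derivedSeries G n ≠ ⊥ := by
  intro hn
  have hs : Group.IsSolvable G := ⟨n, hn⟩
  have : Group.IsSolvable (⊤ : Subgroup G) := inferInstance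
  exact top_ne_bot (h.eq_bot_of_isSolvable ⊤)

/-- Take m to be the index of the core of an abelian subgroup of finite index in C(x): elements of
order prime to m fall into that core. -/
theorem exists_commute_of_coprime {x : G} (hx : x ≠ 1) : ∃ m ≠ 0, ∀ u v : G,
    (orderOf u).Coprime m → (orderOf v).Coprime m → Commute x u → Commute x v → Commute u v := by
  obtain ⟨A, hA, hAi⟩ := h.isVirtuallyAbelian_centralizer x hx
  refine ⟨A.normalCore.index, (inferInstance : A.normalCore.FiniteIndex).index_ne_zero, ?_⟩
  have key : ∀ u : Subgroup.centralizer {x}, (orderOf (u : G)).Coprime A.normalCore.index →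
      u ∈ A := by
    intro u hu
    refine A.normalCore_le (mem_of_pow_mem_of_coprime hu ?_ (A.normalCore.pow_index_mem u))
    rw [Subgroup.orderOf_coe, pow_orderOf_eq_one]
    exact one_mem _
  intro u v hu hv hxu hxv
  have hu' := key ⟨u, Subgroup.mem_centralizer_singleton_iff.2 hxu.symm.eq⟩ hu
  have hv' := key ⟨v, Subgroup.mem_centralizer_singleton_iff.2 hxv.symm.eq⟩ hv
  exact congrArg Subtype.val (setLike_mul_comm hu' hv')

/-- Choose a finite F with minimal centralizer in P. The centre of the finite p-group generated by F
and one nontrivial element supplies z ≠ 1 in C(F), and by minimality C(F) centralizes P. -/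
theorem exists_mem_forall_commute {p : ℕ} [Fact p.Prime] {P : Subgroup G} (hP : IsPGroup p P)
    (hne : P ≠ ⊥) : ∃ z ∈ P, z ≠ 1 ∧ ∀ x ∈ P, Commute z x := by
  have hwf := h.wellFoundedLT p Fact.out P hP
  have hnt : Nontrivial P := (Subgroup.nontrivial_iff_ne_bot P).2 hne
  obtain ⟨x0, hx0⟩ := exists_ne (1 : P)
  obtain ⟨C, ⟨F, hF, rfl⟩, hmin⟩ := WellFounded.has_min hwf.wf
    {C : Subgroup P | ∃ F : Set P, F.Finite ∧ C = Subgroup.centralizer F}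
    ⟨_, ∅, Set.finite_empty, rfl⟩
  set K := Subgroup.closure (insert x0 F) with hK
  have hKfin : Finite K := (h.subgroup P).finite_closure _ (hF.insert x0)
  have hx0K : x0 ∈ K := Subgroup.subset_closure (Set.mem_insert _ _)
  have hKnt : Nontrivial K := (Subgroup.nontrivial_iff_ne_bot K).2 fun hb =>
    hx0 (Subgroup.mem_bot.1 (hb ▸ hx0K))
  have := (hP.to_subgroup K).center_nontrivial
  obtain ⟨z, hz⟩ := exists_ne (1 : Subgroup.center K)
  have hzF : ((z : K) : P) ∈ Subgroup.centralizer F := Subgroup.mem_centralizer_iff.2 fun f hf =>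
    congrArg Subtype.val (Subgroup.mem_center_iff.1 z.2
      ⟨f, Subgroup.subset_closure (Set.mem_insert_of_mem _ hf)⟩)
  refine ⟨((z : K) : P), (z : K).1.2, fun h1 => hz (Subtype.ext (Subtype.ext (Subtype.ext h1))),
    fun x hx => ?_⟩
  have hle : Subgroup.centralizer F ≤ Subgroup.centralizer (insert ⟨x, hx⟩ F) := by
    by_contra hn
    exact hmin _ ⟨_, hF.insert ⟨x, hx⟩, rfl⟩
      (lt_of_le_not_ge (Subgroup.centralizer_le (Set.subset_insert _ _)) hn)
  have := Subgroup.mem_centralizer_iff.1 (hle hzF) ⟨x, hx⟩ (Set.mem_insert _ _)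
  exact (congrArg Subtype.val this).symm

theorem exists_hasBoundedAbelian {p : ℕ} [hp : Fact p.Prime] {P : Subgroup G}
    (hP : IsPGroup p P) : ∃ m, HasBoundedAbelian p m P := by
  have hVA : IsVirtuallyAbelian P := by
    by_cases hne : P = ⊥
    · subst hne
      exact ⟨⊤, inferInstance, inferInstance⟩
    · obtain ⟨z, -, hz1, hz⟩ := h.exists_mem_forall_commute hP hne
      exact (h.isVirtuallyAbelian_centralizer z hz1).mono fun x hx =>
        Subgroup.mem_centralizer_singleton_iff.2 (hz x hx).symm.eq
  obtain ⟨A, hA, hAi⟩ := hVA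
  have hfin := (h.subgroup P).finite_torsion A hA hp.out.ne_zero
  refine ⟨max A.index {x | x ∈ A ∧ x ^ p = 1}.ncard, A, hA, hAi.index_ne_zero,
    le_max_left _ _, ?_⟩
  rw [← hfin.cast_ncard_eq]
  exact_mod_cast le_max_right _ _

theorem exists_isPGroup_ge {p : ℕ} [hp : Fact p.Prime] {R Q : Subgroup G} [Finite R] [Finite Q]
    (hR : IsPGroup p R) (hQ : IsPGroup p Q) : ∃ S : Subgroup G, Finite S ∧ IsPGroup p S ∧ R ≤ S ∧
      ∃ f : Q →* S, Function.Injective f := by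
  set K := Subgroup.closure ((R : Set G) ∪ Q) with hK
  have hKfin : Finite K := h.finite_closure _ ((Set.toFinite _).union (Set.toFinite _))
  have hRK : R ≤ K := fun x hx => Subgroup.subset_closure (Or.inl hx)
  have hQK : Q ≤ K := fun x hx => Subgroup.subset_closure (Or.inr hx)
  obtain ⟨S, hS⟩ := (hR.comap_of_injective K.subtype K.subtype_injective).exists_le_sylow
  obtain ⟨T, hT⟩ := (hQ.comap_of_injective K.subtype K.subtype_injective).exists_le_sylow
  refine ⟨(S : Subgroup K).map K.subtype,
    Finite.of_surjective _ (K.subtype.subgroupMap_surjective S),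
    S.isPGroup'.map _, fun x hx => ?_, ?_⟩
  · exact ⟨⟨x, hRK hx⟩, hS hx, rfl⟩
  · let f1 : Q →* T :=
      (Subgroup.inclusion hQK).codRestrict (T : Subgroup K) fun x => hT (Subgroup.mem_comap.2 x.2)
    have hf1 : Function.Injective f1 := fun a b hab =>
      Subgroup.inclusion_injective hQK (congrArg Subtype.val hab)
    let e := (Sylow.equiv T S).trans
      ((S : Subgroup K).equivMapOfInjective K.subtype K.subtype_injective)
    exact ⟨e.toMonoidHom.comp f1, e.injective.comp hf1⟩

/-- If every bound m failed for some finite Q m, Sylow's theorem would give an ascending chain of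
finite p-groups containing copies of all the Q m; the bound for its union, a p-group, is a
contradiction. -/
theorem exists_forall_hasBoundedAbelian (p : ℕ) [hp : Fact p.Prime] : ∃ m, ∀ Q : Subgroup G,
    Finite Q → IsPGroup p Q → HasBoundedAbelian p m Q := by
  by_contra hcon
  push Not at hcon
  choose Q hQfin hQp hQ using hcon
  have hstep : ∀ (m : ℕ) (R : {R : Subgroup G // Finite R ∧ IsPGroup p R}),
      ∃ S : {S : Subgroup G // Finite S ∧ IsPGroup p S}, (R : Subgroup G) ≤ S ∧
        ∃ f : Q m →* (S : Subgroup G), Function.Injective f := by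
    rintro m ⟨R, hRfin, hRp⟩
    have := hQfin m
    obtain ⟨S, hSfin, hSp, hRS, hf⟩ := h.exists_isPGroup_ge hRp (hQp m)
    exact ⟨⟨S, hSfin, hSp⟩, hRS, hf⟩
  choose next hnext hembed using hstep
  let R : ℕ → {R : Subgroup G // Finite R ∧ IsPGroup p R} :=
    fun n => Nat.rec ⟨⊥, inferInstance, IsPGroup.of_bot⟩ (fun n R => next n R) n
  let R' : ℕ → Subgroup G := fun n => (R n).1
  have hR : Monotone R' := monotone_nat_of_le_succ fun n => hnext n (R n)
  have hP : IsPGroup p (⨆ n, R' n : Subgroup G) := by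
    rintro ⟨x, hx⟩
    obtain ⟨n, hn⟩ := (Subgroup.mem_iSup_of_directed hR.directed_le).1 hx
    obtain ⟨k, hk⟩ := (R n).2.2 ⟨x, hn⟩
    have hk : x ^ p ^ k = 1 := congrArg Subtype.val hk
    exact ⟨k, Subtype.ext hk⟩
  obtain ⟨m, hm⟩ := h.exists_hasBoundedAbelian hP
  obtain ⟨f, hf⟩ := hembed m (R m)
  have hle : (next m (R m) : Subgroup G) ≤ ⨆ n, R' n :=
    le_iSup R' (m + 1)
  exact hQ m ((hm.of_injective (Subgroup.inclusion hle)
    (Subgroup.inclusion_injective hle)).of_injective f hf)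

theorem exists_not_dvd_orderOf (p : ℕ) [hp : Fact p.Prime] :
    ∃ l, ∀ y ∈ derivedSeries G l, ¬ p ∣ orderOf y := by
  obtain ⟨m, hm⟩ := h.exists_forall_hasBoundedAbelian p
  refine ⟨(m * m).factorial + (m.factorial + 1), fun y hy => ?_⟩
  obtain ⟨s, hs, hys⟩ := exists_finite_mem_derivedIn hy
  have hfin := h.finite_closure s hs
  have hsol := h.isSolvable_closure s hs
  rw [derivedIn_eq_map] at hys
  obtain ⟨z, hz, rfl⟩ := hys
  have := not_dvd_orderOf_of_mem_derivedSeries (p := p) (m := m) _ (Subgroup.closure s) le_rfl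
    (fun P hP => ?_) z hz
  · rwa [← Subgroup.orderOf_coe] at this
  · have e := P.equivMapOfInjective (Subgroup.closure s).subtype (Subgroup.subtype_injective _)
    exact (hm (P.map (Subgroup.closure s).subtype)
      (Finite.of_surjective _ (Subgroup.subtype _ |>.subgroupMap_surjective P))
      (hP.map _)).of_injective
      e.toMonoidHom e.injective

theorem exists_coprime_orderOf {m : ℕ} (hm : m ≠ 0) :
    ∃ l, ∀ k, l ≤ k → ∀ y ∈ derivedSeries G k, (orderOf y).Coprime m := by
  induction m using Nat.recOnMul with
  | zero => exact absurd rfl hm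
  | one => exact ⟨0, fun k _ y _ => Nat.coprime_one_right _⟩
  | prime p hp =>
    have : Fact p.Prime := ⟨hp⟩
    obtain ⟨l, hl⟩ := h.exists_not_dvd_orderOf p
    exact ⟨l, fun k hk y hy => ((Nat.Prime.coprime_iff_not_dvd hp).2
      (hl y (derivedSeries_antitone G hk hy))).symm⟩
  | mul a b iha ihb =>
    obtain ⟨l, hl⟩ := iha (left_ne_zero_of_mul hm)
    obtain ⟨l', hl'⟩ := ihb (right_ne_zero_of_mul hm)
    exact ⟨max l l', fun k hk y hy => Nat.Coprime.mul_right
      (hl k ((le_max_left _ _).trans hk) y hy) (hl' k ((le_max_right _ _).trans hk) y hy)⟩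

end HasSmallCentralizers

/-! ### Groups of prime rank one -/

section CyclicSylow

open scoped commutatorElement

theorem mul_pow_eq_of_commute {P : Type*} [Group P] {x y c : P} (hc : y * x = c * x * y)
    (hcx : Commute c x) (hcy : Commute c y) (n : ℕ) :
    y * x ^ n = c ^ n * x ^ n * y ∧ (x * y) ^ n = c ^ n.choose 2 * x ^ n * y ^ n := by
  have h1 : ∀ n : ℕ, y * x ^ n = c ^ n * x ^ n * y := by
    intro n
    induction n with
    | zero => simp
    | succ n ih =>
      rw [pow_succ' x, ← mul_assoc, hc, mul_assoc, ih, pow_succ' c]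
      simp only [mul_assoc]
      rw [← mul_assoc x, ← (hcx.pow_left n).eq]
      simp only [mul_assoc]
  refine ⟨h1 n, ?_⟩
  induction n with
  | zero => simp
  | succ n ih =>
    have e1 : y * c ^ n.choose 2 = c ^ n.choose 2 * y := (hcy.pow_left _).symm.eq
    have e2 : x * c ^ n.choose 2 = c ^ n.choose 2 * x := (hcx.pow_left _).symm.eq
    have e3 : x * c ^ n = c ^ n * x := (hcx.pow_left _).symm.eq
    rw [pow_succ', ih]
    calc x * y * (c ^ n.choose 2 * x ^ n * y ^ n)
        = x * (y * c ^ n.choose 2) * x ^ n * y ^ n := by simp only [mul_assoc]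
      _ = x * c ^ n.choose 2 * (y * x ^ n) * y ^ n := by rw [e1]; simp only [mul_assoc]
      _ = c ^ n.choose 2 * (x * c ^ n) * x ^ n * (y * y ^ n) := by
          rw [e2, h1]; simp only [mul_assoc]
      _ = c ^ n.choose 2 * c ^ n * (x * x ^ n) * (y * y ^ n) := by
          rw [e3]; simp only [mul_assoc]
      _ = c ^ (n + 1).choose 2 * x ^ (n + 1) * y ^ (n + 1) := by
          rw [← pow_add, ← pow_succ', ← pow_succ', Nat.choose_succ_succ' n 1, Nat.choose_one_right,
            add_comm]

/-- A group in which commuting elements of the same prime order generate the same subgroup. -/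
def HasPrimeRankOne (P : Type*) [Group P] : Prop :=
  ∀ q : ℕ, q.Prime → ∀ x y : P, x ^ q = 1 → y ^ q = 1 → Commute x y → x ≠ 1 →
    y ∈ Subgroup.zpowers x

theorem HasPrimeRankOne.of_injective {P Q : Type*} [Group P] [Group Q] (h : HasPrimeRankOne Q)
    (f : P →* Q) (hf : Function.Injective f) : HasPrimeRankOne P := by
  intro q hq x y hx hy hxy hx1
  obtain ⟨k, hk⟩ := h q hq (f x) (f y) (by rw [← map_pow, hx, map_one])
    (by rw [← map_pow, hy, map_one]) (hxy.map f) (fun h1 => hx1 (hf (h1.trans (map_one f).symm)))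
  exact ⟨k, hf (by rw [map_zpow]; exact hk)⟩

theorem commutator_le_of_isCoatom {P : Type*} [Group P] {M : Subgroup P} [M.Normal]
    (hM : IsCoatom M) : commutator P ≤ M := by
  obtain ⟨y, -, hy⟩ := SetLike.exists_of_lt (lt_top_iff_ne_top.2 hM.1)
  have htop : M ⊔ Subgroup.zpowers y = ⊤ :=
    hM.2 _ (lt_of_le_of_ne le_sup_left fun h =>
      hy (h ▸ Subgroup.mem_sup_right (Subgroup.mem_zpowers y)))
  have hgen : ∀ q : P ⧸ M, q ∈ Subgroup.zpowers (QuotientGroup.mk' M y) := by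
    intro q
    have h1 := congrArg (Subgroup.map (QuotientGroup.mk' M)) htop
    rw [Subgroup.map_sup, QuotientGroup.map_mk'_self, bot_sup_eq, MonoidHom.map_zpowers,
      ← MonoidHom.range_eq_map, QuotientGroup.range_mk'] at h1
    rw [h1]; exact Subgroup.mem_top q
  rw [commutator_def, Subgroup.commutator_le]
  intro a _ b _
  refine (QuotientGroup.eq_one_iff _).1 ?_
  change QuotientGroup.mk' M ⁅a, b⁆ = 1
  rw [map_commutatorElement, commutatorElement_eq_one_iff_mul_comm]
  obtain ⟨i, hi⟩ := hgen (QuotientGroup.mk' M a)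
  obtain ⟨j, hj⟩ := hgen (QuotientGroup.mk' M b)
  rw [← hi, ← hj]
  exact ((Commute.refl _).zpow_zpow i j).eq

/-- In a minimal counterexample proper subgroups are commutative, so the intersection of two maximal
subgroups M, N is central. The p-th power map is then a homomorphism into M ∩ N with kernel of order
at most p, whereas M ∩ N has index at least 2p. -/
theorem isCyclic_of_isPGroup {p : ℕ} [hp : Fact p.Prime] :
    ∀ (n : ℕ) (P : Type u) [Group P] [Finite P], Nat.card P ≤ n → IsPGroup p P →
      (p ≠ 2 ∨ ∀ x y : P, Commute x y) → HasPrimeRankOne P → IsCyclic P := by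
  intro n
  induction n with
  | zero => intro P _ _ h; exact absurd Nat.card_pos (not_lt.2 h)
  | succ n ih =>
    intro P _ _ hn hP h2 hr
    by_contra hcyc
    have hsub : ∀ K : Subgroup P, K ≠ ⊤ → ∀ x ∈ K, ∀ y ∈ K, Commute x y := by
      intro K hK x hx y hy
      have hlt : Nat.card K < Nat.card P := by
        by_contra hge
        exact hK (Subgroup.eq_top_of_le_card K (not_lt.1 hge))
      have := ih K (by omega) (hP.to_subgroup K)
        (h2.imp_right fun h2 x y => Subtype.ext (h2 x y)) (hr.of_injective K.subtype
          K.subtype_injective)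
      obtain ⟨g, hg⟩ := this.exists_generator
      obtain ⟨i, hi⟩ := hg ⟨x, hx⟩
      obtain ⟨j, hj⟩ := hg ⟨y, hy⟩
      have := ((Commute.refl g).zpow_zpow i j).map K.subtype
      have hi : g ^ i = ⟨x, hx⟩ := hi
      have hj : g ^ j = ⟨y, hy⟩ := hj
      rwa [hi, hj] at this
    have hnt : Nontrivial P := by
      by_contra hnt
      rw [not_nontrivial_iff_subsingleton] at hnt
      exact hcyc inferInstance
    have hnil : Group.IsNilpotent P := hP.isNilpotent
    obtain ⟨M, hM, -⟩ := (eq_top_or_exists_le_coatom (⊥ : Subgroup P)).resolve_left bot_ne_top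
    obtain ⟨y, -, hyM⟩ := SetLike.exists_of_lt (lt_top_iff_ne_top.2 hM.1)
    obtain ⟨N, hN, hyN⟩ := (eq_top_or_exists_le_coatom (Subgroup.zpowers y)).resolve_left
      fun h => hcyc ⟨y, fun x => h.ge (Subgroup.mem_top x)⟩
    have hMN : ¬ M ≤ N := fun hle => by
      have : M = N := by
        by_contra hne
        exact hN.1 (hM.2 N (lt_of_le_of_ne hle hne))
      exact hyM (this ▸ hyN (Subgroup.mem_zpowers y))
    have hnorm : ∀ K : Subgroup P, IsCoatom K → K.Normal :=
      (Group.isNilpotent_of_finite_tfae.out 0 2 rfl rfl).1 hnil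
    have hMn := hnorm M hM
    have hNn := hnorm N hN
    have hsup : N ⊔ M = ⊤ := hN.2 _ (lt_of_le_of_ne le_sup_left fun h => hMN (h ▸ le_sup_right))
    have hcen : ∀ z ∈ M ⊓ N, ∀ x, Commute z x := by
      rintro z ⟨hzM, hzN⟩ x
      have hle : N ⊔ M ≤ Subgroup.centralizer {z} := sup_le
        (fun w hw => Subgroup.mem_centralizer_singleton_iff.2 (hsub N hN.1 w hw z hzN).eq)
        (fun w hw => Subgroup.mem_centralizer_singleton_iff.2 (hsub M hM.1 w hw z hzM).eq)
      exact (Subgroup.mem_centralizer_singleton_iff.1 (hle (hsup ▸ Subgroup.mem_top x))).symm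
    have hpow : ∀ x : P, x ^ p ∈ M ⊓ N := fun x =>
      ⟨pow_mem_of_isCoatom hP hM x, pow_mem_of_isCoatom hP hN x⟩
    have hmul : ∀ x y : P, (x * y) ^ p = x ^ p * y ^ p := by
      intro x y
      rcases h2 with h2 | h2
      · have hcmem : ⁅y, x⁆ ∈ M ⊓ N := by
          have hc : ⁅y, x⁆ ∈ commutator P :=
            Subgroup.commutator_mem_commutator (Subgroup.mem_top y) (Subgroup.mem_top x)
          exact ⟨commutator_le_of_isCoatom hM hc, commutator_le_of_isCoatom hN hc⟩
        obtain ⟨e1, e2⟩ := mul_pow_eq_of_commute (x := x) (y := y) (c := ⁅y, x⁆)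
          (by rw [commutatorElement_def]; group) (hcen _ hcmem x) (hcen _ hcmem y) p
        -- As x^p is central, the commutator has `p`-th power 1; for odd `p` the exponent p choose 2
        -- is a multiple of `p`.
        rw [← (hcen _ (hpow x) y).eq, mul_assoc, right_eq_mul] at e1
        obtain ⟨k, hk⟩ := hp.out.dvd_choose_self two_ne_zero
          (lt_of_le_of_ne hp.out.two_le h2.symm)
        rw [e2, hk, pow_mul, e1, one_pow, one_mul]
      · exact (h2 x y).mul_pow p
    let f : P →* P := { toFun := fun x => x ^ p, map_one' := one_pow p, map_mul' := hmul }
    have hrange : f.range ≤ M ⊓ N := by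
      rintro _ ⟨x, rfl⟩
      exact hpow x
    have hcnt := hP.center_nontrivial
    obtain ⟨z, hz⟩ := exists_prime_orderOf_dvd_card' p
      ((hP.to_subgroup (Subgroup.center P)).card_eq_or_dvd.resolve_left
        (Finite.one_lt_card (α := Subgroup.center P)).ne')
    rw [← Subgroup.orderOf_coe] at hz
    have hker : f.ker ≤ Subgroup.zpowers (z : P) := by
      intro x hx
      refine hr p hp.out z x (by rw [← hz, pow_orderOf_eq_one]) hx
        (Subgroup.mem_center_iff.1 z.2 x).symm fun h1 => ?_
      rw [h1, orderOf_one] at hz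
      exact hp.out.ne_one hz.symm
    have hker' : Nat.card f.ker ≤ p := by
      have := Subgroup.card_le_of_le hker
      rwa [Nat.card_zpowers, hz] at this
    have hidx : 2 * p ≤ (M ⊓ N).index := by
      rw [← Subgroup.relIndex_mul_index (inf_le_left : M ⊓ N ≤ M)]
      refine Nat.mul_le_mul ?_ ?_
      · have h0 : (M ⊓ N).relIndex M ≠ 0 :=
          Subgroup.FiniteIndex.index_ne_zero (H := (M ⊓ N).subgroupOf M)
        have h1 : (M ⊓ N).relIndex M ≠ 1 := fun h1 =>
          hMN ((Subgroup.relIndex_eq_one.1 h1).trans inf_le_right)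
        omega
      · obtain ⟨k, hk⟩ := hP.index M
        have hk0 : k ≠ 0 := by
          rintro rfl
          exact hM.1 (Subgroup.index_eq_one.1 (by rw [hk, pow_zero]))
        rw [hk]
        exact Nat.le_self_pow hk0 p
    have e1 := f.ker.card_mul_index
    have e2 := (M ⊓ N).card_mul_index
    rw [Subgroup.index_ker] at e1
    have e3 := Subgroup.card_le_of_le hrange
    have e4 : 0 < Nat.card (M ⊓ N : Subgroup P) := Nat.card_pos
    have e5 := hp.out.pos
    have e6 : Nat.card f.ker * Nat.card f.range ≤ p * Nat.card (M ⊓ N : Subgroup P) :=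
      Nat.mul_le_mul hker' e3
    have e7 : Nat.card (M ⊓ N : Subgroup P) * (2 * p) ≤
      Nat.card (M ⊓ N : Subgroup P) * (M ⊓ N).index := Nat.mul_le_mul_left _ hidx
    nlinarith

/-- The alternative on 2 excludes generalized quaternion Sylow subgroups, which have prime rank one
but are not cyclic. -/
theorem HasPrimeRankOne.isZGroup {K : Type u} [Group K] [Finite K] (hr : HasPrimeRankOne K)
    (h2 : (∀ x : K, ¬ 2 ∣ orderOf x) ∨ ∀ x y : K, Commute x y) : IsZGroup K := by
  refine ⟨fun q hq P => ?_⟩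
  have : Fact q.Prime := ⟨hq⟩
  by_cases hq2 : q = 2 ∧ ∀ x : K, ¬ 2 ∣ orderOf x
  · have : Subsingleton P := by
      refine ⟨fun x y => ?_⟩
      have key : ∀ x : P, x = 1 := fun x => by
        by_contra hx
        have := P.isPGroup'.dvd_orderOf hx
        rw [← Subgroup.orderOf_coe] at this
        exact hq2.2 _ ((dvd_of_eq hq2.1.symm).trans this)
      rw [key x, key y]
    infer_instance
  · refine isCyclic_of_isPGroup (p := q) _ P le_rfl P.isPGroup' ?_
      (hr.of_injective (P : Subgroup K).subtype (P : Subgroup K).subtype_injective)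
    rcases h2 with h2 | h2
    · exact Or.inl fun h => hq2 ⟨h, h2⟩
    · exact Or.inr fun x y => Subtype.ext (h2 x y)

theorem HasPrimeRankOne.isCyclic {K : Type u} [Group K] [Finite K] (hr : HasPrimeRankOne K)
    (hc : ∀ x y : K, Commute x y) : IsCyclic K := by
  have := hr.isZGroup (Or.inr hc)
  let _ : CommGroup K := { (inferInstance : Group K) with mul_comm := hc }
  infer_instance

/-- A deep derived term has no elements of even order, so its finite subgroups are Z-groups with
cyclic derived subgroup; the term would be metabelian, although soluble normal subgroups are
trivial. -/
theorem HasSmallCentralizers.not_hasPrimeRankOne {G : Type u} [Group G] [Nontrivial G]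
    (h : HasSmallCentralizers G) : ¬ HasPrimeRankOne G := by
  intro hr
  obtain ⟨l, hl⟩ := h.exists_not_dvd_orderOf 2
  set M := derivedSeries G l with hM
  have hs : Group.IsSolvable M := by
    refine ⟨2, (Subgroup.eq_bot_iff_forall _).2 fun y hy => ?_⟩
    obtain ⟨s, hs, hys⟩ := exists_finite_mem_derivedIn hy
    have hfin := (h.subgroup M).finite_closure s hs
    rw [derivedIn_eq_map] at hys
    have hZ : IsZGroup (Subgroup.closure s) := by
      refine HasPrimeRankOne.isZGroup (hr.of_injective
        (M.subtype.comp (Subgroup.closure s).subtype)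
        (M.subtype_injective.comp (Subgroup.subtype_injective _))) (Or.inl fun x => ?_)
      rw [← Subgroup.orderOf_coe, ← Subgroup.orderOf_coe]
      exact hl _ (x : M).2
    have hbot : derivedSeries (Subgroup.closure s) 2 = ⊥ := by
      have hcyc := IsZGroup.isCyclic_commutator (G := Subgroup.closure s)
      have : IsMulCommutative (commutator (Subgroup.closure s)) := by
        obtain ⟨g, hg⟩ := hcyc.exists_generator
        refine ⟨⟨fun a b => ?_⟩⟩
        obtain ⟨i, rfl⟩ := hg a
        obtain ⟨j, rfl⟩ := hg b
        exact ((Commute.refl g).zpow_zpow i j).eq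
      have h1 := Subgroup.commutator_self_eq_bot_iff.2 this
      rw [← derivedSeries_one] at h1
      exact h1
    rw [hbot, Subgroup.map_bot] at hys
    exact Subgroup.mem_bot.1 hys
  exact h.derivedSeries_ne_bot l (h.eq_bot_of_isSolvable M)

end CyclicSylow

/-! ### Passage to abelian sections -/

section InducedAction

/-- The action of automorphisms on the quotient by a characteristic subgroup. -/
def quotientAut {U : Type*} [Group U] (V : Subgroup U) [hV : V.Characteristic] :
    MulAut U →* MulAut (U ⧸ V) where
  toFun α := QuotientGroup.congr V V α (Subgroup.characteristic_iff_map_eq.1 hV α)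
  map_one' := by
    ext x; obtain ⟨x, rfl⟩ := QuotientGroup.mk_surjective x; rfl
  map_mul' _ _ := by
    ext x; obtain ⟨x, rfl⟩ := QuotientGroup.mk_surjective x; rfl

variable {A : Type*} [CommGroup A] {p : ℕ} [hp : Fact p.Prime] {D U : Type*} [Group D] [Group U]
  [Finite U]

theorem exists_fixed_of_map_eq {K : Type*} [Group K] (θ : A →* D) (Φ : D →* K) (H : Subgroup D)
    [Finite H] (hA : IsPGroup p A) (hHn : ∀ a, ∀ x ∈ H, θ a * x * (θ a)⁻¹ ∈ H)
    (hpH : ¬ p ∣ Nat.card H) {S : Subgroup A} {l : K} (hl : l ∈ H.map Φ)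
    (hlS : ∀ a ∈ S, Commute (Φ (θ a)) l) :
    ∃ x ∈ H, Φ x = l ∧ ∀ a ∈ S, Commute (θ a) x := by
  obtain ⟨x, hx, rfl⟩ := hl
  have hle : H ⊓ Φ.ker ≤ H := inf_le_left
  have : Finite (H ⊓ Φ.ker : Subgroup D) :=
    Finite.of_injective (Subgroup.inclusion hle) (Subgroup.inclusion_injective hle)
  obtain ⟨n, hn, hfix⟩ := exists_fixed_mul_of_not_dvd_card
    ((MulAut.conj.comp θ).comp S.subtype) (hA.to_subgroup S) (H ⊓ Φ.ker) (fun a n hn =>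
      ⟨hHn a n hn.1, (inferInstance : Φ.ker.Normal).conj_mem n hn.2 _⟩)
    (fun hd => hpH (hd.trans (Subgroup.card_dvd_of_le hle))) x (fun a =>
      ⟨H.mul_mem (H.inv_mem hx) (hHn a x hx), MonoidHom.mem_ker.2 (by
        change Φ (x⁻¹ * (θ a * x * (θ a)⁻¹)) = 1
        rw [map_mul, map_mul, map_mul, map_inv, map_inv, (hlS a a.2).eq, mul_inv_cancel_right,
          inv_mul_cancel])⟩)
  refine ⟨x * n, mul_mem hx hn.1, by rw [map_mul, MonoidHom.mem_ker.1 hn.2, mul_one],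
    fun a ha => ?_⟩
  exact mul_inv_eq_iff_eq_mul.1 (hfix ⟨a, ha⟩)

/-- The derived group of a coprime group of operators, normalized by an elementary abelian group of
order `p ^ 2`, acts trivially on abelian sections of prime exponent. -/
theorem inv_mul_map_mem_of_mem_commutator (hA : ∀ a : A, a ^ p = 1) (hcard : Nat.card A = p ^ 2)
    (θ : A →* D) (H : Subgroup D) [Finite H] [Group.IsSolvable H]
    (hHn : ∀ a, ∀ x ∈ H, θ a * x * (θ a)⁻¹ ∈ H) (hpH : ¬ p ∣ Nat.card H)
    (Ψ : D →* MulAut U) (hpU : ¬ p ∣ Nat.card U) (hco : (Nat.card H).Coprime (Nat.card U))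
    (hHcyc : ∀ a, a ≠ 1 → ∃ g, ∀ x ∈ H, Commute (θ a) x → x ∈ Subgroup.zpowers g)
    (hUcyc : ∀ a, a ≠ 1 → ∃ g, ∀ u, Ψ (θ a) u = u → u ∈ Subgroup.zpowers g)
    (hHU : ∀ a, a ≠ 1 → ∀ x ∈ H, Commute (θ a) x → ∀ u, Ψ (θ a) u = u → Ψ x u = u)
    (hHA : ∀ x ∈ H, (∀ a, Commute (θ a) x) → x = 1) {r : ℕ} [hr : Fact r.Prime]
    (V : Subgroup U) [hV : V.Characteristic] (hVc : commutator U ≤ V) (hVr : ∀ u, u ^ r ∈ V)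
    {x : D} (hx : x ∈ ⁅H, H⁆) (u : U) : u⁻¹ * Ψ x u ∈ V := by
  let _ : CommGroup (U ⧸ V) :=
    { (inferInstance : Group (U ⧸ V)) with
      mul_comm := (Subgroup.Normal.quotient_commutative_iff_commutator_le.2 hVc).is_comm.comm }
  have hAp : IsPGroup p A := fun a => ⟨1, by rw [pow_one]; exact hA a⟩
  let Φ : D →* MulAut (U ⧸ V) := (quotientAut V).comp Ψ
  have hΦ : ∀ d u, Φ d (QuotientGroup.mk' V u) = QuotientGroup.mk' V (Ψ d u) := fun d u => rfl
  have hWU : Nat.card (U ⧸ V) ∣ Nat.card U :=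
    Subgroup.card_dvd_of_surjective _ (QuotientGroup.mk'_surjective V)
  have hLH : Nat.card (H.map Φ) ∣ Nat.card H := Subgroup.card_map_dvd _ Φ
  have hsolL : Group.IsSolvable (H.map Φ) :=
    Group.isSolvable_of_surjective (Φ.subgroupMap_surjective H)
  have hliftU : ∀ a, ∀ w, Φ (θ a) w = w → ∃ u, QuotientGroup.mk' V u = w ∧ Ψ (θ a) u = u := by
    intro a w hw
    obtain ⟨u, rfl⟩ := QuotientGroup.mk'_surjective V w
    obtain ⟨n, hn, hfix⟩ := exists_fixed_mul_of_pow_eq_one (p := p) (n := 1) (α := Ψ (θ a))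
      (by rw [pow_one, ← map_pow, ← map_pow, hA, map_one, map_one]) V
      (fun n hn => Subgroup.characteristic_iff_map_le.1 hV _ (Subgroup.mem_map_of_mem _ hn))
      (fun hd => hpU (hd.trans (Subgroup.card_subgroup_dvd_card V))) u
      (QuotientGroup.eq.1 (hw.symm.trans (hΦ _ _)))
    refine ⟨u * n, ?_, hfix⟩
    rw [map_mul]
    exact mul_eq_left.2 ((QuotientGroup.eq_one_iff n).2 hn)
  have hliftH : ∀ a, ∀ l ∈ H.map Φ, Commute (Φ (θ a)) l →
      ∃ x ∈ H, Φ x = l ∧ Commute (θ a) x := by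
    intro a l hl hal
    obtain ⟨x, hx, hxl, hxa⟩ := exists_fixed_of_map_eq θ Φ H hAp hHn hpH
      (S := Subgroup.zpowers a) hl (by
        rintro _ ⟨i, rfl⟩
        change Commute (Φ (θ (a ^ i))) l
        rw [map_zpow, map_zpow]
        exact hal.zpow_left i)
    exact ⟨x, hx, hxl, hxa a (Subgroup.mem_zpowers a)⟩
  have hpow : ∀ w : U ⧸ V, w ^ r = 1 := by
    intro w
    obtain ⟨u, rfl⟩ := QuotientGroup.mk'_surjective V w
    rw [← map_pow]
    exact (QuotientGroup.eq_one_iff _).2 (hVr u)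
  -- By coprimality, fixed points in the section and centralizers in the image of `H` lift to `U`
  -- and `H`, so the hypotheses descend.
  have key := commute_of_rankTwo hA hcard (Φ.comp θ) (fun hd => hpU (hd.trans hWU))
    (fun a ha w w' hw hw' hw1 => ?_) (H.map Φ) ?_ (fun hd => hpH (hd.trans hLH))
    (fun q hq hqL hqW => hq.one_lt.ne'
      (Nat.dvd_one.1 (hco ▸ Nat.dvd_gcd (hqL.trans hLH) (hqW.trans hWU))))
    ?_ ?_ ?_
  · have hxΦ : Φ x = 1 := by
      have h1 : Φ x ∈ ⁅H.map Φ, H.map Φ⁆ := by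
        rw [← Subgroup.map_commutator]
        exact Subgroup.mem_map_of_mem Φ hx
      have h2 : ⁅H.map Φ, H.map Φ⁆ = ⊥ := by
        rw [Subgroup.commutator_eq_bot_iff_le_centralizer]
        exact fun l hl => Subgroup.mem_centralizer_iff.2 fun m hm => (key m hm l hl).eq
      rw [h2] at h1
      exact Subgroup.mem_bot.1 h1
    refine QuotientGroup.eq.1 ?_
    exact (DFunLike.congr_fun hxΦ (QuotientGroup.mk' V u)).symm
  · obtain ⟨g, hg⟩ := hUcyc a ha
    obtain ⟨u, rfl, hu⟩ := hliftU a w hw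
    obtain ⟨u', rfl, hu'⟩ := hliftU a w' hw'
    have hmem : ∀ z ∈ Subgroup.zpowers g,
        QuotientGroup.mk' V z ∈ Subgroup.zpowers (QuotientGroup.mk' V g) := by
      rintro _ ⟨i, rfl⟩
      exact ⟨i, (map_zpow (QuotientGroup.mk' V) g i).symm⟩
    exact mem_zpowers_of_mem_zpowers (q := r) (hmem _ (hg u hu)) (hmem _ (hg u' hu'))
      (hpow _) (hpow _) hw1
  · rintro a _ ⟨x, hx, rfl⟩
    exact ⟨_, hHn a x hx, by rw [map_mul, map_mul, map_inv]; rfl⟩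
  · intro a ha
    obtain ⟨g, hg⟩ := hHcyc a ha
    refine ⟨Φ g, fun l hl hal => ?_⟩
    obtain ⟨x, hx, rfl, hax⟩ := hliftH a l hl hal
    obtain ⟨i, rfl⟩ := hg x hx hax
    exact ⟨i, (map_zpow Φ g i).symm⟩
  · intro a ha l hl hal w hw
    obtain ⟨x, hx, rfl, hax⟩ := hliftH a l hl hal
    obtain ⟨u, rfl, hu⟩ := hliftU a w hw
    rw [hΦ, hHU a ha x hx hax u hu]
  · intro l hl hal
    obtain ⟨x, hx, rfl, hxa⟩ := exists_fixed_of_map_eq θ Φ H hAp hHn hpH (S := ⊤) hl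
      fun a _ => hal a
    rw [hHA x hx fun a => hxa a (Subgroup.mem_top a), map_one]

end InducedAction

theorem coprime_card_of_forall_orderOf {G : Type*} [Group G] {N : Subgroup G} [Finite N] {m : ℕ}
    (hN : ∀ y ∈ N, (orderOf y).Coprime m) : (Nat.card N).Coprime m := by
  refine Nat.Coprime.symm (Nat.coprime_of_dvd fun q hq hqm hqN => ?_)
  have : Fact q.Prime := ⟨hq⟩
  obtain ⟨y, hy⟩ := exists_prime_orderOf_dvd_card' q hqN
  have h1 := hN y y.2
  rw [Subgroup.orderOf_coe, hy] at h1
  exact (hq.coprime_iff_not_dvd.1 h1) hqm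

theorem exists_elementaryAbelian {G : Type u} [Group G] {q : ℕ} [hq : Fact q.Prime] {x y : G}
    (hx : x ^ q = 1) (hy : y ^ q = 1) (hxy : Commute x y) (hx1 : x ≠ 1)
    (hyx : y ∉ Subgroup.zpowers x) :
    ∃ (A : Type u) (_ : CommGroup A) (θ : A →* G), (∀ a : A, a ^ q = 1) ∧ Nat.card A = q ^ 2 ∧
      Function.Injective θ ∧ ∀ g, Commute g x → Commute g y → ∀ a, Commute (θ a) g := by
  have hy1 : y ≠ 1 := fun h => hyx (h ▸ one_mem _)
  have hcomm : ∀ (m : Subgroup.zpowers x) (n : Subgroup.zpowers y), Commute (m : G) n := by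
    rintro ⟨_, i, rfl⟩ ⟨_, j, rfl⟩
    exact hxy.zpow_zpow i j
  have hpow : ∀ {z : G}, z ^ q = 1 → ∀ w ∈ Subgroup.zpowers z, w ^ q = 1 := by
    rintro z hz _ ⟨i, rfl⟩
    change (z ^ i) ^ q = 1
    rw [← zpow_natCast, ← zpow_mul, mul_comm, zpow_mul, zpow_natCast, hz, one_zpow]
  let inst : CommGroup (Subgroup.zpowers x × Subgroup.zpowers y) :=
    { (inferInstance : Group (Subgroup.zpowers x × Subgroup.zpowers y)) with
      mul_comm := fun a b => Prod.ext (mul_comm' _ _) (mul_comm' _ _) }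
  refine ⟨Subgroup.zpowers x × Subgroup.zpowers y, inst,
    MonoidHom.noncommCoprod (Subgroup.subtype _) (Subgroup.subtype _) hcomm, ?_, ?_, ?_, ?_⟩
  · rintro ⟨m, n⟩
    exact Prod.ext (Subtype.ext (hpow hx m m.2)) (Subtype.ext (hpow hy n n.2))
  · rw [Nat.card_prod, Nat.card_zpowers, Nat.card_zpowers, orderOf_eq_prime hx hx1,
      orderOf_eq_prime hy hy1, sq]
  · rw [injective_iff_map_eq_one]
    rintro ⟨m, n⟩ hmn
    have hmn : (m : G) * n = 1 := hmn
    have hn : (n : G) ∈ Subgroup.zpowers x := by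
      rw [eq_inv_of_mul_eq_one_right hmn]
      exact inv_mem m.2
    have hn1 : (n : G) = 1 := by
      by_contra hne
      refine hyx (Subgroup.zpowers_le.2 hn ?_)
      rw [zpowers_eq_of_mem_of_ne_one hy n.2 hne]
      exact Subgroup.mem_zpowers y
    rw [hn1, mul_one] at hmn
    exact Prod.ext (Subtype.ext hmn) (Subtype.ext hn1)
  · rintro g hgx hgy ⟨⟨_, i, rfl⟩, ⟨_, j, rfl⟩⟩
    exact ((hgx.zpow_right i).mul_right (hgy.zpow_right j)).symm

/-- Normal `p'`-subgroups in which the elementary abelian group `θ(A)` has only the trivial fixed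
point, while the centralizers of the nontrivial elements of `θ(A)` are abelian. -/
structure HasAbelianFixedPoints {G A : Type*} [Group G] [CommGroup A] (p : ℕ) (θ : A →* G)
    (M : Subgroup G) : Prop where
  coprime : ∀ y ∈ M, (orderOf y).Coprime p
  commute : ∀ a, a ≠ 1 → ∀ u ∈ M, ∀ v ∈ M, Commute (θ a) u → Commute (θ a) v → Commute u v
  eq_one : ∀ u ∈ M, (∀ a, Commute (θ a) u) → u = 1

theorem HasAbelianFixedPoints.mono {G A : Type*} [Group G] [CommGroup A] {p : ℕ} {θ : A →* G}
    {M N : Subgroup G} (h : HasAbelianFixedPoints p θ M) (hN : N ≤ M) :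
    HasAbelianFixedPoints p θ N :=
  ⟨fun y hy => h.coprime y (hN hy), fun a ha u hu v hv => h.commute a ha u (hN hu) v (hN hv),
    fun u hu => h.eq_one u (hN hu)⟩

/-! ### Centralizers of a rank-two subgroup in deep derived terms -/

namespace HasSmallCentralizers

variable {G : Type u} [Group G] (h : HasSmallCentralizers G)

include h

theorem exists_finite_conj_invariant {N : Subgroup G} [hN : N.Normal] (D : Subgroup G) [Finite D]
    {u : G} (hu : u ∈ N) : ∃ U : Subgroup G, Finite U ∧ U ≤ N ∧ u ∈ U ∧
      ∀ d ∈ D, ∀ x ∈ U, d * x * d⁻¹ ∈ U := by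
  have hfin : (Set.range fun d : D => (d : G) * u * (d : G)⁻¹).Finite := Set.finite_range _
  refine ⟨Subgroup.closure (Set.range fun d : D => (d : G) * u * (d : G)⁻¹),
    h.finite_closure _ hfin, ?_, Subgroup.subset_closure ⟨1, by simp⟩, fun d hd => ?_⟩
  · rw [Subgroup.closure_le]
    rintro _ ⟨d, rfl⟩
    exact hN.conj_mem u hu d
  · have : Subgroup.closure (Set.range fun d : D => (d : G) * u * (d : G)⁻¹) ≤
        (Subgroup.closure (Set.range fun d : D => (d : G) * u * (d : G)⁻¹)).comap
          (MulAut.conj d).toMonoidHom := by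
      rw [Subgroup.closure_le]
      rintro _ ⟨e, rfl⟩
      refine Subgroup.subset_closure ⟨⟨d, hd⟩ * e, ?_⟩
      change d * e * u * (d * e : G)⁻¹ = d * (e * u * (e : G)⁻¹) * d⁻¹
      group
    exact fun x hx => this hx

variable [Nontrivial G] {A : Type*} [CommGroup A] {p : ℕ} [hp : Fact p.Prime]

/-- Finitely many a impose finitely many coprimality conditions. An element u of the term
centralized by A commutes with each abelian C(a) there; these generate finite A-invariant subgroups
covering the term, whose centralizer is trivial. -/
theorem exists_hasAbelianFixedPoints (hA : ∀ a : A, a ^ p = 1) (hcard : Nat.card A = p ^ 2)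
    (θ : A →* G) (hθ : Function.Injective θ) :
    ∃ l, HasAbelianFixedPoints p θ (derivedSeries G l) := by
  have hAfin : Finite A := Nat.finite_of_card_ne_zero (by
    rw [hcard]; exact pow_ne_zero _ hp.out.ne_zero)
  have := Fintype.ofFinite A
  have hm : ∀ a : A, ∃ m ≠ 0, a ≠ 1 → ∀ u v : G, (orderOf u).Coprime m → (orderOf v).Coprime m →
      Commute (θ a) u → Commute (θ a) v → Commute u v := by
    intro a
    by_cases ha : a = 1
    · exact ⟨1, one_ne_zero, fun h => absurd ha h⟩
    · obtain ⟨m, hm0, hm⟩ := h.exists_commute_of_coprime (x := θ a)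
        (fun h1 => ha (hθ (h1.trans (map_one θ).symm)))
      exact ⟨m, hm0, fun _ => hm⟩
  choose m hm0 hm using hm
  obtain ⟨l, hl⟩ := h.exists_coprime_orderOf (m := p * ∏ a, m a)
    (mul_ne_zero hp.out.ne_zero (Finset.prod_ne_zero_iff.2 fun a _ => hm0 a))
  have hcop : ∀ y ∈ derivedSeries G l, (orderOf y).Coprime p := fun y hy =>
    (hl l le_rfl y hy).coprime_dvd_right (dvd_mul_right _ _)
  have hcom : ∀ a, a ≠ 1 → ∀ u ∈ derivedSeries G l, ∀ v ∈ derivedSeries G l,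
      Commute (θ a) u → Commute (θ a) v → Commute u v := by
    intro a ha u hu v hv
    have hd : m a ∣ p * ∏ a, m a := (Finset.dvd_prod_of_mem m (Finset.mem_univ a)).mul_left p
    exact hm a ha u v ((hl l le_rfl u hu).coprime_dvd_right hd)
      ((hl l le_rfl v hv).coprime_dvd_right hd)
  refine ⟨l, hcop, hcom, fun u hu hau => ?_⟩
  have hbot := h.centralizer_eq_bot (h.derivedSeries_ne_bot l)
  refine Subgroup.mem_bot.1 (hbot ▸ Subgroup.mem_centralizer_iff.2 fun v hv => ?_)
  have : Finite θ.range := Finite.of_surjective _ θ.rangeRestrict_surjective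
  obtain ⟨U, hUfin, hUM, hvU, hU⟩ := h.exists_finite_conj_invariant θ.range hv
  have hsol := h.isSolvable_of_finite U
  have hle := le_of_fixed_mem hA hcard (MulAut.conj.comp θ) U (fun a => hU (θ a) ⟨a, rfl⟩)
    (hp.out.coprime_iff_not_dvd.1
      (coprime_card_of_forall_orderOf fun y hy => hcop y (hUM hy)).symm)
    (Subgroup.centralizer {u}) fun a ha k hk hak =>
      Subgroup.mem_centralizer_singleton_iff.2
        (hcom a ha k (hUM hk) u hu (mul_inv_eq_iff_eq_mul.1 hak) (hau a)).eq
  exact Subgroup.mem_centralizer_singleton_iff.1 (hle hvU)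

/-- If the abelian C_M(a) contains a rank-two group B, every element of C_M(a) centralizes B. Far
enough down, only 1 centralizes B, and the condition for a becomes vacuous. -/
theorem exists_hasAbelianFixedPoints_cyclic (hA : ∀ a : A, a ^ p = 1)
    (hcard : Nat.card A = p ^ 2) (θ : A →* G) (hθ : Function.Injective θ) :
    ∃ l, HasAbelianFixedPoints p θ (derivedSeries G l) ∧ ∀ a, a ≠ 1 → ∀ q : ℕ, q.Prime →
      ∀ u ∈ derivedSeries G l, ∀ v ∈ derivedSeries G l, Commute (θ a) u → Commute (θ a) v →
        u ^ q = 1 → v ^ q = 1 → u ≠ 1 → v ∈ Subgroup.zpowers u := by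
  have hAfin : Finite A := Nat.finite_of_card_ne_zero (by
    rw [hcard]; exact pow_ne_zero _ hp.out.ne_zero)
  have := Fintype.ofFinite A
  obtain ⟨l, hl⟩ := h.exists_hasAbelianFixedPoints hA hcard θ hθ
  have key : ∀ a, ∃ k₀, ∀ k, k₀ ≤ k → a ≠ 1 → ∀ q : ℕ, q.Prime →
      ∀ u ∈ derivedSeries G k, ∀ v ∈ derivedSeries G k, Commute (θ a) u → Commute (θ a) v →
        u ^ q = 1 → v ^ q = 1 → u ≠ 1 → v ∈ Subgroup.zpowers u := by
    intro a
    by_cases hex : ∃ q : ℕ, a ≠ 1 ∧ q.Prime ∧ ∃ u ∈ derivedSeries G l, ∃ v ∈ derivedSeries G l,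
        Commute (θ a) u ∧ Commute (θ a) v ∧ u ^ q = 1 ∧ v ^ q = 1 ∧ u ≠ 1 ∧
          v ∉ Subgroup.zpowers u
    · obtain ⟨q, ha, hq, u, hu, v, hv, hau, hav, huq, hvq, hu1, hvu⟩ := hex
      have : Fact q.Prime := ⟨hq⟩
      obtain ⟨B, _, θB, hB, hBcard, hBinj, hBcomm⟩ := exists_elementaryAbelian huq hvq
        (hl.commute a ha u hu v hv hau hav) hu1 hvu
      obtain ⟨j, hj⟩ := h.exists_hasAbelianFixedPoints hB hBcard θB hBinj
      refine ⟨max l j, fun k hk _ q _ w hw z hz haw _ _ _ hw1 => (hw1 ?_).elim⟩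
      have hwl := derivedSeries_antitone G ((le_max_left l j).trans hk) hw
      exact hj.eq_one w (derivedSeries_antitone G ((le_max_right l j).trans hk) hw)
        (hBcomm w (hl.commute a ha w hwl u hu haw hau) (hl.commute a ha w hwl v hv haw hav))
    · push Not at hex
      exact ⟨l, fun k hk ha q hq u hu v hv hau hav huq hvq hu1 => hex q ha hq u
        (derivedSeries_antitone G hk hu) v (derivedSeries_antitone G hk hv) hau hav huq hvq hu1⟩
  choose k₀ hk₀ using key
  refine ⟨max l (Finset.univ.sup k₀), hl.mono (derivedSeries_antitone G (le_max_left _ _)),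
    fun a ha => hk₀ a _ ((Finset.le_sup (Finset.mem_univ a)).trans (le_max_right _ _)) ha⟩

end HasSmallCentralizers

/-! ### A proper characteristic subgroup with elementary abelian quotient -/

section PowerSubgroup

/-- The elements of `U` whose image in the abelianization is an `r`-th power. -/
def commutatorPow (U : Type*) [Group U] (r : ℕ) : Subgroup U :=
  (powMonoidHom r : Abelianization U →* Abelianization U).range.comap Abelianization.of

instance commutatorPow_characteristic (U : Type*) [Group U] (r : ℕ) :
    (commutatorPow U r).Characteristic := by
  refine Subgroup.characteristic_iff_le_comap.2 fun φ x hx => ?_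
  obtain ⟨w, hw⟩ := hx
  refine ⟨φ.abelianizationCongr w, ?_⟩
  change (φ.abelianizationCongr w) ^ r = φ.abelianizationCongr (Abelianization.of x)
  rw [← hw, powMonoidHom_apply, map_pow]

theorem exists_commutatorPow_ne_top (U : Type*) [Group U] [Finite U] [Nontrivial U]
    [Group.IsSolvable U] : ∃ r : ℕ, r.Prime ∧ commutator U ≤ commutatorPow U r ∧
      (∀ u, u ^ r ∈ commutatorPow U r) ∧ commutatorPow U r ≠ ⊤ := by
  have hnt : Nontrivial (Abelianization U) := by
    by_contra hn
    rw [not_nontrivial_iff_subsingleton] at hn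
    refine (Group.IsSolvable.commutator_lt_top_of_nontrivial U).ne (eq_top_iff.2 fun u _ => ?_)
    rw [← Abelianization.ker_of]
    exact MonoidHom.mem_ker.2 (Subsingleton.elim _ _)
  obtain ⟨r, hr, hrd⟩ := Nat.exists_prime_and_dvd
    (Finite.one_lt_card (α := Abelianization U)).ne'
  have : Fact r.Prime := ⟨hr⟩
  refine ⟨r, hr, ?_, fun u => ⟨Abelianization.of u, (map_pow _ _ _).symm⟩, fun htop => ?_⟩
  · rw [← Abelianization.ker_of]
    exact MonoidHom.ker_le_comap _ _
  · have hsurj : Function.Surjective (powMonoidHom r : Abelianization U →* Abelianization U) := by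
      intro w
      obtain ⟨u, rfl⟩ := QuotientGroup.mk_surjective w
      have hu : u ∈ commutatorPow U r := htop ▸ Subgroup.mem_top u
      exact hu
    obtain ⟨w, hw⟩ := exists_prime_orderOf_dvd_card' r hrd
    have hinj := Finite.injective_iff_surjective.2 hsurj
    have hw1 : w = 1 := hinj (by
      change w ^ r = 1 ^ r
      rw [one_pow, ← hw, pow_orderOf_eq_one])
    rw [hw1, orderOf_one] at hw
    exact hr.ne_one hw.symm

end PowerSubgroup

/-! ### Cyclic centralizers in finite subgroups -/

section FixedPoints

variable {G : Type u} [Group G] {A : Type*} [CommGroup A] {p : ℕ} {θ : A →* G} {M : Subgroup G}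

theorem HasAbelianFixedPoints.exists_generator (hM : HasAbelianFixedPoints p θ M) {a : A}
    (ha : a ≠ 1) (hcyc : ∀ q : ℕ, q.Prime → ∀ u ∈ M, ∀ v ∈ M, Commute (θ a) u →
      Commute (θ a) v → u ^ q = 1 → v ^ q = 1 → u ≠ 1 → v ∈ Subgroup.zpowers u)
    (K : Subgroup G) [Finite K] (hK : K ≤ M) :
    ∃ g ∈ K, ∀ x ∈ K, Commute (θ a) x → x ∈ Subgroup.zpowers g := by
  set C := K ⊓ Subgroup.centralizer {θ a} with hC
  have hCK : C ≤ K := inf_le_left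
  have hCa : ∀ x : C, Commute (θ a) x := fun x =>
    (Subgroup.mem_centralizer_singleton_iff.1 x.2.2).symm
  have : Finite C := Finite.of_injective _ (Subgroup.inclusion_injective hCK)
  have hcomm : ∀ x y : C, Commute x y := fun x y => Subtype.ext
    (hM.commute a ha x (hK (hCK x.2)) y (hK (hCK y.2)) (hCa x) (hCa y)).eq
  have hr : HasPrimeRankOne C := by
    intro q hq x y hx hy _ hx1
    obtain ⟨i, hi⟩ := hcyc q hq x (hK (hCK x.2)) y (hK (hCK y.2)) (hCa x) (hCa y)
      (congrArg Subtype.val hx) (congrArg Subtype.val hy) (fun h => hx1 (Subtype.ext h))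
    exact ⟨i, Subtype.ext hi⟩
  obtain ⟨g, hg⟩ := (hr.isCyclic hcomm).exists_generator
  refine ⟨g, hCK g.2, fun x hx hax => ?_⟩
  obtain ⟨i, hi⟩ := hg ⟨x, hx, Subgroup.mem_centralizer_singleton_iff.2 hax.symm.eq⟩
  exact ⟨i, congrArg Subtype.val hi⟩

end FixedPoints

/-! ### Deep derived terms are abelian -/

section Main

variable {G : Type u} [Group G] (h : HasSmallCentralizers G) {A : Type*} [CommGroup A] {p : ℕ}
  [hp : Fact p.Prime]

/-- An element of prime order of the derived group of `H` cannot act nontrivially on a finite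
group of coprime order when its action is trivial on all proper invariant subgroups. -/
theorem commute_of_mem_commutator (hA : ∀ a : A, a ^ p = 1) (hcard : Nat.card A = p ^ 2)
    {θ : A →* G} {M : Subgroup G} (hM : HasAbelianFixedPoints p θ M)
    (hcyc : ∀ a, a ≠ 1 → ∀ q : ℕ, q.Prime → ∀ u ∈ M, ∀ v ∈ M, Commute (θ a) u →
      Commute (θ a) v → u ^ q = 1 → v ^ q = 1 → u ≠ 1 → v ∈ Subgroup.zpowers u)
    {D H U : Subgroup G} [Finite H] [Group.IsSolvable H] [Finite U] [Group.IsSolvable U]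
    (hHM : H ≤ M) (hUM : U ≤ M) (hHD : H ≤ D) (hθD : ∀ a, θ a ∈ D)
    (hHA : ∀ a, ∀ x ∈ H, θ a * x * (θ a)⁻¹ ∈ H) (hUD : ∀ d ∈ D, ∀ u ∈ U, d * u * d⁻¹ ∈ U)
    (hco : (Nat.card H).Coprime (Nat.card U)) {s : ℕ} [hs : Fact s.Prime] {x : G}
    (hx : x ∈ ⁅H, H⁆) (hxs : orderOf x = s)
    (hmin : ∀ V : Subgroup G, V < U → (∀ d ∈ D, ∀ u ∈ V, d * u * d⁻¹ ∈ V) →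
      ∀ v ∈ V, Commute x v) : ∀ u ∈ U, Commute x u := by
  rcases subsingleton_or_nontrivial U with hU1 | hU1
  · intro u hu
    have : u = 1 := congrArg Subtype.val (Subsingleton.elim (⟨u, hu⟩ : U) 1)
    rw [this]; exact Commute.one_right x
  obtain ⟨r, hr, hrc, hrp, hrt⟩ := exists_commutatorPow_ne_top U
  have : Fact r.Prime := ⟨hr⟩
  set V := commutatorPow U r with hV
  have hpK : ∀ K : Subgroup G, Finite K → K ≤ M → ¬ p ∣ Nat.card K := fun K _ hK =>
    hp.out.coprime_iff_not_dvd.1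
      (coprime_card_of_forall_orderOf fun y hy => hM.coprime y (hK hy)).symm
  let Ψ : D →* MulAut U := restrictAction (MulAut.conj.comp D.subtype) U fun d => hUD d d.2
  have hΨ : ∀ (d : D) (u : U), ((Ψ d u : U) : G) = d * u * (d : G)⁻¹ := fun d u => rfl
  have hΨfix : ∀ (d : D) (u : U), Ψ d u = u ↔ Commute (d : G) u := fun d u => by
    rw [Subtype.ext_iff, hΨ, mul_inv_eq_iff_eq_mul]; rfl
  let H' := H.subgroupOf D
  let e : H' ≃* H := Subgroup.subgroupOfEquivOfLe hHD
  have : Finite H' := Finite.of_equiv _ e.symm.toEquiv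
  have : Group.IsSolvable H' := Group.isSolvable_of_isSolvable_injective (f := e.toMonoidHom)
    e.injective
  have hcardH : Nat.card H' = Nat.card H := Nat.card_congr e.toEquiv
  let θ' : A →* D := θ.codRestrict D hθD
  have hxH : x ∈ H := (Subgroup.commutator_le_self H) hx
  have hx' : (⟨x, hHD hxH⟩ : D) ∈ ⁅H', H'⁆ := by
    refine (Subgroup.mem_map_iff_mem D.subtype_injective).1 ?_
    rw [Subgroup.map_commutator, Subgroup.subgroupOf_map_subtype, inf_eq_left.2 hHD]
    exact hx
  have hpV : ∀ u : U, u⁻¹ * Ψ ⟨x, hHD hxH⟩ u ∈ V := by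
    refine inv_mul_map_mem_of_mem_commutator hA hcard θ' H' (fun a y hy => hHA a y hy)
      (hcardH ▸ hpK H inferInstance hHM) Ψ (hpK U inferInstance hUM) (hcardH ▸ hco)
      (fun a ha => ?_) (fun a ha => ?_) (fun a ha y hy hay u hu => ?_) (fun y hy hay => ?_)
      (r := r) V hrc hrp hx'
    · obtain ⟨g, hgH, hg⟩ := hM.exists_generator ha (hcyc a ha) H hHM
      refine ⟨⟨g, hHD hgH⟩, fun y hy hay => ?_⟩
      obtain ⟨i, hi⟩ := hg y hy (congrArg Subtype.val hay)
      exact ⟨i, Subtype.ext hi⟩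
    · obtain ⟨g, hgU, hg⟩ := hM.exists_generator ha (hcyc a ha) U hUM
      refine ⟨⟨g, hgU⟩, fun u hu => ?_⟩
      obtain ⟨i, hi⟩ := hg u u.2 ((hΨfix _ _).1 hu)
      exact ⟨i, Subtype.ext hi⟩
    · exact (hΨfix _ _).2 (hM.commute a ha y (hHM hy) u (hUM u.2) (congrArg Subtype.val hay)
        ((hΨfix _ _).1 hu))
    · exact Subtype.ext (hM.eq_one y (hHM hy) fun a => congrArg Subtype.val (hay a))
  have hVU : V.map U.subtype < U := by
    refine lt_of_le_of_ne (Subgroup.map_subtype_le V) fun heq => hrt (eq_top_iff.2 fun u _ => ?_)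
    have hu : (u : G) ∈ V.map U.subtype := heq.ge u.2
    exact (Subgroup.mem_map_iff_mem U.subtype_injective).1 hu
  have hVx := hmin (V.map U.subtype) hVU (by
    rintro d hd _ ⟨v, hv, rfl⟩
    exact ⟨Ψ ⟨d, hd⟩ v, Subgroup.characteristic_iff_map_le.1 inferInstance (Ψ ⟨d, hd⟩)
      (Subgroup.mem_map_of_mem _ hv), rfl⟩)
  intro u hu
  -- `x` acts trivially on the quotient by `V`, so it fixes a point of each coset; by minimality it
  -- also fixes `V` pointwise.
  obtain ⟨n, hn, hfix⟩ := exists_fixed_mul_of_pow_eq_one (p := s) (n := 1)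
    (α := Ψ ⟨x, hHD hxH⟩) (by
      have hx1 : (⟨x, hHD hxH⟩ : D) ^ s = 1 := Subtype.ext (by
        change x ^ s = 1
        rw [← hxs, pow_orderOf_eq_one])
      rw [pow_one, ← map_pow, hx1, map_one]) V
    (fun n hn => Subgroup.characteristic_iff_map_le.1 inferInstance _
      (Subgroup.mem_map_of_mem _ hn))
    (fun hd => hs.out.one_lt.ne' (Nat.dvd_one.1 (hco ▸ Nat.dvd_gcd
      (hxs ▸ Subgroup.orderOf_dvd_natCard H hxH) (hd.trans (Subgroup.card_subgroup_dvd_card V)))))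
    ⟨u, hu⟩ (hpV ⟨u, hu⟩)
  have h1 : Commute x (u * (n : G)) := (hΨfix _ _).1 hfix
  have h2 : Commute x (n : G) := hVx n (Subgroup.mem_map_of_mem _ hn)
  have h3 := h1.mul_right h2.inv_right
  rwa [mul_inv_cancel_right] at h3

include h in
theorem HasSmallCentralizers.commutator_eq_bot [Nontrivial G] (hA : ∀ a : A, a ^ p = 1)
    (hcard : Nat.card A = p ^ 2) {θ : A →* G} {l : ℕ}
    (hM : HasAbelianFixedPoints p θ (derivedSeries G l))
    (hcyc : ∀ a, a ≠ 1 → ∀ q : ℕ, q.Prime → ∀ u ∈ derivedSeries G l, ∀ v ∈ derivedSeries G l,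
      Commute (θ a) u → Commute (θ a) v → u ^ q = 1 → v ^ q = 1 → u ≠ 1 → v ∈ Subgroup.zpowers u)
    {H : Subgroup G} [Finite H] (hHM : H ≤ derivedSeries G l)
    (hHA : ∀ a, ∀ x ∈ H, θ a * x * (θ a)⁻¹ ∈ H) : ⁅H, H⁆ = ⊥ := by
  by_contra hne
  obtain ⟨y, hy, hy1⟩ := (Subgroup.bot_or_exists_ne_one ⁅H, H⁆).resolve_left hne
  have hyo : orderOf y ≠ 1 := fun h1 => hy1 (orderOf_eq_one_iff.1 h1)
  obtain ⟨s, hs, hsd⟩ := Nat.exists_prime_and_dvd hyo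
  have : Fact s.Prime := ⟨hs⟩
  set x := y ^ (orderOf y / s) with hxdef
  have hxs : orderOf x = s := orderOf_pow_orderOf_div (h.isOfFinOrder _).orderOf_pos.ne' hsd
  have hx : x ∈ ⁅H, H⁆ := pow_mem hy _
  have hAfin : Finite A := Nat.finite_of_card_ne_zero (by
    rw [hcard]; exact pow_ne_zero _ hp.out.ne_zero)
  set D := Subgroup.closure ((H : Set G) ∪ Set.range θ) with hD
  have hDfin : Finite D := h.finite_closure _ ((Set.toFinite _).union (Set.finite_range θ))
  have hHD : H ≤ D := fun z hz => Subgroup.subset_closure (Or.inl hz)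
  have hθD : ∀ a, θ a ∈ D := fun a => Subgroup.subset_closure (Or.inr ⟨a, rfl⟩)
  obtain ⟨k, hk⟩ := h.exists_coprime_orderOf (m := Nat.card H) Nat.card_pos.ne'
  set N := derivedSeries G (max k l) with hN
  have hNM : N ≤ derivedSeries G l := derivedSeries_antitone G (le_max_right k l)
  have hbot := h.centralizer_eq_bot (h.derivedSeries_ne_bot (max k l))
  obtain ⟨u, huN, hxu⟩ : ∃ u ∈ N, ¬ Commute x u := by
    by_contra hcon
    push Not at hcon
    have hx1 : x ∈ Subgroup.centralizer (N : Set G) := Subgroup.mem_centralizer_iff.2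
      fun u hu => (hcon u hu).symm.eq
    rw [hbot, Subgroup.mem_bot] at hx1
    rw [hx1, orderOf_one] at hxs
    exact hs.ne_one hxs.symm
  obtain ⟨U₀, hU₀fin, hU₀N, huU₀, hU₀D⟩ := h.exists_finite_conj_invariant D huN
  -- `N` was taken deep enough to have elements of order prime to |H|, and its centralizer is
  -- trivial, so a finite invariant `U` not centralized by `x` exists; one of least order is chosen.
  obtain ⟨U, ⟨hUfin, hUN, hUD, w, hwU, hxw⟩, hmin⟩ := WellFounded.has_min
    (measure fun U : Subgroup G => Nat.card U).wf
    {U | Finite U ∧ U ≤ N ∧ (∀ d ∈ D, ∀ x ∈ U, d * x * d⁻¹ ∈ U) ∧ ∃ u ∈ U, ¬ Commute x u}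
    ⟨U₀, hU₀fin, hU₀N, hU₀D, u, huU₀, hxu⟩
  have hsolH := h.isSolvable_of_finite H
  have hsolU := h.isSolvable_of_finite U
  refine hxw (commute_of_mem_commutator hA hcard hM hcyc hHM (hUN.trans hNM) hHD hθD hHA hUD
    (coprime_card_of_forall_orderOf fun z hz => hk _ (le_max_left k l) z (hUN hz)).symm hx hxs
    (fun V hVU hVD v hv => ?_) w hwU)
  by_contra hxv
  have hVfin : Finite V := Finite.of_injective _ (Subgroup.inclusion_injective hVU.le)
  refine hmin V ⟨hVfin, hVU.le.trans hUN, hVD, v, hv, hxv⟩ ?_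
  change Nat.card V < Nat.card U
  by_contra hge
  exact hVU.ne (Subgroup.eq_of_le_of_card_ge hVU.le (not_lt.1 hge))

include h in
theorem HasSmallCentralizers.subsingleton : Subsingleton G := by
  by_contra hns
  rw [not_subsingleton_iff_nontrivial] at hns
  have hnr := h.not_hasPrimeRankOne
  unfold HasPrimeRankOne at hnr
  push Not at hnr
  obtain ⟨p, hp, x, y, hx, hy, hxy, hx1, hyx⟩ := hnr
  have : Fact p.Prime := ⟨hp⟩
  obtain ⟨A, _, θ, hA, hcard, hθ, -⟩ := exists_elementaryAbelian hx hy hxy hx1 hyx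
  obtain ⟨l, hM, hcyc⟩ := h.exists_hasAbelianFixedPoints_cyclic hA hcard θ hθ
  have hAfin : Finite A := Nat.finite_of_card_ne_zero (by
    rw [hcard]; exact pow_ne_zero _ hp.ne_zero)
  refine h.derivedSeries_ne_bot (l + 1) ?_
  rw [derivedSeries_succ, Subgroup.commutator_eq_bot_iff_le_centralizer]
  intro u hu
  refine Subgroup.mem_centralizer_iff.2 fun v hv => ?_
  set H := Subgroup.closure ((Set.range fun a => θ a * u * (θ a)⁻¹) ∪
    Set.range fun a => θ a * v * (θ a)⁻¹) with hH
  have hHfin : Finite H := h.finite_closure _ ((Set.finite_range _).union (Set.finite_range _))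
  have hn : (derivedSeries G l).Normal := inferInstance
  have hHM : H ≤ derivedSeries G l := by
    rw [hH, Subgroup.closure_le]
    rintro _ (⟨a, rfl⟩ | ⟨a, rfl⟩)
    · exact hn.conj_mem u hu _
    · exact hn.conj_mem v hv _
  have hHA : ∀ a, ∀ z ∈ H, θ a * z * (θ a)⁻¹ ∈ H := by
    intro a
    have hle : H ≤ H.comap (MulAut.conj (θ a)).toMonoidHom := by
      conv_lhs => rw [hH]
      rw [Subgroup.closure_le]
      have e : ∀ b w, θ a * (θ b * w * (θ b)⁻¹) * (θ a)⁻¹ = θ (a * b) * w * (θ (a * b))⁻¹ := by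
        intro b w
        rw [map_mul]; group
      rintro _ (⟨b, rfl⟩ | ⟨b, rfl⟩)
      · exact Subgroup.subset_closure (Or.inl ⟨a * b, (e b u).symm⟩)
      · exact Subgroup.subset_closure (Or.inr ⟨a * b, (e b v).symm⟩)
    exact fun z hz => hle hz
  have huH : u ∈ H := Subgroup.subset_closure (Or.inl ⟨1, by simp⟩)
  have hvH : v ∈ H := Subgroup.subset_closure (Or.inr ⟨1, by simp⟩)
  have hbot := h.commutator_eq_bot hA hcard hM hcyc hHM hHA
  rw [Subgroup.commutator_eq_bot_iff_le_centralizer] at hbot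
  exact Subgroup.mem_centralizer_iff.1 (hbot huH) v hvH

end Main

end SubIcc
theorem mainTheorem2 (G : Type u) [Group G]
    (hper : IsMulTorsion G)
    (hsol : SubIcc.IsLocallySoluble G)
    (hicc : SubIcc.IsSubIcc.{u, v} G)
    (hmin : ∀ p : ℕ, p.Prime → ∀ P : Subgroup G, IsPGroup p P → SubIcc.MinimalCondition P) :
    SubIcc.IsVirtuallyAbelian G :=
  SubIcc.isVirtuallyAbelian_of_centralizerDCC
    (fun _ _ h hfc hva => SubIcc.HasSmallCentralizers.subsingleton ⟨h, hfc, hva⟩)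
    (hsol.isLocFinSolMin hper hmin) hicc.centralizerDCC
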